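/- **Theorem (Region of local optimality).** *Plant and constraints.* Let $x^+=Ax+Bu$, $y=Cx+Du$ with $x\in\mathbb R^n$, $u\in\mathbb R^m$, $y\in\mathbb R^p$. Let $\mathcal Z\subset\mathbb R^{n+m}$ be a closed convex polyhedron with the origin in its interior whose projection onto $u$ is compact. Let $\lambda\in[0,1)$, $\mathcal Z_{sp}=\{(x_s,u_s): x_s=Ax_s+Bu_s,\ (x_s,u_s)\in\lambda\mathcal Z\}$ and $\mathcal Y_{sp}=\{Cx_s+Du_s:(x_s,u_s)\in\mathcal Z_{sp}\}$. Assume that $x=Ax+Bu$ and $Cx+Du=0$ imply $x=0$, $u=0$, so that a setpoint determines its equilibrium. *Design.* Let $R\succ0$, $Q\succeq0$ with $(Q^{1/2},A)$ observable, $N\ge1$. Let $P\succ0$ and $K$ be the cost matrix and the gain of the unconstrained LQR: $(R+B'PB)K=-B'PA$, $P=Q+K'RK+(A+BK)'P(A+BK)$, with all eigenvalues of $A+BK$ in the open unit disc (so $(A,B)$ is stabilizable). Let $\Omega_t^a$ be a polyhedron such that every $(x,x_a,u_a)\in\Omega_t^a$ satisfies $(x,K(x-x_a)+u_a)\in\mathcal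 Z$, $(x_a,u_a)\in\mathcal Z_{sp}$ and $(Ax+B(K(x-x_a)+u_a),x_a,u_a)\in\Omega_t^a$, and such that for every $(x_a,u_a)\in\mathcal Z_{sp}$ the set $\{x:(x,x_a,u_a)\in\Omega_t^a\}$ is a neighbourhood of $x_a$. Both polyhedra are given by finite systems of linear inequalities. *Controllers.* Fix $y_{sp}\in\mathcal Y_{sp}$, with equilibrium $(x_{sp},u_{sp})\in\mathcal Z_{sp}$. For $\mathbf u=(u(0),\dots,u(N-1))$, $x(0)=x$, $x(j+1)=Ax(j)+Bu(j)$ and $y_a=Cx_a+Du_a$ put $$V(x;\mathbf u,x_a,u_a)=\sum_{j=0}^{N-1}\big(\|x(j)-x_a\|_Q^2+\|u(j)-u_a\|_R^2\big)+\|x(N)-x_a\|_P^2 .$$ The MPCT law $\kappa_N(x,y_{sp})$ is the first input $u(0)$ of a minimizer of $V+V_O(y_a,y_{sp})$ over $(\mathbf u,x_a,u_a)$ subject to $(x(j),u(j))\in\mathcal Z$ for $0\le j<N$ and $(x(N),x_a,u_a)\in\Omega_t^a$. The regulation law $\kappa_N^r(x,y_{sp})$ is the first input of a minimizer of $V$ under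 the same constraints together with $y_a=y_{sp}$; $\mathcal X_N^r(y_{sp})$ is the set of $x$ for which this second problem is feasible. We say that $V_O$ is *admissible for* $\gamma$ if $V_O(\cdot,y_{sp})$ is convex, $V_O(y_{sp},y_{sp})=0$, $V_O(y,y_{sp})>0$ for $y\ne y_{sp}$, and $V_O(y,y_{sp})\ge\gamma\|y-y_{sp}\|_\infty$ for all $y\in\mathcal Y_{sp}$ (for example $V_O=\gamma\|y-y_{sp}\|_1$, $\gamma>0$). A law is admissible from $x$ if its closed loop from $x$ satisfies the constraint $\mathcal Z$ at all times. $\kappa_\infty(\cdot,y_{sp})$ denotes a law that, from every state from which some admissible law has finite cost, is admissible and minimizes $\sum_{j\ge0}\|x(j)-x_{sp}\|_Q^2+\|u(j)-u_{sp}\|_R^2$ over the admissible laws. $\phi(i;x,\kappa)$ denotes the closed-loop state at time $i$, and $\Upsilon_N(y_{sp})$ is the set of $x$ in this domain of $\kappa_\infty$ with $(\phi(N;x,\kappa_\infty),x_{sp},u_{sp})\in\Omega_t^a$. *Multipliers.* $\Gamma$ is the set of $(x,y)$ with $x\in\mathcal X_N^r(y)$. $\Gamma(\gamma)$ is the set of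 $(x,y)$ at which the KKT conditions of the regulation problem hold for some primal point and multipliers, $\nu$ being the multiplier of $y_a-y=0$, with $\|\nu\|_1\le\gamma$. $\gamma_{min}$ and $\gamma_{max}$ are the infimum and the supremum over $\Gamma$, in $[-\infty,\infty]$, of $\|\nu(x,y)\|_1$ (of its least value, where $\nu$ is not unique). For $V_O$ admissible for $\gamma$ let $$\mathcal W(\gamma,y_{sp})=\{x\in\Upsilon_N(y_{sp}) : (\phi(i;x,\kappa_N(\cdot,y_{sp})),y_{sp})\in\Gamma(\gamma)\ \ \forall i\ge0\}.$$ Then, whichever minimizers define the laws: 1. For every $\gamma>\gamma_{min}$ and $V_O$ admissible for $\gamma$, $\mathcal W(\gamma,y_{sp})$ is non-empty and positively invariant for $x^+=Ax+B\kappa_N(x,y_{sp})$; if $\mathcal Z$ is bounded, it is a polygon, that is, a (possibly nonconvex) union of finitely many closed convex polyhedra. 2. If $\gamma_{min}<\gamma_a\le\gamma_b$, then $\mathcal W(\gamma_a,y_{sp})\subseteq\mathcal W(\gamma_b,y_{sp})$, where the two sets may be formed with different offset costs, admissible for $\gamma_a$ and for $\gamma_b$ respectively. 3. Let $\gamma>\gamma_{min}$,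 $V_O$ be admissible for $\gamma$, $x(0)\in\mathcal X_N^r(y_{sp})$, and let $x(k)$ be the closed-loop trajectory under $\kappa_N(\cdot,y_{sp})$. (a) There is $\bar k$ such that $x(\bar k)\in\mathcal W(\gamma,y_{sp})$ and $\kappa_N(x(k),y_{sp})=\kappa_\infty(x(k),y_{sp})$ for all $k\ge\bar k$. (b) If $\gamma\ge\gamma_{max}$, then $\kappa_N(x(k),y_{sp})=\kappa_N^r(x(k),y_{sp})$ for all $k\ge0$, and there is $\bar k$ such that $x(\bar k)\in\Upsilon_N(y_{sp})$ and $\kappa_N(x(k),y_{sp})=\kappa_\infty(x(k),y_{sp})$ for all $k\ge\bar k$. -/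

import Mathlib

open Matrix Topology
open scoped Pointwise

noncomputable section

/-- Data of the plant `x⁺ = A x + B u`, `y = C x + D u`, of the constraint polyhedra and of the
predictive controllers.  The constraint set is `{(x,u) | Gx x + Gu u ≤ w}`, the extended terminal
set is `{(x,xa,ua) | Hx x + Ha xa + Hu ua ≤ h}`; `N` is the prediction horizon, `Q`, `R` are the
stage weights, `P` the terminal weight, `K` the terminal gain and `lam` the factor that tightens
the constraints for the steady states. -/
structure MPCData (n m p : ℕ) where
  A : Matrix (Fin n) (Fin n) ℝ
  B : Matrix (Fin n) (Fin m) ℝ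
  C : Matrix (Fin p) (Fin n) ℝ
  D : Matrix (Fin p) (Fin m) ℝ
  Q : Matrix (Fin n) (Fin n) ℝ
  R : Matrix (Fin m) (Fin m) ℝ
  P : Matrix (Fin n) (Fin n) ℝ
  K : Matrix (Fin m) (Fin n) ℝ
  lam : ℝ
  N : ℕ
  N_pos : 0 < N
  rZ : ℕ
  Gx : Matrix (Fin rZ) (Fin n) ℝ
  Gu : Matrix (Fin rZ) (Fin m) ℝ
  w : Fin rZ → ℝ
  rO : ℕ
  Hx : Matrix (Fin rO) (Fin n) ℝ
  Ha : Matrix (Fin rO) (Fin n) ℝ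
  Hu : Matrix (Fin rO) (Fin m) ℝ
  h : Fin rO → ℝ

/-- Decision variables `(u(0),…,u(N-1); x_a, u_a)`. -/
abbrev MPCDecision (N n m : ℕ) : Type :=
  (Fin N → Fin m → ℝ) × (Fin n → ℝ) × (Fin m → ℝ)

/-- `‖v‖²_M = v' M v`. -/
def quadForm {k : ℕ} (M : Matrix (Fin k) (Fin k) ℝ) (v : Fin k → ℝ) : ℝ := v ⬝ᵥ (M *ᵥ v)

/-- All (complex) eigenvalues lie in the open unit disc. -/
def IsSchur {k : ℕ} (M : Matrix (Fin k) (Fin k) ℝ) : Prop :=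
  ∀ μ ∈ spectrum ℂ (M.map (fun a : ℝ => (a : ℂ))), ‖μ‖ < 1

/-- A closed convex polyhedron: solution set of finitely many (weak) linear inequalities. -/
def IsPolyhedron {k : ℕ} (S : Set (Fin k → ℝ)) : Prop :=
  ∃ (r : ℕ) (M : Matrix (Fin r) (Fin k) ℝ) (b : Fin r → ℝ), S = {x | M *ᵥ x ≤ b}

/-- A (possibly nonconvex) polygon: the union of finitely many closed convex polyhedra. -/
def IsPolygon {k : ℕ} (S : Set (Fin k → ℝ)) : Prop :=
  ∃ (r : ℕ) (T : Fin r → Set (Fin k → ℝ)), (∀ i, IsPolyhedron (T i)) ∧ S = ⋃ i, T i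

namespace MPCData

variable {n m p : ℕ} (d : MPCData n m p)

/-- The constraint set `𝒵` of pairs `(x,u)`. -/
def Z : Set ((Fin n → ℝ) × (Fin m → ℝ)) := {q | d.Gx *ᵥ q.1 + d.Gu *ᵥ q.2 ≤ d.w}

/-- The extended terminal set `Ω_t^a` of triples `(x,x_a,u_a)`. -/
def Omega : Set ((Fin n → ℝ) × (Fin n → ℝ) × (Fin m → ℝ)) :=
  {q | d.Hx *ᵥ q.1 + d.Ha *ᵥ q.2.1 + d.Hu *ᵥ q.2.2 ≤ d.h}

/-- Admissible equilibria: `x_s = A x_s + B u_s` and `(x_s,u_s) ∈ λ 𝒵`. -/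
def Zsp : Set ((Fin n → ℝ) × (Fin m → ℝ)) :=
  {q | q.1 = d.A *ᵥ q.1 + d.B *ᵥ q.2 ∧ q ∈ d.lam • d.Z}

/-- Reachable setpoints. -/
def Ysp : Set (Fin p → ℝ) := {y | ∃ q ∈ d.Zsp, y = d.C *ᵥ q.1 + d.D *ᵥ q.2}

/-- Standing assumptions on the plant, the constraints and the design parameters. -/
structure Assumptions : Prop where
  /-- the origin lies in the interior of the constraint set -/
  zero_mem : (0 : (Fin n → ℝ) × (Fin m → ℝ)) ∈ interior d.Z
  /-- admissible inputs are bounded: the projection of the constraint set is compact -/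
  proj_compact : IsCompact (Prod.snd '' d.Z)
  lam_nonneg : 0 ≤ d.lam
  lam_lt_one : d.lam < 1
  /-- a setpoint determines its equilibrium point: the matrix with block rows
  `(A - I, B)` and `(C, D)` has trivial kernel -/
  equilibrium_unique : ∀ (x : Fin n → ℝ) (u : Fin m → ℝ),
    x = d.A *ᵥ x + d.B *ᵥ u → d.C *ᵥ x + d.D *ᵥ u = 0 → x = 0 ∧ u = 0
  R_posDef : d.R.PosDef
  Q_posSemidef : d.Q.PosSemidef
  /-- observability of `(Q^{1/2}, A)`; `Q` and `Q^{1/2}` have the same kernel -/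
  observable : ∀ v : Fin n → ℝ, (∀ j : ℕ, d.Q *ᵥ ((d.A ^ j) *ᵥ v) = 0) → v = 0
  /-- the terminal gain is stabilizing (in particular `(A,B)` is stabilizable) -/
  schur : IsSchur (d.A + d.B * d.K)
  P_posDef : d.P.PosDef
  /-- `K` is the gain of the unconstrained LQR with cost matrix `P` -/
  lqr_gain : (d.R + d.Bᵀ * d.P * d.B) * d.K = -(d.Bᵀ * d.P * d.A)
  /-- `x' P x` is the optimal cost of the unconstrained LQR -/
  lqr_cost : d.P = d.Q + d.Kᵀ * d.R * d.K + (d.A + d.B * d.K)ᵀ * d.P * (d.A + d.B * d.K)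
  /-- the terminal set is an admissible invariant set for tracking -/
  omega_adm : ∀ x xa ua, (x, xa, ua) ∈ d.Omega → (x, d.K *ᵥ (x - xa) + ua) ∈ d.Z
  omega_eq : ∀ x xa ua, (x, xa, ua) ∈ d.Omega → (xa, ua) ∈ d.Zsp
  omega_inv : ∀ x xa ua, (x, xa, ua) ∈ d.Omega →
    (d.A *ᵥ x + d.B *ᵥ (d.K *ᵥ (x - xa) + ua), xa, ua) ∈ d.Omega
  /-- for each admissible equilibrium the terminal region is a neighbourhood of it -/
  omega_nhds : ∀ xa ua, (xa, ua) ∈ d.Zsp → {x | (x, xa, ua) ∈ d.Omega} ∈ 𝓝 xa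

/-- `(xsp, usp)` is the admissible equilibrium point associated with the setpoint `ysp`. -/
def IsSetpoint (ysp : Fin p → ℝ) (xsp : Fin n → ℝ) (usp : Fin m → ℝ) : Prop :=
  (xsp, usp) ∈ d.Zsp ∧ ysp = d.C *ᵥ xsp + d.D *ᵥ usp

/-- Assumptions on the offset cost at the setpoint `ysp`: it is convex and positive definite, and
on the reachable setpoints it is at least `γ` times the distance in the max norm
(as are `γ‖y - ysp‖_q`, `1 ≤ q ≤ ∞`). -/
structure IsOffsetCost (VO : (Fin p → ℝ) → (Fin p → ℝ) → ℝ) (ysp : Fin p → ℝ) (γ : ℝ) :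
    Prop where
  convex : ConvexOn ℝ Set.univ (fun y => VO y ysp)
  zero : VO ysp ysp = 0
  pos : ∀ y, y ≠ ysp → 0 < VO y ysp
  lower : ∀ y ∈ d.Ysp, γ * ‖y - ysp‖ ≤ VO y ysp

/-- Predicted state `x(j)` under the inputs `u(0),…,u(N-1)` (used for `j ≤ N` only). -/
def pred (x : Fin n → ℝ) (u : Fin d.N → Fin m → ℝ) : ℕ → (Fin n → ℝ)
  | 0 => x
  | j + 1 => d.A *ᵥ pred x u j + d.B *ᵥ (if hj : j < d.N then u ⟨j, hj⟩ else 0)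

/-- Artificial output `y_a = C x_a + D u_a`. -/
def output (z : MPCDecision d.N n m) : Fin p → ℝ := d.C *ᵥ z.2.1 + d.D *ᵥ z.2.2

/-- Regulation cost
`∑_{j<N} (‖x(j) - x_a‖²_Q + ‖u(j) - u_a‖²_R) + ‖x(N) - x_a‖²_P`. -/
def regCost (x : Fin n → ℝ) (z : MPCDecision d.N n m) : ℝ :=
  (∑ j : Fin d.N, (quadForm d.Q (d.pred x z.1 j - z.2.1) + quadForm d.R (z.1 j - z.2.2)))
    + quadForm d.P (d.pred x z.1 d.N - z.2.1)

/-- Cost of the tracking MPC. -/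
def trackCost (VO : (Fin p → ℝ) → (Fin p → ℝ) → ℝ) (ysp : Fin p → ℝ) (x : Fin n → ℝ)
    (z : MPCDecision d.N n m) : ℝ :=
  d.regCost x z + VO (d.output z) ysp

/-- Constraints of the tracking MPC problem. -/
def TrackFeasible (x : Fin n → ℝ) (z : MPCDecision d.N n m) : Prop :=
  (∀ j : Fin d.N, (d.pred x z.1 j, z.1 j) ∈ d.Z) ∧ (d.pred x z.1 d.N, z.2.1, z.2.2) ∈ d.Omega

/-- Constraints of the regulation MPC problem. -/
def RegFeasible (x : Fin n → ℝ) (ysp : Fin p → ℝ) (z : MPCDecision d.N n m) : Prop :=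
  d.TrackFeasible x z ∧ d.output z = ysp

/-- Feasible region `𝒳_N` of the tracking MPC. -/
def trackRegion : Set (Fin n → ℝ) := {x | ∃ z, d.TrackFeasible x z}

/-- Feasible region `𝒳_N^r(ysp)` of the regulation MPC. -/
def regRegion (ysp : Fin p → ℝ) : Set (Fin n → ℝ) := {x | ∃ z, d.RegFeasible x ysp z}

/-- First input of a decision. -/
def firstInput (z : MPCDecision d.N n m) : Fin m → ℝ := z.1 ⟨0, d.N_pos⟩

/-- `κ = κ_N(·, ysp)`: at every feasible state it applies the first input of an optimal solution
of the tracking MPC problem. -/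
def IsTrackLaw (VO : (Fin p → ℝ) → (Fin p → ℝ) → ℝ) (ysp : Fin p → ℝ)
    (κ : (Fin n → ℝ) → (Fin m → ℝ)) : Prop :=
  ∀ x ∈ d.trackRegion, ∃ z, d.TrackFeasible x z ∧
    (∀ z', d.TrackFeasible x z' → d.trackCost VO ysp x z ≤ d.trackCost VO ysp x z') ∧
    κ x = d.firstInput z

/-- `κ = κ_N^r(·, ysp)`: at every feasible state it applies the first input of an optimal solution
of the regulation MPC problem. -/
def IsRegLaw (ysp : Fin p → ℝ) (κ : (Fin n → ℝ) → (Fin m → ℝ)) : Prop :=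
  ∀ x ∈ d.regRegion ysp, ∃ z, d.RegFeasible x ysp z ∧
    (∀ z', d.RegFeasible x ysp z' → d.regCost x z ≤ d.regCost x z') ∧
    κ x = d.firstInput z

/-- Closed-loop trajectory `φ(k; x, κ)`. -/
def closedLoop (κ : (Fin n → ℝ) → (Fin m → ℝ)) (x : Fin n → ℝ) : ℕ → (Fin n → ℝ)
  | 0 => x
  | k + 1 => d.A *ᵥ closedLoop κ x k + d.B *ᵥ κ (closedLoop κ x k)

/-- The law `κ` fulfils the constraints along the closed-loop trajectory from `x`. -/
def AdmissibleFrom (κ : (Fin n → ℝ) → (Fin m → ℝ)) (x : Fin n → ℝ) : Prop :=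
  ∀ k : ℕ, (d.closedLoop κ x k, κ (d.closedLoop κ x k)) ∈ d.Z

/-- Infinite-horizon cost-to-go `V_∞(x, ysp; κ)`, possibly infinite. -/
def costToGo (xsp : Fin n → ℝ) (usp : Fin m → ℝ) (κ : (Fin n → ℝ) → (Fin m → ℝ))
    (x : Fin n → ℝ) : ENNReal :=
  ∑' k : ℕ, ENNReal.ofReal (quadForm d.Q (d.closedLoop κ x k - xsp)
    + quadForm d.R (κ (d.closedLoop κ x k) - usp))

/-- States from which some admissible control law has finite infinite-horizon cost. -/
def optDomain (xsp : Fin n → ℝ) (usp : Fin m → ℝ) : Set (Fin n → ℝ) :=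
  {x | ∃ κ, d.AdmissibleFrom κ x ∧ d.costToGo xsp usp κ x < ⊤}

/-- `κ = κ_∞(·, ysp)`: admissible and of minimal infinite-horizon cost among the admissible
control laws, from every state of its domain. -/
def IsOptimalLaw (xsp : Fin n → ℝ) (usp : Fin m → ℝ) (κ : (Fin n → ℝ) → (Fin m → ℝ)) : Prop :=
  ∀ x ∈ d.optDomain xsp usp, d.AdmissibleFrom κ x ∧
    ∀ κ', d.AdmissibleFrom κ' x → d.costToGo xsp usp κ x ≤ d.costToGo xsp usp κ' x

/-- `Υ_N(ysp)`: the states (where `κ_∞` is defined) that `κ_∞` steers into the terminal region of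
the setpoint in `N` steps. -/
def Upsilon (xsp : Fin n → ℝ) (usp : Fin m → ℝ) (κinf : (Fin n → ℝ) → (Fin m → ℝ)) :
    Set (Fin n → ℝ) :=
  {x | x ∈ d.optDomain xsp usp ∧ (d.closedLoop κinf x d.N, xsp, usp) ∈ d.Omega}

/-- Left side minus right side of the inequality constraints at stage `j`. -/
def stageResidual (x : Fin n → ℝ) (z : MPCDecision d.N n m) (j : Fin d.N) : Fin d.rZ → ℝ :=
  d.Gx *ᵥ d.pred x z.1 j + d.Gu *ᵥ z.1 j - d.w

/-- Left side minus right side of the terminal inequality constraints. -/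
def terminalResidual (x : Fin n → ℝ) (z : MPCDecision d.N n m) : Fin d.rO → ℝ :=
  d.Hx *ᵥ d.pred x z.1 d.N + d.Ha *ᵥ z.2.1 + d.Hu *ᵥ z.2.2 - d.h

/-- Lagrangian of the regulation problem; `(lz, lo)` are the multipliers of the inequality
constraints and `ν` is the multiplier of the equality constraint `y_a - ysp = 0`. -/
def lagrangian (x : Fin n → ℝ) (ysp : Fin p → ℝ) (lz : Fin d.N → Fin d.rZ → ℝ)
    (lo : Fin d.rO → ℝ) (ν : Fin p → ℝ) (z : MPCDecision d.N n m) : ℝ :=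
  d.regCost x z + (∑ j : Fin d.N, lz j ⬝ᵥ d.stageResidual x z j)
    + lo ⬝ᵥ d.terminalResidual x z + ν ⬝ᵥ (d.output z - ysp)

/-- Karush-Kuhn-Tucker conditions of the regulation problem with parameters `(x, ysp)`. -/
structure IsKKT (x : Fin n → ℝ) (ysp : Fin p → ℝ) (z : MPCDecision d.N n m)
    (lz : Fin d.N → Fin d.rZ → ℝ) (lo : Fin d.rO → ℝ) (ν : Fin p → ℝ) : Prop where
  feasible : d.RegFeasible x ysp z
  lz_nonneg : ∀ j i, 0 ≤ lz j i
  lo_nonneg : ∀ i, 0 ≤ lo i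
  lz_compl : ∀ j i, lz j i * d.stageResidual x z j i = 0
  lo_compl : ∀ i, lo i * d.terminalResidual x z i = 0
  stationary : HasFDerivAt (d.lagrangian x ysp lz lo ν)
    (0 : MPCDecision d.N n m →L[ℝ] ℝ) z

/-- Lagrange multipliers of the equality constraint of the regulation problem. -/
def multipliers (x : Fin n → ℝ) (ysp : Fin p → ℝ) : Set (Fin p → ℝ) :=
  {ν | ∃ z lz lo, d.IsKKT x ysp z lz lo ν}

/-- `Γ(γ)`: parameters for which there are multipliers with `‖ν‖₁ ≤ γ`. -/
def Gam (γ : ℝ) : Set ((Fin n → ℝ) × (Fin p → ℝ)) :=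
  {q | ∃ ν ∈ d.multipliers q.1 q.2, ∑ i, |ν i| ≤ γ}

/-- `Γ`: all feasible parameters of the regulation problem. -/
def GamAll : Set ((Fin n → ℝ) × (Fin p → ℝ)) := {q | q.1 ∈ d.regRegion q.2}

/-- `‖ν(x,ysp)‖₁` (the least value, should the multiplier not be unique). -/
def multNorm (q : (Fin n → ℝ) × (Fin p → ℝ)) : EReal :=
  ⨅ ν ∈ d.multipliers q.1 q.2, ((∑ i, |ν i| : ℝ) : EReal)

/-- `γ_min`: the infimum of `‖ν(x,ysp)‖₁` over all feasible parameters. -/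
def gamMin : EReal := ⨅ q ∈ d.GamAll, d.multNorm q

/-- `γ_max`: the supremum of `‖ν(x,ysp)‖₁` over all feasible parameters. -/
def gamMax : EReal := ⨆ q ∈ d.GamAll, d.multNorm q

/-- `𝒲(γ, ysp)`: the states of `Υ_N(ysp)` whose closed-loop trajectory under the tracking MPC `κN`
keeps `(x(i), ysp)` in `Γ(γ)`. -/
def W (γ : ℝ) (ysp : Fin p → ℝ) (xsp : Fin n → ℝ) (usp : Fin m → ℝ)
    (κinf κN : (Fin n → ℝ) → (Fin m → ℝ)) : Set (Fin n → ℝ) :=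
  {x | x ∈ d.Upsilon xsp usp κinf ∧ ∀ i : ℕ, (d.closedLoop κN x i, ysp) ∈ d.Gam γ}

end MPCData

end

/-! Exact penalty. At a KKT point `z` of the regulation problem the Lagrangian is quadratic with
zero derivative, so every tracking-feasible `z'` satisfies `V(z) + V₀(z' - z) ≤ V(z') + ν·(y_a' -
ysp)`, where `V₀` is the cost with initial state `0` (`IsKKT.le_regCost`). If `‖ν‖₁ ≤ γ`, Hölder's
inequality bounds the last term by the offset cost. A tracking minimizer then has `V₀(z' - z) = 0`,
and observability, `R ≻ 0` and uniqueness of equilibria give `z' = z` (`track_eq_reg`). Thus `κ_N =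
κ_N^r` wherever `Γ(γ)` holds.

Infinite horizon. Since `P` solves the Riccati equation, `‖x - xsp‖²_P` bounds every
infinite-horizon cost from below. Hence on `Υ_N` the first `N` inputs of `κ_∞` minimize the
regulation problem, and `κ_∞` acts as the LQR at time `N`, so that `Υ_N` is invariant under it
(`lawDecision_optimal`, `upsilon_succ`). Therefore `κ_N = κ_∞` on `Υ_N ∩ Γ(γ)`, and `𝒲` can be
rewritten with `κ_∞` trajectories only (`mem_W_iff`). Invariance is then clear, and so is
monotonicity, since `Γ(γ)` grows with `γ`.

Nonemptiness and entry in finite time. As `γ_min ≥ 0`, the hypothesis `γ > γ_min` gives `γ > 0`. The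
optimal tracking cost decreases along the closed loop, which forces convergence to `xsp`
(`trackLaw_tendsto`). Both `Υ_N` and `Γ(γ)` are neighbourhoods of `xsp`: the former because `κ_∞`
does not increase the `P`-norm in the terminal region, the latter because near `xsp` the LQR
solution satisfies the KKT conditions with multipliers of size `O(‖x - xsp‖)` (`gam_mem_nhds`).

Polygon. If `𝒵` is bounded, the costs are bounded uniformly, so after a common time all relevant
`κ_∞` trajectories stay in a given neighbourhood of `xsp` (`exists_uniform_time`). Only finitely
many of the conditions defining `𝒲` remain, and the trajectory up to that time solves a regulation
problem with a longer horizon. Its KKT conditions form a finite union of polyhedra in state,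
decision and multipliers; Fourier-Motzkin elimination projects this union to the state space. -/

/-! ### Affine maps as a predicate -/

section AffineFun

variable {E F G : Type*} [AddCommGroup E] [Module ℝ E] [AddCommGroup F] [Module ℝ F]
  [AddCommGroup G] [Module ℝ G]

/-- The function `f` is affine: a linear map plus a constant. -/
@[fun_prop]
def IsAffineFun (f : E → F) : Prop := ∃ (φ : E →ₗ[ℝ] F) (c : F), ∀ x, f x = φ x + c

namespace IsAffineFun

@[fun_prop]
theorem id : IsAffineFun (fun x : E => x) := ⟨LinearMap.id, 0, by simp⟩

@[fun_prop]
theorem const (c : F) : IsAffineFun (fun _ : E => c) := ⟨0, c, by simp⟩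

@[fun_prop]
theorem comp {f : F → G} {g : E → F} (hf : IsAffineFun f) (hg : IsAffineFun g) :
    IsAffineFun (fun x => f (g x)) := by
  obtain ⟨φ, c, h⟩ := hf
  obtain ⟨ψ, e, k⟩ := hg
  exact ⟨φ.comp ψ, φ e + c, fun x => by simp [h, k, add_assoc]⟩

theorem linear (φ : E →ₗ[ℝ] F) : IsAffineFun (fun x => φ x) := ⟨φ, 0, by simp⟩

@[fun_prop]
theorem add {f g : E → F} (hf : IsAffineFun f) (hg : IsAffineFun g) :
    IsAffineFun (fun x => f x + g x) := by
  obtain ⟨φ, c, h⟩ := hf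
  obtain ⟨ψ, e, k⟩ := hg
  exact ⟨φ + ψ, c + e, fun x => by simp only [h, k, LinearMap.add_apply]; abel⟩

@[fun_prop]
theorem const_smul {f : E → F} (hf : IsAffineFun f) (a : ℝ) :
    IsAffineFun (fun x => a • f x) := by
  obtain ⟨φ, c, h⟩ := hf
  exact ⟨a • φ, a • c, fun x => by simp [h]⟩

@[fun_prop]
theorem sub {f g : E → F} (hf : IsAffineFun f) (hg : IsAffineFun g) :
    IsAffineFun (fun x => f x - g x) := by
  obtain ⟨φ, c, h⟩ := hf
  obtain ⟨ψ, e, k⟩ := hg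
  exact ⟨φ - ψ, c - e, fun x => by simp only [h, k, LinearMap.sub_apply]; abel⟩

@[fun_prop]
theorem neg {f : E → F} (hf : IsAffineFun f) : IsAffineFun (fun x => -f x) := by
  simpa using (const (0 : F)).sub hf

@[fun_prop]
theorem const_mul {f : E → ℝ} (hf : IsAffineFun f) (a : ℝ) :
    IsAffineFun (fun x => a * f x) := hf.const_smul a

@[fun_prop]
theorem mul_const {f : E → ℝ} (hf : IsAffineFun f) (a : ℝ) :
    IsAffineFun (fun x => f x * a) := by
  simpa [mul_comm] using hf.const_smul a

@[fun_prop]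
theorem sum {ι : Type*} {s : Finset ι} {f : ι → E → F} (hf : ∀ i, IsAffineFun (f i)) :
    IsAffineFun (fun x => ∑ i ∈ s, f i x) := by
  classical
  induction s using Finset.induction_on with
  | empty => simpa using const (0 : F)
  | insert a s ha ih => simpa [Finset.sum_insert ha] using (hf a).add ih

@[fun_prop]
theorem fst {f : E → F × G} (hf : IsAffineFun f) : IsAffineFun (fun x => (f x).1) :=
  (linear (LinearMap.fst ℝ F G)).comp hf

@[fun_prop]
theorem snd {f : E → F × G} (hf : IsAffineFun f) : IsAffineFun (fun x => (f x).2) :=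
  (linear (LinearMap.snd ℝ F G)).comp hf

@[fun_prop]
theorem prodMk {f : E → F} {g : E → G} (hf : IsAffineFun f) (hg : IsAffineFun g) :
    IsAffineFun (fun x => (f x, g x)) := by
  obtain ⟨φ, c, h⟩ := hf
  obtain ⟨ψ, e, k⟩ := hg
  exact ⟨φ.prod ψ, (c, e), fun x => by simp [h, k]⟩

@[fun_prop]
theorem pi {ι : Type*} {f : E → ι → F} (hf : ∀ i, IsAffineFun (fun x => f x i)) :
    IsAffineFun f := by
  choose φ c h using hf
  exact ⟨LinearMap.pi φ, c, fun x => by ext i; simp [h]⟩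

@[fun_prop]
theorem apply {ι : Type*} (i : ι) : IsAffineFun (fun x : ι → F => x i) :=
  linear (LinearMap.proj (R := ℝ) (φ := fun _ : ι => F) i)

@[fun_prop]
theorem mulVec {k l : ℕ} (M : Matrix (Fin k) (Fin l) ℝ) {f : E → Fin l → ℝ}
    (hf : IsAffineFun f) : IsAffineFun (fun x => M *ᵥ f x) :=
  (linear M.mulVecLin).comp hf

@[fun_prop]
theorem dotProduct_const {k : ℕ} {f : E → Fin k → ℝ} (hf : IsAffineFun f) (v : Fin k → ℝ) :
    IsAffineFun (fun x => f x ⬝ᵥ v) := by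
  unfold dotProduct
  exact sum fun i => mul_const ((apply i).comp hf) _

end IsAffineFun

end AffineFun

/-! ### Polyhedra and finite unions of polyhedra -/

section Polyhedra

variable {E F : Type*} [AddCommGroup E] [Module ℝ E] [AddCommGroup F] [Module ℝ F]

/-- A polyhedron in a real vector space. -/
def IsPolyhedral (S : Set E) : Prop :=
  ∃ c : Set ((E →ₗ[ℝ] ℝ) × ℝ), c.Finite ∧ S = {x | ∀ q ∈ c, q.1 x ≤ q.2}

/-- A finite union of polyhedra in a real vector space. -/
def IsPolyUnion (S : Set E) : Prop :=
  ∃ T : Set (Set E), T.Finite ∧ (∀ P ∈ T, IsPolyhedral P) ∧ S = ⋃₀ T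

theorem IsPolyhedral.inter {S T : Set E} (hS : IsPolyhedral S) (hT : IsPolyhedral T) :
    IsPolyhedral (S ∩ T) := by
  obtain ⟨c, hc, rfl⟩ := hS
  obtain ⟨e, he, rfl⟩ := hT
  refine ⟨c ∪ e, hc.union he, ?_⟩
  ext x
  simp only [Set.mem_inter_iff, Set.mem_ofPred_eq, Set.mem_union]
  exact ⟨fun h q hq => hq.elim (h.1 q) (h.2 q), fun h => ⟨fun q hq => h q (.inl hq),
    fun q hq => h q (.inr hq)⟩⟩

theorem IsPolyhedral.preimage {S : Set F} (hS : IsPolyhedral S) {f : E → F}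
    (hf : IsAffineFun f) : IsPolyhedral (f ⁻¹' S) := by
  obtain ⟨c, hc, rfl⟩ := hS
  obtain ⟨φ, a, hφ⟩ := hf
  refine ⟨(fun q => (q.1.comp φ, q.2 - q.1 a)) '' c, hc.image _, ?_⟩
  ext x
  simp only [Set.mem_preimage, Set.mem_ofPred_eq, Set.forall_mem_image, hφ, map_add,
    LinearMap.comp_apply, le_sub_iff_add_le]

/-- The witness is `sSup L`, or `sInf U` if `L` is empty; if both are empty any number will do,
including the default value of `sInf ∅`. -/
theorem exists_between_of_finite {L U : Set ℝ} (hL : L.Finite) (hU : U.Finite)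
    (h : ∀ l ∈ L, ∀ u ∈ U, l ≤ u) : ∃ t, (∀ l ∈ L, l ≤ t) ∧ ∀ u ∈ U, t ≤ u := by
  rcases L.eq_empty_or_nonempty with rfl | hne
  · exact ⟨sInf U, by simp, fun u hu => csInf_le hU.bddBelow hu⟩
  · exact ⟨sSup L, fun l hl => le_csSup hL.bddAbove hl,
      fun u hu => csSup_le hne fun l hl => h l hl u hu⟩

/-- Fourier-Motzkin elimination of one variable. -/
theorem IsPolyhedral.exists_real {S : Set (E × ℝ)} (hS : IsPolyhedral S) :
    IsPolyhedral {x | ∃ t : ℝ, (x, t) ∈ S} := by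
  obtain ⟨c, hc, rfl⟩ := hS
  -- Each inequality is split into the coefficient `a q` of the eliminated variable and the part `f
  -- q` in the remaining ones.
  set a : ((E × ℝ →ₗ[ℝ] ℝ) × ℝ) → ℝ := fun q => q.1 (0, 1) with ha
  set f : ((E × ℝ →ₗ[ℝ] ℝ) × ℝ) → (E →ₗ[ℝ] ℝ) := fun q => q.1.comp (LinearMap.inl ℝ E ℝ) with hf
  have key : ∀ q : (E × ℝ →ₗ[ℝ] ℝ) × ℝ, ∀ x t, q.1 (x, t) = f q x + t * a q := by
    intro q x t
    have : ((x, t) : E × ℝ) = (x, 0) + t • ((0, 1) : E × ℝ) := by simp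
    rw [this, map_add, map_smul]
    simp [hf, ha]
  -- The projection keeps the inequalities free of `t` and adds, for each pair with coefficients of
  -- opposite signs, the positive combination in which `t` cancels.
  refine ⟨(fun q => (f q, q.2)) '' {q ∈ c | a q = 0} ∪
    Set.image2 (fun q r => (a q • f r - a r • f q, a q * r.2 - a r * q.2))
      {q ∈ c | 0 < a q} {r ∈ c | a r < 0}, ?_, ?_⟩
  · exact ((hc.subset (Set.sep_subset _ _)).image _).union
      ((hc.subset (Set.sep_subset _ _)).image2 _ (hc.subset (Set.sep_subset _ _)))
  ext x
  simp only [Set.mem_ofPred_eq, key]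
  constructor
  · rintro ⟨t, ht⟩ q (⟨q, ⟨hq, hq0⟩, rfl⟩ | ⟨q, ⟨hq, hq0⟩, r, ⟨hr, hr0⟩, rfl⟩)
    · have := ht q hq
      rw [hq0] at this
      simpa using this
    · have h1 := mul_le_mul_of_nonneg_left (ht r hr) hq0.le
      have h2 := mul_le_mul_of_nonneg_left (ht q hq) (neg_nonneg.2 hr0.le)
      simp only [LinearMap.sub_apply, LinearMap.smul_apply, smul_eq_mul]
      linarith
  · intro h
    obtain ⟨t, hl, hu⟩ := exists_between_of_finite
      (L := (fun r => (r.2 - f r x) / a r) '' {r ∈ c | a r < 0})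
      (U := (fun q => (q.2 - f q x) / a q) '' {q ∈ c | 0 < a q})
      ((hc.subset (Set.sep_subset _ _)).image _) ((hc.subset (Set.sep_subset _ _)).image _) (by
        rintro _ ⟨r, ⟨hr, hr0⟩, rfl⟩ _ ⟨q, ⟨hq, hq0⟩, rfl⟩
        have := h _ (Or.inr ⟨q, ⟨hq, hq0⟩, r, ⟨hr, hr0⟩, rfl⟩)
        simp only [LinearMap.sub_apply, LinearMap.smul_apply, smul_eq_mul] at this
        simp only
        rw [le_div_iff₀ hq0, div_mul_eq_mul_div, div_le_iff_of_neg hr0]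
        linarith)
    refine ⟨t, fun q hq => ?_⟩
    rcases lt_trichotomy (a q) 0 with h0 | h0 | h0
    · have := hl _ ⟨q, ⟨hq, h0⟩, rfl⟩
      simp only [div_le_iff_of_neg h0] at this
      linarith
    · have := h _ (Or.inl ⟨q, ⟨hq, h0⟩, rfl⟩)
      rw [h0]
      simpa using this
    · have := hu _ ⟨q, ⟨hq, h0⟩, rfl⟩
      simp only [le_div_iff₀ h0] at this
      linarith

namespace IsPolyhedral

theorem le {f g : E → ℝ} (hf : IsAffineFun f) (hg : IsAffineFun g) :
    IsPolyhedral {x | f x ≤ g x} := by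
  obtain ⟨φ, a, hφ⟩ := hf.sub hg
  refine ⟨{(φ, -a)}, Set.finite_singleton _, ?_⟩
  ext x
  have := hφ x
  simp only [Set.mem_ofPred_eq, Set.mem_singleton_iff, forall_eq]
  constructor <;> intro h <;> linarith

theorem univ : IsPolyhedral (Set.univ : Set E) := ⟨∅, Set.finite_empty, by simp⟩

theorem and {p q : E → Prop} (hp : IsPolyhedral {x | p x}) (hq : IsPolyhedral {x | q x}) :
    IsPolyhedral {x | p x ∧ q x} := hp.inter hq

theorem forall_fintype {ι : Type*} [Finite ι] {p : ι → E → Prop}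
    (hp : ∀ i, IsPolyhedral {x | p i x}) : IsPolyhedral {x | ∀ i, p i x} := by
  classical
  have := Fintype.ofFinite ι
  have h : ∀ s : Finset ι, IsPolyhedral {x | ∀ i ∈ s, p i x} := by
    intro s
    induction s using Finset.induction_on with
    | empty => simpa using univ
    | insert a s ha ih => simpa using (hp a).and ih
  simpa using h Finset.univ

theorem eq {f g : E → ℝ} (hf : IsAffineFun f) (hg : IsAffineFun g) :
    IsPolyhedral {x | f x = g x} := by
  simpa [le_antisymm_iff] using (le hf hg).and (le hg hf)

theorem exists_fin (k : ℕ) {S : Set (E × (Fin k → ℝ))} (hS : IsPolyhedral S) :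
    IsPolyhedral {x | ∃ y, (x, y) ∈ S} := by
  induction k with
  | zero =>
    have : {x | ∃ y, (x, y) ∈ S} = {x : E | (x, (0 : Fin 0 → ℝ)) ∈ S} := by
      ext x
      exact ⟨fun ⟨y, hy⟩ => by rwa [Subsingleton.elim y 0] at hy, fun h => ⟨0, h⟩⟩
    rw [this]
    exact hS.preimage (f := fun x => (x, 0)) (by fun_prop)
  | succ k ih =>
    have haff : IsAffineFun (fun q : (E × (Fin k → ℝ)) × ℝ =>
        (q.1.1, (Fin.cons q.2 q.1.2 : Fin (k + 1) → ℝ))) := by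
      refine IsAffineFun.prodMk (by fun_prop) (IsAffineFun.pi fun i => ?_)
      refine Fin.cases ?_ (fun j => ?_) i
      · simp only [Fin.cons_zero]; fun_prop
      · simp only [Fin.cons_succ]; fun_prop
    convert ih (exists_real (hS.preimage haff)) using 1
    ext x
    constructor
    · rintro ⟨y, hy⟩
      exact ⟨Fin.tail y, y 0, by simpa using hy⟩
    · rintro ⟨y, t, h⟩
      exact ⟨_, h⟩

/-- Projections of polyhedra are polyhedra. -/
theorem exists_mem [FiniteDimensional ℝ F] {S : Set (E × F)} (hS : IsPolyhedral S) :
    IsPolyhedral {x | ∃ y, (x, y) ∈ S} := by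
  set e := (Module.finBasis ℝ F).equivFun
  have haff : IsAffineFun (fun q : E × (Fin (Module.finrank ℝ F) → ℝ) => (q.1, e.symm q.2)) :=
    IsAffineFun.prodMk (by fun_prop) ((IsAffineFun.linear e.symm.toLinearMap).comp (by fun_prop))
  convert exists_fin _ (hS.preimage haff) using 1
  ext x
  exact ⟨fun ⟨y, hy⟩ => ⟨e y, by simpa using hy⟩, fun ⟨y, hy⟩ => ⟨_, hy⟩⟩

end IsPolyhedral

namespace IsPolyUnion

theorem of_polyhedral {S : Set E} (hS : IsPolyhedral S) : IsPolyUnion S :=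
  ⟨{S}, Set.finite_singleton S, by simpa using hS, by simp⟩

theorem le {f g : E → ℝ} (hf : IsAffineFun f) (hg : IsAffineFun g) :
    IsPolyUnion {x | f x ≤ g x} := of_polyhedral (.le hf hg)

theorem univ : IsPolyUnion (Set.univ : Set E) := of_polyhedral .univ

theorem union {S T : Set E} (hS : IsPolyUnion S) (hT : IsPolyUnion T) :
    IsPolyUnion (S ∪ T) := by
  obtain ⟨c, hc, hc', rfl⟩ := hS
  obtain ⟨e, he, he', rfl⟩ := hT
  exact ⟨c ∪ e, hc.union he, fun P hP => hP.elim (hc' P) (he' P), by rw [Set.sUnion_union]⟩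

theorem inter {S T : Set E} (hS : IsPolyUnion S) (hT : IsPolyUnion T) :
    IsPolyUnion (S ∩ T) := by
  obtain ⟨c, hc, hc', rfl⟩ := hS
  obtain ⟨e, he, he', rfl⟩ := hT
  refine ⟨Set.image2 (· ∩ ·) c e, hc.image2 _ he, ?_, ?_⟩
  · rintro _ ⟨P, hP, Q, hQ, rfl⟩
    exact (hc' P hP).inter (he' Q hQ)
  · ext x
    simp only [Set.mem_inter_iff, Set.mem_sUnion, Set.mem_image2]
    constructor
    · rintro ⟨⟨P, hP, hxP⟩, Q, hQ, hxQ⟩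
      exact ⟨_, ⟨P, hP, Q, hQ, rfl⟩, hxP, hxQ⟩
    · rintro ⟨_, ⟨P, hP, Q, hQ, rfl⟩, hxP, hxQ⟩
      exact ⟨⟨P, hP, hxP⟩, Q, hQ, hxQ⟩

theorem and {p q : E → Prop} (hp : IsPolyUnion {x | p x}) (hq : IsPolyUnion {x | q x}) :
    IsPolyUnion {x | p x ∧ q x} := hp.inter hq

theorem or {p q : E → Prop} (hp : IsPolyUnion {x | p x}) (hq : IsPolyUnion {x | q x}) :
    IsPolyUnion {x | p x ∨ q x} := hp.union hq

theorem forall_fintype {ι : Type*} [Finite ι] {p : ι → E → Prop}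
    (hp : ∀ i, IsPolyUnion {x | p i x}) : IsPolyUnion {x | ∀ i, p i x} := by
  classical
  have := Fintype.ofFinite ι
  have h : ∀ s : Finset ι, IsPolyUnion {x | ∀ i ∈ s, p i x} := by
    intro s
    induction s using Finset.induction_on with
    | empty => simpa using univ
    | insert a s ha ih => simpa using (hp a).and ih
  simpa using h Finset.univ

theorem eq {f g : E → ℝ} (hf : IsAffineFun f) (hg : IsAffineFun g) :
    IsPolyUnion {x | f x = g x} := by
  simpa [le_antisymm_iff] using (le hf hg).and (le hg hf)

theorem le_pi {ι : Type*} [Finite ι] {f g : E → ι → ℝ} (hf : IsAffineFun f)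
    (hg : IsAffineFun g) : IsPolyUnion {x | f x ≤ g x} := by
  simp only [Pi.le_def]
  exact forall_fintype fun i => le ((IsAffineFun.apply i).comp hf) ((IsAffineFun.apply i).comp hg)

theorem eq_pi {ι : Type*} [Finite ι] {f g : E → ι → ℝ} (hf : IsAffineFun f)
    (hg : IsAffineFun g) : IsPolyUnion {x | f x = g x} := by
  simp only [funext_iff]
  exact forall_fintype fun i => eq ((IsAffineFun.apply i).comp hf) ((IsAffineFun.apply i).comp hg)

theorem preimage {S : Set F} (hS : IsPolyUnion S) {f : E → F}
    (hf : IsAffineFun f) : IsPolyUnion {x | f x ∈ S} := by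
  obtain ⟨c, hc, hc', rfl⟩ := hS
  refine ⟨(fun P => f ⁻¹' P) '' c, hc.image _, ?_, ?_⟩
  · rintro _ ⟨P, hP, rfl⟩
    exact (hc' P hP).preimage hf
  · ext x
    simp

/-- Projections of finite unions of polyhedra are finite unions of polyhedra. -/
theorem exists_mem [FiniteDimensional ℝ F] {S : Set (E × F)} (hS : IsPolyUnion S) :
    IsPolyUnion {x | ∃ y, (x, y) ∈ S} := by
  obtain ⟨c, hc, hc', rfl⟩ := hS
  refine ⟨(fun P => {x | ∃ t : F, (x, t) ∈ P}) '' c, hc.image _, ?_, ?_⟩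
  · rintro _ ⟨P, hP, rfl⟩
    exact (hc' P hP).exists_mem
  · ext x
    simp only [Set.mem_sUnion, Set.mem_ofPred_eq, Set.mem_image, exists_exists_and_eq_and]
    exact ⟨fun ⟨t, P, h1, h2⟩ => ⟨P, h1, t, h2⟩, fun ⟨P, h1, t, h2⟩ => ⟨t, P, h1, h2⟩⟩

theorem exists_prop [FiniteDimensional ℝ F] {p : E → F → Prop}
    (hp : IsPolyUnion {q : E × F | p q.1 q.2}) : IsPolyUnion {x | ∃ y, p x y} :=
  exists_mem hp

end IsPolyUnion

theorem IsPolyhedral.isPolyhedron {k : ℕ} {S : Set (Fin k → ℝ)} (hS : IsPolyhedral S) :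
    IsPolyhedron S := by
  obtain ⟨c, hc, rfl⟩ := hS
  obtain ⟨r, ⟨e⟩⟩ := (finite_iff_exists_equiv_fin (α := c)).1 hc
  refine ⟨r, Matrix.of fun i j => (e.symm i).1.1 (Pi.single j 1), fun i => (e.symm i).1.2, ?_⟩
  have key : ∀ (φ : (Fin k → ℝ) →ₗ[ℝ] ℝ) x, (fun j => φ (Pi.single j 1)) ⬝ᵥ x = φ x := by
    intro φ x
    conv_rhs => rw [← Finset.univ_sum_single x, map_sum]
    refine Finset.sum_congr rfl fun j _ => ?_
    rw [mul_comm, ← smul_eq_mul, ← map_smul, ← Pi.single_smul, smul_eq_mul, mul_one]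
  ext x
  simp only [Set.mem_ofPred_eq, Pi.le_def, mulVec, Matrix.of_apply]
  constructor
  · intro h i
    rw [key]
    exact h _ (e.symm i).2
  · intro h q hq
    have := h (e ⟨q, hq⟩)
    rw [key] at this
    simpa using this

theorem IsPolyUnion.isPolygon {k : ℕ} {S : Set (Fin k → ℝ)} (hS : IsPolyUnion S) :
    IsPolygon S := by
  obtain ⟨c, hc, hc', rfl⟩ := hS
  obtain ⟨r, ⟨e⟩⟩ := (finite_iff_exists_equiv_fin (α := c)).1 hc
  refine ⟨r, fun i => (e.symm i).1, fun i => (hc' _ (e.symm i).2).isPolyhedron, ?_⟩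
  ext x
  simp only [Set.mem_sUnion, Set.mem_iUnion]
  exact ⟨fun ⟨P, hP, hx⟩ => ⟨e ⟨P, hP⟩, by simpa using hx⟩, fun ⟨i, hi⟩ => ⟨_, (e.symm i).2, hi⟩⟩

/-- Farkas' lemma for the nonnegativity of a linear functional on the cone of the directions `δ`
with `a i δ ≤ 0` for `i ∈ I` and `e k δ = 0` for all `k`. -/
theorem farkas {ι κ : Type*} [Fintype ι] [Fintype κ] [FiniteDimensional ℝ E] (I : Set ι)
    (a : ι → E →ₗ[ℝ] ℝ) (e : κ → E →ₗ[ℝ] ℝ) (c : E →ₗ[ℝ] ℝ)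
    (h : ∀ δ, (∀ i ∈ I, a i δ ≤ 0) → (∀ k, e k δ = 0) → 0 ≤ c δ) :
    ∃ (l : ι → ℝ) (ν : κ → ℝ), (∀ i, 0 ≤ l i) ∧ (∀ i, i ∉ I → l i = 0) ∧
      ∀ δ, c δ + ∑ i, l i * a i δ + ∑ k, ν k * e k δ = 0 := by
  classical
  -- `C` is the cone of functionals generated by the constraints. As a projection it is a
  -- polyhedron, so if `-c ∉ C`, one of its finitely many inequalities already separates `-c` from
  -- `C`; no closedness argument is needed.
  set C : Set (E →ₗ[ℝ] ℝ) := {φ | ∃ q : (ι → ℝ) × (κ → ℝ), (∀ i, 0 ≤ q.1 i) ∧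
    (∀ i, i ∉ I → q.1 i = 0) ∧ φ = ∑ i, q.1 i • a i + ∑ k, q.2 k • e k} with hC
  have hzero : (0 : E →ₗ[ℝ] ℝ) ∈ C := ⟨0, by simp, by simp, by simp⟩
  have hadd : ∀ j ∈ I, ∀ t : ℝ, 0 ≤ t → t • a j ∈ C := by
    intro j hj t ht
    refine ⟨(Pi.single j t, 0), fun i => ?_, fun i hi => ?_, ?_⟩
    · by_cases hij : i = j
      · subst hij; simpa using ht
      · simp [hij]
    · have : i ≠ j := fun h => hi (h ▸ hj)
      simp [this]
    · simp [Pi.single_apply, ite_smul]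
  have hequ : ∀ k, ∀ t : ℝ, t • e k ∈ C := by
    intro k t
    refine ⟨(0, Pi.single k t), by simp, by simp, ?_⟩
    simp [Pi.single_apply, ite_smul]
  have hCp : IsPolyhedral C := by
    refine IsPolyhedral.exists_mem (F := (ι → ℝ) × (κ → ℝ)) (S := {q | (∀ i, 0 ≤ q.2.1 i) ∧
      (∀ i, i ∉ I → q.2.1 i = 0) ∧ q.1 = ∑ i, q.2.1 i • a i + ∑ k, q.2.2 k • e k}) ?_
    refine .and (.forall_fintype fun i => .le (by fun_prop) (by fun_prop)) (.and ?_ ?_)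
    · refine .forall_fintype fun i => ?_
      by_cases hi : i ∈ I
      · simpa [hi] using IsPolyhedral.univ
      · simpa [hi] using IsPolyhedral.eq (E := (E →ₗ[ℝ] ℝ) × (ι → ℝ) × (κ → ℝ))
          (f := fun q => q.2.1 i) (g := fun _ => 0) (by fun_prop) (by fun_prop)
    · have : {q : (E →ₗ[ℝ] ℝ) × (ι → ℝ) × (κ → ℝ) |
          q.1 = ∑ i, q.2.1 i • a i + ∑ k, q.2.2 k • e k} =
          {q | ∀ j, q.1 (Module.finBasis ℝ E j) = ∑ i, q.2.1 i * a i (Module.finBasis ℝ E j)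
            + ∑ k, q.2.2 k * e k (Module.finBasis ℝ E j)} := by
        ext q
        simp only [Set.mem_ofPred_eq]
        constructor
        · intro h j
          rw [h]
          simp
        · intro h
          refine (Module.finBasis ℝ E).ext fun j => ?_
          rw [h]
          simp
      rw [this]
      refine .forall_fintype fun j => .eq ?_ (by fun_prop)
      exact (IsAffineFun.linear (LinearMap.applyₗ (R := ℝ) (M₂ := ℝ)
        (Module.finBasis ℝ E j))).comp (by fun_prop)
  suffices -c ∈ C by
    obtain ⟨q, h1, h2, h3⟩ := this
    refine ⟨q.1, q.2, h1, h2, fun δ => ?_⟩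
    have := congrArg (fun φ : E →ₗ[ℝ] ℝ => φ δ) h3
    simp at this
    linarith
  obtain ⟨s, -, hs⟩ := hCp
  by_contra hcon
  rw [hs] at hzero hadd hequ hcon
  simp only [Set.mem_ofPred_eq, not_forall, not_le] at hcon
  obtain ⟨q, hq, hlt⟩ := hcon
  have h0 : 0 ≤ q.2 := by simpa using hzero q hq
  -- By reflexivity the separating functional on the dual is evaluation at a vector `δ`. As `C`
  -- contains the rays through its generators, `δ` is a direction that contradicts `h`.
  obtain ⟨δ, hδ⟩ := (Module.evalEquiv ℝ E).surjective q.1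
  have hev : ∀ φ : E →ₗ[ℝ] ℝ, q.1 φ = φ δ := fun φ => by rw [← hδ]; rfl
  have hray : ∀ r : ℝ, (∀ t : ℝ, 0 ≤ t → t * r ≤ q.2) → r ≤ 0 := by
    intro r hr
    by_contra! hpos
    have := hr ((q.2 + 1) / r) (by positivity)
    rw [div_mul_cancel₀ _ hpos.ne'] at this
    linarith
  have h1 : ∀ i ∈ I, a i δ ≤ 0 := fun i hi => hray _ fun t ht => by
    simpa [hev] using hadd i hi t ht q hq
  have h2 : ∀ k, e k δ ≤ 0 := fun k => hray _ fun t _ => by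
    simpa [hev] using hequ k t q hq
  have h3 : ∀ k, -(e k δ) ≤ 0 := fun k => hray _ fun t _ => by
    simpa [hev] using hequ k (-t) q hq
  have := h δ h1 fun k => le_antisymm (h2 k) (by linarith [h3 k])
  rw [hev] at hlt
  simp at hlt
  linarith

end Polyhedra

/-! ### Quadratic forms -/

section QuadForm

variable {k l : ℕ}

theorem dotProduct_mulVec_symm {M : Matrix (Fin k) (Fin k) ℝ} (hM : M.IsHermitian)
    (v w : Fin k → ℝ) : v ⬝ᵥ (M *ᵥ w) = w ⬝ᵥ (M *ᵥ v) := by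
  have hM' : Mᵀ = M := by simpa using hM.eq
  rw [dotProduct_mulVec, dotProduct_comm, ← mulVec_transpose, hM']

theorem quadForm_add {M : Matrix (Fin k) (Fin k) ℝ} (hM : M.IsHermitian) (v w : Fin k → ℝ) :
    quadForm M (v + w) = quadForm M v + 2 * (v ⬝ᵥ (M *ᵥ w)) + quadForm M w := by
  simp only [quadForm, mulVec_add, add_dotProduct, dotProduct_add]
  rw [dotProduct_mulVec_symm hM w v]
  ring

theorem quadForm_nonneg {M : Matrix (Fin k) (Fin k) ℝ} (hM : M.PosSemidef) (v : Fin k → ℝ) :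
    0 ≤ quadForm M v := by
  simpa [quadForm] using hM.dotProduct_mulVec_nonneg v

@[simp]
theorem quadForm_zero (M : Matrix (Fin k) (Fin k) ℝ) : quadForm M 0 = 0 := by simp [quadForm]

theorem quadForm_smul (M : Matrix (Fin k) (Fin k) ℝ) (t : ℝ) (v : Fin k → ℝ) :
    quadForm M (t • v) = t ^ 2 * quadForm M v := by
  simp only [quadForm, mulVec_smul, smul_dotProduct, dotProduct_smul, smul_eq_mul]
  ring

theorem continuous_quadForm (M : Matrix (Fin k) (Fin k) ℝ) : Continuous (quadForm M) := by
  unfold quadForm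
  fun_prop

theorem tendsto_mulVec {ι : Type*} {L : Filter ι} (M : Matrix (Fin l) (Fin k) ℝ)
    {v : ι → Fin k → ℝ} {w : Fin k → ℝ} (h : Filter.Tendsto v L (𝓝 w)) :
    Filter.Tendsto (fun i => M *ᵥ v i) L (𝓝 (M *ᵥ w)) :=
  ((continuous_const.matrix_mulVec continuous_id).tendsto w).comp h

theorem tendsto_mulVec_zero {ι : Type*} {L : Filter ι} (M : Matrix (Fin l) (Fin k) ℝ)
    {v : ι → Fin k → ℝ} (h : Filter.Tendsto v L (𝓝 0)) :
    Filter.Tendsto (fun i => M *ᵥ v i) L (𝓝 0) := by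
  simpa using tendsto_mulVec M h

theorem tendsto_zero_of_dotProduct_self {ι : Type*} {L : Filter ι} {v : ι → Fin k → ℝ}
    (h : Filter.Tendsto (fun i => v i ⬝ᵥ v i) L (𝓝 0)) : Filter.Tendsto v L (𝓝 0) := by
  rw [tendsto_pi_nhds]
  intro j
  have hsq : Filter.Tendsto (fun i => (v i j) ^ 2) L (𝓝 0) := by
    refine squeeze_zero (fun i => sq_nonneg _) (fun i => ?_) h
    rw [pow_two]
    exact Finset.single_le_sum (f := fun j => v i j * v i j) (fun j _ => mul_self_nonneg _)
      (Finset.mem_univ j)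
  have := hsq.sqrt
  simp only [Real.sqrt_sq_eq_abs, Real.sqrt_zero] at this
  exact (tendsto_zero_iff_abs_tendsto_zero _).2 this

/-- With `M = Sᴴ S` the form is the squared length of `S v`. A semidefinite form controls only `M
v`, not `v`; for `Q` observability supplies the rest. -/
theorem tendsto_mulVec_of_quadForm {ι : Type*} {L : Filter ι} {M : Matrix (Fin k) (Fin k) ℝ}
    (hM : M.PosSemidef) {v : ι → Fin k → ℝ}
    (h : Filter.Tendsto (fun i => quadForm M (v i)) L (𝓝 0)) :
    Filter.Tendsto (fun i => M *ᵥ v i) L (𝓝 0) := by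
  obtain ⟨S, hS⟩ : ∃ S : Matrix (Fin k) (Fin k) ℝ, M = Sᴴ * S := by
    open scoped MatrixOrder in
    exact CStarAlgebra.nonneg_iff_eq_star_mul_self.mp hM.nonneg
  have h1 : ∀ v : Fin k → ℝ, quadForm M v = (S *ᵥ v) ⬝ᵥ (S *ᵥ v) := by
    intro v
    rw [quadForm, hS, ← mulVec_mulVec, dotProduct_mulVec, ← mulVec_transpose]
    simp
  have h2 : Filter.Tendsto (fun i => S *ᵥ v i) L (𝓝 0) :=
    tendsto_zero_of_dotProduct_self (by simpa [h1] using h)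
  have h3 := tendsto_mulVec_zero Sᴴ h2
  simpa [hS, mulVec_mulVec] using h3

theorem tendsto_of_quadForm_posDef {ι : Type*} {L : Filter ι} {M : Matrix (Fin k) (Fin k) ℝ}
    (hM : M.PosDef) {v : ι → Fin k → ℝ}
    (h : Filter.Tendsto (fun i => quadForm M (v i)) L (𝓝 0)) : Filter.Tendsto v L (𝓝 0) := by
  have h1 := tendsto_mulVec_zero M⁻¹ (tendsto_mulVec_of_quadForm hM.posSemidef h)
  have hu : IsUnit M.det := (Matrix.isUnit_iff_isUnit_det M).1 hM.isUnit
  simpa [mulVec_mulVec, Matrix.nonsing_inv_mul M hu] using h1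

theorem eq_zero_of_quadForm_posDef {M : Matrix (Fin k) (Fin k) ℝ} (hM : M.PosDef)
    {v : Fin k → ℝ} (h : quadForm M v = 0) : v = 0 := by
  by_contra hv
  have := hM.dotProduct_mulVec_pos hv
  simp only [star_trivial] at this
  exact this.ne' h

/-- A quadratic form is bounded by a multiple of the squared norm. -/
theorem exists_quadForm_le (M : Matrix (Fin k) (Fin k) ℝ) :
    ∃ c, 0 < c ∧ ∀ v, quadForm M v ≤ c * ‖v‖ ^ 2 := by
  refine ⟨∑ i, ∑ j, |M i j| + 1, by positivity, fun v => ?_⟩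
  have : quadForm M v ≤ (∑ i, ∑ j, |M i j|) * ‖v‖ ^ 2 := by
    simp only [quadForm, dotProduct, mulVec, Finset.sum_mul, Finset.mul_sum]
    refine Finset.sum_le_sum fun i _ => Finset.sum_le_sum fun j _ => ?_
    have h1 : |v i| ≤ ‖v‖ := norm_le_pi_norm v i
    have h2 : |v j| ≤ ‖v‖ := norm_le_pi_norm v j
    calc v i * (M i j * v j) ≤ |v i * (M i j * v j)| := le_abs_self _
      _ = |M i j| * (|v i| * |v j|) := by rw [abs_mul, abs_mul]; ring
      _ ≤ |M i j| * (‖v‖ * ‖v‖) := by gcongr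
      _ = |M i j| * ‖v‖ ^ 2 := by ring
  nlinarith [sq_nonneg ‖v‖]

end QuadForm

namespace MPCData

variable {n m p : ℕ} {d : MPCData n m p}

/-! ### Observability and the Riccati equation -/

/-- If the outputs `Q e_j` and the residuals `e_{j+1} - A e_j` tend to zero for each `j`, so
does `e_0`. -/
theorem Assumptions.tendsto_zero (hd : d.Assumptions) {ι : Type*} {L : Filter ι}
    {e : ℕ → ι → Fin n → ℝ}
    (hQ : ∀ j, Filter.Tendsto (fun i => d.Q *ᵥ e j i) L (𝓝 0))
    (hA : ∀ j, Filter.Tendsto (fun i => e (j + 1) i - d.A *ᵥ e j i) L (𝓝 0)) :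
    Filter.Tendsto (e 0) L (𝓝 0) := by
  have h1 : ∀ j, Filter.Tendsto (fun i => (d.A ^ j) *ᵥ e 0 i - e j i) L (𝓝 0) := by
    intro j
    induction j with
    | zero => simpa using tendsto_const_nhds
    | succ j ih =>
      have := (tendsto_mulVec_zero d.A ih).sub (hA j)
      rw [sub_zero] at this
      refine this.congr fun i => ?_
      rw [pow_succ', ← mulVec_mulVec, mulVec_sub]
      abel
  have h2 : ∀ j, Filter.Tendsto (fun i => d.Q *ᵥ ((d.A ^ j) *ᵥ e 0 i)) L (𝓝 0) := by
    intro j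
    have := (tendsto_mulVec_zero d.Q (h1 j)).add (hQ j)
    rw [add_zero] at this
    refine this.congr fun i => ?_
    rw [mulVec_sub]
    abel
  -- The observability map is linear and injective on a finite-dimensional space, hence a closed
  -- embedding, so convergence may be tested on its image.
  let T : (Fin n → ℝ) →ₗ[ℝ] (ℕ → Fin n → ℝ) :=
    LinearMap.pi fun j => d.Q.mulVecLin.comp (d.A ^ j).mulVecLin
  have hT : LinearMap.ker T = ⊥ := by
    rw [LinearMap.ker_eq_bot']
    intro v hv
    exact hd.observable v fun j => congrFun hv j
  have hemb := LinearMap.isClosedEmbedding_of_injective hT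
  rw [hemb.isInducing.tendsto_nhds_iff, map_zero, tendsto_pi_nhds]
  exact h2

/-- `R + B' P B`, the Hessian of the Riccati equation. -/
def gainHessian (d : MPCData n m p) : Matrix (Fin m) (Fin m) ℝ := d.R + d.Bᵀ * d.P * d.B

theorem Assumptions.gainHessian_posDef (hd : d.Assumptions) : d.gainHessian.PosDef := by
  refine hd.R_posDef.add_posSemidef ?_
  simpa using hd.P_posDef.posSemidef.conjTranspose_mul_mul_same d.B

/-- Completion of the square in polarized form: the Riccati equation and the gain equation cancel
all terms except those in the deviations from the LQR inputs. The diagonal gives the cost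
identities; the polarized version gives the gradient at the LQR point. -/
theorem Assumptions.riccati_bilin (hd : d.Assumptions) (e a : Fin n → ℝ) (v b : Fin m → ℝ) :
    e ⬝ᵥ (d.Q *ᵥ a) + v ⬝ᵥ (d.R *ᵥ b)
      + (d.A *ᵥ e + d.B *ᵥ v) ⬝ᵥ (d.P *ᵥ (d.A *ᵥ a + d.B *ᵥ b))
    = e ⬝ᵥ (d.P *ᵥ a) + (v - d.K *ᵥ e) ⬝ᵥ (d.gainHessian *ᵥ (b - d.K *ᵥ a)) := by
  have hmv : ∀ {r s : ℕ} (M : Matrix (Fin r) (Fin s) ℝ) (x : Fin s → ℝ) (y : Fin r → ℝ),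
      (M *ᵥ x) ⬝ᵥ y = x ⬝ᵥ (Mᵀ *ᵥ y) := by
    intro r s M x y
    rw [mulVec_transpose, dotProduct_comm, dotProduct_mulVec, dotProduct_comm]
  have hP : d.Pᵀ = d.P := by simpa using hd.P_posDef.isHermitian.eq
  have hR : d.Rᵀ = d.R := by simpa using hd.R_posDef.isHermitian.eq
  have hg : ∀ a : Fin n → ℝ, d.R *ᵥ (d.K *ᵥ a) + d.Bᵀ *ᵥ (d.P *ᵥ (d.B *ᵥ (d.K *ᵥ a)))
      + d.Bᵀ *ᵥ (d.P *ᵥ (d.A *ᵥ a)) = 0 := by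
    intro a
    have := congrArg (fun M => M *ᵥ a) hd.lqr_gain
    simp only [Matrix.add_mul, add_mulVec, ← mulVec_mulVec, neg_mulVec] at this
    rw [this]
    simp
  have hc : ∀ a : Fin n → ℝ, d.P *ᵥ a = d.Q *ᵥ a + d.Kᵀ *ᵥ (d.R *ᵥ (d.K *ᵥ a))
      + (d.Aᵀ *ᵥ (d.P *ᵥ (d.A *ᵥ a + d.B *ᵥ (d.K *ᵥ a)))
        + d.Kᵀ *ᵥ (d.Bᵀ *ᵥ (d.P *ᵥ (d.A *ᵥ a + d.B *ᵥ (d.K *ᵥ a))))) := by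
    intro a
    conv_lhs => rw [hd.lqr_cost]
    simp only [add_mulVec, ← mulVec_mulVec, transpose_add, transpose_mul, mulVec_add]
    abel
  obtain ⟨w, rfl⟩ : ∃ w, v = d.K *ᵥ e + w := ⟨v - d.K *ᵥ e, by abel⟩
  obtain ⟨c, rfl⟩ : ∃ c, b = d.K *ᵥ a + c := ⟨b - d.K *ᵥ a, by abel⟩
  simp only [add_sub_cancel_left]
  rw [hc a]
  have h1 := congrArg (fun y => w ⬝ᵥ y) (hg a)
  have h2 := congrArg (fun y => y ⬝ᵥ c) (hg e)
  simp only [gainHessian, add_mulVec, ← mulVec_mulVec, mulVec_add, add_dotProduct,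
    dotProduct_add, hmv, dotProduct_zero, zero_dotProduct, transpose_transpose, hP, hR] at h1 h2 ⊢
  linarith

theorem Assumptions.riccati (hd : d.Assumptions) (e : Fin n → ℝ) (v : Fin m → ℝ) :
    quadForm d.Q e + quadForm d.R v + quadForm d.P (d.A *ᵥ e + d.B *ᵥ v)
      = quadForm d.P e + quadForm d.gainHessian (v - d.K *ᵥ e) :=
  hd.riccati_bilin e e v v

/-! ### Trajectories -/

/-- State trajectory under an input sequence. -/
def traj (d : MPCData n m p) (x : Fin n → ℝ) (u : ℕ → Fin m → ℝ) : ℕ → Fin n → ℝ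
  | 0 => x
  | j + 1 => d.A *ᵥ traj d x u j + d.B *ᵥ u j

/-- Stage cost with respect to the target `(xa, ua)`. -/
def stage (d : MPCData n m p) (xa : Fin n → ℝ) (ua : Fin m → ℝ) (x : Fin n → ℝ)
    (u : Fin m → ℝ) : ℝ := quadForm d.Q (x - xa) + quadForm d.R (u - ua)

theorem Assumptions.stage_nonneg (hd : d.Assumptions) (xa : Fin n → ℝ) (ua : Fin m → ℝ)
    (x : Fin n → ℝ) (u : Fin m → ℝ) : 0 ≤ d.stage xa ua x u :=
  add_nonneg (quadForm_nonneg hd.Q_posSemidef _) (quadForm_nonneg hd.R_posDef.posSemidef _)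

/-- Source of all telescoping sums below: the LQR input preserves stage plus terminal cost exactly,
and any other input increases it by a positive definite excess. -/
theorem Assumptions.stage_add_terminal (hd : d.Assumptions) {xa : Fin n → ℝ} {ua : Fin m → ℝ}
    (heq : xa = d.A *ᵥ xa + d.B *ᵥ ua) (x : Fin n → ℝ) (u : Fin m → ℝ) :
    d.stage xa ua x u + quadForm d.P (d.A *ᵥ x + d.B *ᵥ u - xa)
      = quadForm d.P (x - xa) + quadForm d.gainHessian (u - (d.K *ᵥ (x - xa) + ua)) := by
  have h := hd.riccati (x - xa) (u - ua)
  have h1 : d.A *ᵥ (x - xa) + d.B *ᵥ (u - ua) = d.A *ᵥ x + d.B *ᵥ u - xa := by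
    conv_rhs => rw [heq]
    simp only [mulVec_sub]
    abel
  rw [h1] at h
  rw [stage, h, sub_sub, add_comm ua]

theorem traj_succ' (x : Fin n → ℝ) (u : ℕ → Fin m → ℝ) (j : ℕ) :
    d.traj x u (j + 1) = d.traj (d.A *ᵥ x + d.B *ᵥ u 0) (fun k => u (k + 1)) j := by
  induction j with
  | zero => rfl
  | succ j ih => rw [traj, ih, traj]

theorem closedLoop_eq_traj (κ : (Fin n → ℝ) → Fin m → ℝ) (x : Fin n → ℝ) (k : ℕ) :
    d.traj x (fun k => κ (d.closedLoop κ x k)) k = d.closedLoop κ x k := by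
  induction k with
  | zero => rfl
  | succ k ih => rw [traj, ih, closedLoop]

theorem closedLoop_add (κ : (Fin n → ℝ) → Fin m → ℝ) (x : Fin n → ℝ) (j k : ℕ) :
    d.closedLoop κ (d.closedLoop κ x j) k = d.closedLoop κ x (j + k) := by
  induction k with
  | zero => rfl
  | succ k ih => rw [closedLoop, ih, ← add_assoc, closedLoop]

theorem closedLoop_succ' (κ : (Fin n → ℝ) → Fin m → ℝ) (x : Fin n → ℝ) (k : ℕ) :
    d.closedLoop κ (d.A *ᵥ x + d.B *ᵥ κ x) k = d.closedLoop κ x (k + 1) := by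
  rw [add_comm k, ← closedLoop_add]
  rfl

end MPCData

namespace MPCData

variable {n m p : ℕ} {d : MPCData n m p}

/-! ### The regulation cost as a quadratic form -/

theorem pred_add (x x' : Fin n → ℝ) (u u' : Fin d.N → Fin m → ℝ) (j : ℕ) :
    d.pred (x + x') (u + u') j = d.pred x u j + d.pred x' u' j := by
  induction j with
  | zero => rfl
  | succ j ih =>
    simp only [pred, ih]
    split_ifs
    · simp only [Pi.add_apply, mulVec_add]
      abel
    · simp only [mulVec_add, mulVec_zero, add_zero]

theorem pred_smul (t : ℝ) (x : Fin n → ℝ) (u : Fin d.N → Fin m → ℝ) (j : ℕ) :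
    d.pred (t • x) (t • u) j = t • d.pred x u j := by
  induction j with
  | zero => rfl
  | succ j ih =>
    simp only [pred, ih]
    split_ifs <;> simp [mulVec_smul]

theorem pred_add_right (x : Fin n → ℝ) (u u' : Fin d.N → Fin m → ℝ) (j : ℕ) :
    d.pred x (u + u') j = d.pred x u j + d.pred 0 u' j := by
  simpa using pred_add x 0 u u' j

theorem pred_smul_zero (t : ℝ) (u : Fin d.N → Fin m → ℝ) (j : ℕ) :
    d.pred 0 (t • u) j = t • d.pred 0 u j := by
  simpa using pred_smul t 0 u j

/-- The bilinear form of the quadratic form `regCost`. -/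
def regBilin (d : MPCData n m p) (x : Fin n → ℝ) (z : MPCDecision d.N n m) (x' : Fin n → ℝ)
    (z' : MPCDecision d.N n m) : ℝ :=
  (∑ j : Fin d.N, ((d.pred x z.1 j - z.2.1) ⬝ᵥ (d.Q *ᵥ (d.pred x' z'.1 j - z'.2.1))
    + (z.1 j - z.2.2) ⬝ᵥ (d.R *ᵥ (z'.1 j - z'.2.2))))
    + (d.pred x z.1 d.N - z.2.1) ⬝ᵥ (d.P *ᵥ (d.pred x' z'.1 d.N - z'.2.1))

/-- With the initial state fixed, a change `δ` of the decision changes the predictions by those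
started from `0`; hence the state argument `0` beside every increment. -/
theorem Assumptions.regCost_add (hd : d.Assumptions) (x : Fin n → ℝ) (z δ : MPCDecision d.N n m) :
    d.regCost x (z + δ) = d.regCost x z + 2 * d.regBilin x z 0 δ + d.regCost 0 δ := by
  have h1 : ∀ j, d.pred x (z + δ).1 j - (z + δ).2.1
      = (d.pred x z.1 j - z.2.1) + (d.pred 0 δ.1 j - δ.2.1) := by
    intro j
    rw [Prod.fst_add, pred_add_right]
    simp only [Prod.snd_add, Prod.fst_add]
    abel
  have h2 : ∀ j, (z + δ).1 j - (z + δ).2.2 = (z.1 j - z.2.2) + (δ.1 j - δ.2.2) := by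
    intro j
    simp only [Prod.snd_add, Prod.fst_add, Pi.add_apply]
    abel
  simp only [regCost, regBilin, h1, h2, quadForm_add hd.Q_posSemidef.isHermitian,
    quadForm_add hd.R_posDef.isHermitian, quadForm_add hd.P_posDef.isHermitian,
    Finset.sum_add_distrib, ← Finset.mul_sum, mul_add]
  ring

theorem regBilin_add_right (x : Fin n → ℝ) (z : MPCDecision d.N n m) (δ δ' : MPCDecision d.N n m) :
    d.regBilin x z 0 (δ + δ') = d.regBilin x z 0 δ + d.regBilin x z 0 δ' := by
  have h1 : ∀ j, d.pred 0 (δ + δ').1 j - (δ + δ').2.1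
      = (d.pred 0 δ.1 j - δ.2.1) + (d.pred 0 δ'.1 j - δ'.2.1) := by
    intro j
    rw [Prod.fst_add, pred_add_right]
    simp only [Prod.snd_add, Prod.fst_add]
    abel
  have h2 : ∀ j, (δ + δ').1 j - (δ + δ').2.2 = (δ.1 j - δ.2.2) + (δ'.1 j - δ'.2.2) := by
    intro j
    simp only [Prod.snd_add, Prod.fst_add, Pi.add_apply]
    abel
  simp only [regBilin, h1, h2, mulVec_add, dotProduct_add, Finset.sum_add_distrib]
  ring

theorem regBilin_smul_right (x : Fin n → ℝ) (z δ : MPCDecision d.N n m) (t : ℝ) :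
    d.regBilin x z 0 (t • δ) = t * d.regBilin x z 0 δ := by
  have h1 : ∀ j, d.pred 0 (t • δ).1 j - (t • δ).2.1 = t • (d.pred 0 δ.1 j - δ.2.1) := by
    intro j
    rw [Prod.smul_fst, pred_smul_zero]
    simp [smul_sub]
  have h2 : ∀ j, (t • δ).1 j - (t • δ).2.2 = t • (δ.1 j - δ.2.2) := by
    intro j
    simp [smul_sub]
  simp only [regBilin, h1, h2, mulVec_smul, dotProduct_smul, smul_eq_mul, ← mul_add,
    ← Finset.mul_sum]

theorem regCost_zero_smul (δ : MPCDecision d.N n m) (t : ℝ) :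
    d.regCost 0 (t • δ) = t ^ 2 * d.regCost 0 δ := by
  have h1 : ∀ j, d.pred 0 (t • δ).1 j - (t • δ).2.1 = t • (d.pred 0 δ.1 j - δ.2.1) := by
    intro j
    rw [Prod.smul_fst, pred_smul_zero]
    simp [smul_sub]
  have h2 : ∀ j, (t • δ).1 j - (t • δ).2.2 = t • (δ.1 j - δ.2.2) := by
    intro j
    simp [smul_sub]
  simp only [regCost, h1, h2, quadForm_smul, ← mul_add, ← Finset.mul_sum]

theorem Assumptions.regCost_nonneg (hd : d.Assumptions) (x : Fin n → ℝ)
    (z : MPCDecision d.N n m) : 0 ≤ d.regCost x z :=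
  add_nonneg (Finset.sum_nonneg fun _ _ => add_nonneg (quadForm_nonneg hd.Q_posSemidef _)
    (quadForm_nonneg hd.R_posDef.posSemidef _)) (quadForm_nonneg hd.P_posDef.posSemidef _)

theorem Assumptions.regCost_line (hd : d.Assumptions) (x : Fin n → ℝ) (z δ : MPCDecision d.N n m)
    (t : ℝ) : d.regCost x (z + t • δ)
      = d.regCost x z + t * (2 * d.regBilin x z 0 δ) + t ^ 2 * d.regCost 0 δ := by
  rw [hd.regCost_add, regBilin_smul_right, regCost_zero_smul]
  ring

/-! ### Directions -/

/-- Change of the stage constraint residual in the direction `δ`. -/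
def stageDir (d : MPCData n m p) (δ : MPCDecision d.N n m) (j : Fin d.N) : Fin d.rZ → ℝ :=
  d.Gx *ᵥ d.pred 0 δ.1 j + d.Gu *ᵥ δ.1 j

/-- Change of the terminal constraint residual in the direction `δ`. -/
def terminalDir (d : MPCData n m p) (δ : MPCDecision d.N n m) : Fin d.rO → ℝ :=
  d.Hx *ᵥ d.pred 0 δ.1 d.N + d.Ha *ᵥ δ.2.1 + d.Hu *ᵥ δ.2.2

theorem stageDir_add (δ δ' : MPCDecision d.N n m) (j : Fin d.N) :
    d.stageDir (δ + δ') j = d.stageDir δ j + d.stageDir δ' j := by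
  simp only [stageDir, Prod.fst_add, pred_add_right, mulVec_add, Pi.add_apply]
  abel

theorem stageDir_smul (t : ℝ) (δ : MPCDecision d.N n m) (j : Fin d.N) :
    d.stageDir (t • δ) j = t • d.stageDir δ j := by
  simp only [stageDir, Prod.smul_fst, pred_smul_zero, mulVec_smul, Pi.smul_apply, smul_add]

theorem terminalDir_add (δ δ' : MPCDecision d.N n m) :
    d.terminalDir (δ + δ') = d.terminalDir δ + d.terminalDir δ' := by
  simp only [terminalDir, Prod.fst_add, Prod.snd_add, pred_add_right, mulVec_add]
  abel

theorem terminalDir_smul (t : ℝ) (δ : MPCDecision d.N n m) :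
    d.terminalDir (t • δ) = t • d.terminalDir δ := by
  simp only [terminalDir, Prod.smul_fst, Prod.smul_snd, pred_smul_zero, mulVec_smul, smul_add]

theorem output_add (δ δ' : MPCDecision d.N n m) :
    d.output (δ + δ') = d.output δ + d.output δ' := by
  simp only [output, Prod.fst_add, Prod.snd_add, mulVec_add]
  abel

theorem output_smul (t : ℝ) (δ : MPCDecision d.N n m) : d.output (t • δ) = t • d.output δ := by
  simp only [output, Prod.smul_fst, Prod.smul_snd, mulVec_smul, smul_add]

theorem output_sub (δ δ' : MPCDecision d.N n m) :
    d.output (δ - δ') = d.output δ - d.output δ' := by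
  simp only [output, Prod.fst_sub, Prod.snd_sub, mulVec_sub]
  abel

theorem stageResidual_add (x : Fin n → ℝ) (z δ : MPCDecision d.N n m) (j : Fin d.N) :
    d.stageResidual x (z + δ) j = d.stageResidual x z j + d.stageDir δ j := by
  simp only [stageResidual, stageDir, Prod.fst_add, pred_add_right, mulVec_add, Pi.add_apply]
  abel

theorem terminalResidual_add (x : Fin n → ℝ) (z δ : MPCDecision d.N n m) :
    d.terminalResidual x (z + δ) = d.terminalResidual x z + d.terminalDir δ := by
  simp only [terminalResidual, terminalDir, Prod.fst_add, Prod.snd_add, pred_add_right, mulVec_add]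
  abel

theorem trackFeasible_iff (x : Fin n → ℝ) (z : MPCDecision d.N n m) :
    d.TrackFeasible x z ↔ (∀ j, d.stageResidual x z j ≤ 0) ∧ d.terminalResidual x z ≤ 0 := by
  simp only [TrackFeasible, Z, Omega, stageResidual, terminalResidual, sub_nonpos,
    Set.mem_ofPred_eq]

theorem TrackFeasible.line {x : Fin n → ℝ} {z z' : MPCDecision d.N n m}
    (hz : d.TrackFeasible x z) (hz' : d.TrackFeasible x z') {t : ℝ} (h0 : 0 ≤ t) (h1 : t ≤ 1) :
    d.TrackFeasible x (z + t • (z' - z)) := by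
  rw [trackFeasible_iff] at hz hz' ⊢
  have hs : ∀ j, d.stageResidual x z' j = d.stageResidual x z j + d.stageDir (z' - z) j := by
    intro j
    rw [← stageResidual_add, add_sub_cancel]
  have ht : d.terminalResidual x z' = d.terminalResidual x z + d.terminalDir (z' - z) := by
    rw [← terminalResidual_add, add_sub_cancel]
  have key : ∀ {r : ℕ} (a b : Fin r → ℝ), a ≤ 0 → a + b ≤ 0 → a + t • b ≤ 0 := by
    intro r a b ha hab i
    have h2 := ha i
    have h3 := hab i
    simp only [Pi.add_apply, Pi.zero_apply, Pi.smul_apply, smul_eq_mul] at *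
    nlinarith
  refine ⟨fun j => ?_, ?_⟩
  · rw [stageResidual_add, stageDir_smul]
    exact key _ _ (hz.1 j) (hs j ▸ hz'.1 j)
  · rw [terminalResidual_add, terminalDir_smul]
    exact key _ _ hz.2 (ht ▸ hz'.2)

theorem RegFeasible.line {x : Fin n → ℝ} {ysp : Fin p → ℝ} {z z' : MPCDecision d.N n m}
    (hz : d.RegFeasible x ysp z) (hz' : d.RegFeasible x ysp z') {t : ℝ} (h0 : 0 ≤ t)
    (h1 : t ≤ 1) : d.RegFeasible x ysp (z + t • (z' - z)) :=
  ⟨hz.1.line hz'.1 h0 h1, by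
    rw [output_add, output_smul, output_sub, hz.2, hz'.2, sub_self, smul_zero, add_zero]⟩

/-- This extracts the first-order condition from minimality of a quadratic along a segment. -/
theorem nonneg_of_forall_small {D q : ℝ} (h : ∀ t : ℝ, 0 < t → t ≤ 1 → 0 ≤ D + t * q) :
    0 ≤ D := by
  by_contra! hD
  rcases le_or_gt q 0 with hq | hq
  · have := h 1 one_pos le_rfl
    linarith
  -- For this `t` the quadratic part is at most `-D / 2`, half of what would be needed to offset `D
  -- < 0`.
  · have h1 := h (min 1 (-D / (2 * q))) (lt_min one_pos (by
      have : 0 < -D := by linarith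
      positivity)) (min_le_left _ _)
    have h2 : min 1 (-D / (2 * q)) * q ≤ -D / (2 * q) * q :=
      mul_le_mul_of_nonneg_right (min_le_right _ _) hq.le
    have h3 : -D / (2 * q) * q = -D / 2 := by field_simp
    linarith

/-- Quadratic growth of `regCost + g` from a minimizer, for `g` convex. -/
theorem Assumptions.growth (hd : d.Assumptions) {x : Fin n → ℝ} {F : MPCDecision d.N n m → Prop}
    {g : MPCDecision d.N n m → ℝ} {z z' : MPCDecision d.N n m}
    (hF : ∀ t : ℝ, 0 ≤ t → t ≤ 1 → F (z + t • (z' - z)))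
    (hg : ∀ t : ℝ, 0 ≤ t → t ≤ 1 → g (z + t • (z' - z)) ≤ (1 - t) * g z + t * g z')
    (hmin : ∀ y, F y → d.regCost x z + g z ≤ d.regCost x y + g y) :
    d.regCost x z + g z + d.regCost 0 (z' - z) ≤ d.regCost x z' + g z' := by
  have h1 : d.regCost x z' = d.regCost x z + 2 * d.regBilin x z 0 (z' - z)
      + d.regCost 0 (z' - z) := by
    rw [← hd.regCost_add, add_sub_cancel]
  have h2 : 0 ≤ 2 * d.regBilin x z 0 (z' - z) + (g z' - g z) := by
    refine nonneg_of_forall_small (q := d.regCost 0 (z' - z)) fun t ht ht1 => ?_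
    have h3 := hmin _ (hF t ht.le ht1)
    have h4 := hg t ht.le ht1
    rw [hd.regCost_line] at h3
    have h5 : 0 ≤ t * (2 * d.regBilin x z 0 (z' - z) + (g z' - g z)
      + t * d.regCost 0 (z' - z)) := by nlinarith
    exact nonneg_of_mul_nonneg_right h5 ht
  linarith

/-- Along equilibrium directions the quadratic form `regCost 0` controls the artificial state. -/
theorem Assumptions.tendsto_dir (hd : d.Assumptions) {ι : Type*} {L : Filter ι}
    {δ : ι → MPCDecision d.N n m}
    (heq : ∀ i, (δ i).2.1 = d.A *ᵥ (δ i).2.1 + d.B *ᵥ (δ i).2.2)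
    (h : Filter.Tendsto (fun i => d.regCost 0 (δ i)) L (𝓝 0)) :
    Filter.Tendsto (fun i => (δ i).2.1) L (𝓝 0) := by
  have hQ0 : ∀ (M : Fin n → ℝ), 0 ≤ quadForm d.Q M := quadForm_nonneg hd.Q_posSemidef
  have hR0 : ∀ (M : Fin m → ℝ), 0 ≤ quadForm d.R M := quadForm_nonneg hd.R_posDef.posSemidef
  have hP0 : ∀ (M : Fin n → ℝ), 0 ≤ quadForm d.P M := quadForm_nonneg hd.P_posDef.posSemidef
  have hsum : ∀ i (j : Fin d.N), quadForm d.Q (d.pred 0 (δ i).1 j - (δ i).2.1)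
      + quadForm d.R ((δ i).1 j - (δ i).2.2) ≤ d.regCost 0 (δ i) := by
    intro i j
    have := Finset.single_le_sum (f := fun j : Fin d.N => quadForm d.Q (d.pred 0 (δ i).1 j
      - (δ i).2.1) + quadForm d.R ((δ i).1 j - (δ i).2.2))
      (fun j _ => add_nonneg (hQ0 _) (hR0 _)) (Finset.mem_univ j)
    have h2 := hP0 (d.pred 0 (δ i).1 d.N - (δ i).2.1)
    simp only [regCost] at *
    linarith
  have hQ : ∀ j : Fin d.N, Filter.Tendsto (fun i => d.Q *ᵥ (d.pred 0 (δ i).1 j - (δ i).2.1)) L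
      (𝓝 0) := fun j => tendsto_mulVec_of_quadForm hd.Q_posSemidef
    (squeeze_zero (fun i => hQ0 _) (fun i => by linarith [hsum i j, hR0 ((δ i).1 j - (δ i).2.2)]) h)
  have hR : ∀ j : Fin d.N, Filter.Tendsto (fun i => (δ i).1 j - (δ i).2.2) L (𝓝 0) :=
    fun j => tendsto_of_quadForm_posDef hd.R_posDef (squeeze_zero (fun i => hR0 _)
      (fun i => by linarith [hsum i j, hQ0 (d.pred 0 (δ i).1 j - (δ i).2.1)]) h)
  have hP : Filter.Tendsto (fun i => d.pred 0 (δ i).1 d.N - (δ i).2.1) L (𝓝 0) := by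
    refine tendsto_of_quadForm_posDef hd.P_posDef (squeeze_zero (fun i => hP0 _) (fun i => ?_) h)
    simp only [regCost, le_add_iff_nonneg_left]
    exact Finset.sum_nonneg fun _ _ => add_nonneg (hQ0 _) (hR0 _)
  -- Observability needs all times, so the deviation sequence is continued by zero after `N`. The
  -- jump there has residual `-A e_N`, which vanishes in the limit because `P ≻ 0`. The initial
  -- deviation is `0 - x_a`, whence the claim.
  have hmain := hd.tendsto_zero (L := L)
    (e := fun j i => if j ≤ d.N then d.pred 0 (δ i).1 j - (δ i).2.1 else 0) ?_ ?_
  · simpa [pred] using hmain.neg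
  · intro j
    rcases lt_trichotomy j d.N with hj | hj | hj
    · simpa [hj.le] using hQ ⟨j, hj⟩
    · subst hj
      simpa using tendsto_mulVec_zero d.Q hP
    · simpa [hj.not_ge] using tendsto_const_nhds
  · intro j
    rcases lt_trichotomy j d.N with hj | hj | hj
    · have := tendsto_mulVec_zero d.B (hR ⟨j, hj⟩)
      refine this.congr fun i => ?_
      rw [if_pos (by omega), if_pos hj.le, pred, dif_pos hj, mulVec_sub, mulVec_sub]
      rw [show d.A *ᵥ (δ i).2.1 = (δ i).2.1 - d.B *ᵥ (δ i).2.2 from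
        eq_sub_of_add_eq (heq i).symm]
      abel
    · subst hj
      simpa using (tendsto_mulVec_zero d.A hP).neg
    · simpa [hj.not_ge, (Nat.lt_succ_of_lt hj).not_ge] using tendsto_const_nhds

theorem Assumptions.regCost_zero_eq_zero (hd : d.Assumptions) {δ : MPCDecision d.N n m}
    (heq : δ.2.1 = d.A *ᵥ δ.2.1 + d.B *ᵥ δ.2.2) (h : d.regCost 0 δ = 0) :
    δ.2.1 = 0 ∧ ∀ j, δ.1 j = δ.2.2 := by
  refine ⟨?_, fun j => ?_⟩
  · have := hd.tendsto_dir (L := Filter.atTop) (δ := fun _ : ℕ => δ) (fun _ => heq)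
      (by simp [h])
    exact tendsto_nhds_unique tendsto_const_nhds this
  · have h1 := Finset.single_le_sum (f := fun j : Fin d.N => quadForm d.Q (d.pred 0 δ.1 j
      - δ.2.1) + quadForm d.R (δ.1 j - δ.2.2)) (fun j _ => add_nonneg
      (quadForm_nonneg hd.Q_posSemidef _) (quadForm_nonneg hd.R_posDef.posSemidef _))
      (Finset.mem_univ j)
    have h2 := quadForm_nonneg hd.P_posDef.posSemidef (d.pred 0 δ.1 d.N - δ.2.1)
    have h3 := quadForm_nonneg hd.Q_posSemidef (d.pred 0 δ.1 j - δ.2.1)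
    have h4 := quadForm_nonneg hd.R_posDef.posSemidef (δ.1 j - δ.2.2)
    simp only [regCost] at *
    exact sub_eq_zero.1 (eq_zero_of_quadForm_posDef hd.R_posDef (by linarith))

theorem Assumptions.eq_zero_of_regCost (hd : d.Assumptions) {δ : MPCDecision d.N n m}
    (heq : δ.2.1 = d.A *ᵥ δ.2.1 + d.B *ᵥ δ.2.2) (h : d.regCost 0 δ = 0)
    (ho : d.output δ = 0) : δ = 0 := by
  have h1 := hd.regCost_zero_eq_zero heq h
  have h2 := hd.equilibrium_unique _ _ heq ho
  exact Prod.ext (funext fun j => (h1.2 j).trans h2.2) (Prod.ext h2.1 h2.2)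

theorem Assumptions.equilibrium (hd : d.Assumptions) {x : Fin n → ℝ} {z : MPCDecision d.N n m}
    (hz : d.TrackFeasible x z) : z.2.1 = d.A *ᵥ z.2.1 + d.B *ᵥ z.2.2 :=
  (hd.omega_eq _ _ _ hz.2).1

theorem Assumptions.equilibrium_sub (hd : d.Assumptions) {x x' : Fin n → ℝ}
    {z z' : MPCDecision d.N n m} (hz : d.TrackFeasible x z) (hz' : d.TrackFeasible x' z') :
    (z - z').2.1 = d.A *ᵥ (z - z').2.1 + d.B *ᵥ (z - z').2.2 := by
  have h1 := hd.equilibrium hz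
  have h2 := hd.equilibrium hz'
  simp only [Prod.snd_sub, Prod.fst_sub, mulVec_sub]
  conv_lhs => rw [h1, h2]
  abel

theorem Assumptions.output_mem (hd : d.Assumptions) {x : Fin n → ℝ} {z : MPCDecision d.N n m}
    (hz : d.TrackFeasible x z) : d.output z ∈ d.Ysp :=
  ⟨_, hd.omega_eq _ _ _ hz.2, rfl⟩

theorem Assumptions.eq_of_regFeasible (hd : d.Assumptions) {ysp : Fin p → ℝ} {xsp : Fin n → ℝ}
    {usp : Fin m → ℝ} (hsp : d.IsSetpoint ysp xsp usp) {x : Fin n → ℝ} {z : MPCDecision d.N n m}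
    (hz : d.RegFeasible x ysp z) : z.2.1 = xsp ∧ z.2.2 = usp := by
  have h1 := hd.equilibrium hz.1
  have h2 : xsp = d.A *ᵥ xsp + d.B *ᵥ usp := hsp.1.1
  have h3 := hz.2
  rw [output, hsp.2] at h3
  have := hd.equilibrium_unique (z.2.1 - xsp) (z.2.2 - usp) (by
    simp only [mulVec_sub]
    conv_lhs => rw [h1, h2]
    abel) (by
    simp only [mulVec_sub]
    rw [← sub_eq_zero] at h3
    rw [← h3]
    abel)
  exact ⟨sub_eq_zero.1 this.1, sub_eq_zero.1 this.2⟩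

/-- Uniqueness of the minimizer of the regulation problem. -/
theorem Assumptions.reg_unique (hd : d.Assumptions) {x : Fin n → ℝ} {ysp : Fin p → ℝ}
    {z z' : MPCDecision d.N n m} (hz : d.RegFeasible x ysp z) (hz' : d.RegFeasible x ysp z')
    (hmin : ∀ y, d.RegFeasible x ysp y → d.regCost x z ≤ d.regCost x y)
    (hle : d.regCost x z' ≤ d.regCost x z) : z' = z := by
  have h1 := hd.growth (x := x) (F := d.RegFeasible x ysp) (g := fun _ => 0) (z := z) (z' := z')
    (fun t h0 h1 => hz.line hz' h0 h1) (by simp) (by simpa using hmin)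
  have h2 := hd.regCost_nonneg 0 (z' - z)
  have h3 : z' - z = 0 := hd.eq_zero_of_regCost (hd.equilibrium_sub hz'.1 hz.1) (by linarith)
    (by rw [output_sub, hz.2, hz'.2, sub_self])
  exact sub_eq_zero.1 h3

/-! ### Karush-Kuhn-Tucker conditions -/

/-- Linear part of the Lagrangian at `z` in the direction `δ`. -/
def lagDir (d : MPCData n m p) (x : Fin n → ℝ) (lz : Fin d.N → Fin d.rZ → ℝ)
    (lo : Fin d.rO → ℝ) (ν : Fin p → ℝ) (z δ : MPCDecision d.N n m) : ℝ :=
  2 * d.regBilin x z 0 δ + (∑ j : Fin d.N, lz j ⬝ᵥ d.stageDir δ j)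
    + lo ⬝ᵥ d.terminalDir δ + ν ⬝ᵥ d.output δ

theorem Assumptions.lagrangian_line (hd : d.Assumptions) (x : Fin n → ℝ) (ysp : Fin p → ℝ)
    (lz : Fin d.N → Fin d.rZ → ℝ) (lo : Fin d.rO → ℝ) (ν : Fin p → ℝ)
    (z δ : MPCDecision d.N n m) (t : ℝ) :
    d.lagrangian x ysp lz lo ν (z + t • δ) = d.lagrangian x ysp lz lo ν z
      + t * d.lagDir x lz lo ν z δ + t ^ 2 * d.regCost 0 δ := by
  simp only [lagrangian, lagDir, hd.regCost_line, stageResidual_add, terminalResidual_add,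
    output_add, stageDir_smul, terminalDir_smul, output_smul, dotProduct_add, dotProduct_smul,
    dotProduct_sub, Finset.sum_add_distrib, smul_eq_mul, ← Finset.mul_sum]
  ring

theorem Assumptions.lagrangian_add (hd : d.Assumptions) (x : Fin n → ℝ) (ysp : Fin p → ℝ)
    (lz : Fin d.N → Fin d.rZ → ℝ) (lo : Fin d.rO → ℝ) (ν : Fin p → ℝ)
    (z δ : MPCDecision d.N n m) :
    d.lagrangian x ysp lz lo ν (z + δ) = d.lagrangian x ysp lz lo ν z
      + d.lagDir x lz lo ν z δ + d.regCost 0 δ := by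
  simpa using hd.lagrangian_line x ysp lz lo ν z δ 1

theorem differentiable_pred (x : Fin n → ℝ) (j : ℕ) :
    Differentiable ℝ (fun z : MPCDecision d.N n m => d.pred x z.1 j) := by
  have hM : ∀ {r s : ℕ} (M : Matrix (Fin r) (Fin s) ℝ) {f : MPCDecision d.N n m → Fin s → ℝ},
      Differentiable ℝ f → Differentiable ℝ (fun z => M *ᵥ f z) := fun M f hf =>
    (LinearMap.toContinuousLinearMap M.mulVecLin).differentiable.comp hf
  induction j with
  | zero => exact differentiable_const x
  | succ j ih =>
    refine (hM d.A ih).add (hM d.B ?_)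
    split_ifs <;> fun_prop

theorem differentiable_lagrangian (x : Fin n → ℝ) (ysp : Fin p → ℝ)
    (lz : Fin d.N → Fin d.rZ → ℝ) (lo : Fin d.rO → ℝ) (ν : Fin p → ℝ) :
    Differentiable ℝ (d.lagrangian x ysp lz lo ν) := by
  have h := fun j => differentiable_pred (d := d) x j
  unfold lagrangian regCost stageResidual terminalResidual output quadForm dotProduct mulVec
    dotProduct
  fun_prop

/-- On each line the Lagrangian is a quadratic polynomial with linear coefficient `lagDir`; since it
is differentiable, vanishing of these directional derivatives means that its derivative is zero. -/
theorem Assumptions.stationary_iff (hd : d.Assumptions) (x : Fin n → ℝ) (ysp : Fin p → ℝ)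
    (lz : Fin d.N → Fin d.rZ → ℝ) (lo : Fin d.rO → ℝ) (ν : Fin p → ℝ)
    (z : MPCDecision d.N n m) :
    HasFDerivAt (d.lagrangian x ysp lz lo ν) (0 : MPCDecision d.N n m →L[ℝ] ℝ) z ↔
      ∀ δ, d.lagDir x lz lo ν z δ = 0 := by
  have hline : ∀ δ, HasDerivAt (fun t : ℝ => d.lagrangian x ysp lz lo ν (z + t • δ))
      (d.lagDir x lz lo ν z δ) 0 := by
    intro δ
    simp only [hd.lagrangian_line]
    have h1 := ((hasDerivAt_id (0 : ℝ)).mul_const (d.lagDir x lz lo ν z δ)).const_add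
      (d.lagrangian x ysp lz lo ν z)
    have h2 := (hasDerivAt_pow 2 (0 : ℝ)).mul_const (d.regCost 0 δ)
    refine (h1.add h2).congr_deriv ?_
    simp
  have hcomp : ∀ f' : MPCDecision d.N n m →L[ℝ] ℝ, HasFDerivAt (d.lagrangian x ysp lz lo ν) f' z →
      ∀ δ, f' δ = d.lagDir x lz lo ν z δ := by
    intro f' hf δ
    have h1 : HasDerivAt (fun t : ℝ => z + t • δ) δ 0 := by
      simpa using ((hasDerivAt_id (0 : ℝ)).smul_const δ).const_add z
    have h2 : HasFDerivAt (d.lagrangian x ysp lz lo ν) f' (z + (0 : ℝ) • δ) := by simpa using hf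
    have h3 : HasDerivAt (fun t : ℝ => d.lagrangian x ysp lz lo ν (z + t • δ)) (f' δ) 0 :=
      HasFDerivAt.comp_hasDerivAt (f := fun t : ℝ => z + t • δ)
        (l := d.lagrangian x ysp lz lo ν) (0 : ℝ) h2 h1
    exact h3.unique (hline δ)
  constructor
  · intro h δ
    simpa using (hcomp _ h δ).symm
  · intro h
    have h1 := (differentiable_lagrangian (d := d) x ysp lz lo ν z).hasFDerivAt
    have h2 : fderiv ℝ (d.lagrangian x ysp lz lo ν) z = 0 := by
      refine ContinuousLinearMap.ext fun δ => ?_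
      rw [hcomp _ h1 δ, h δ]
      rfl
    rwa [h2] at h1

theorem dotProduct_nonpos {k : ℕ} {a b : Fin k → ℝ} (ha : ∀ i, 0 ≤ a i) (hb : b ≤ 0) :
    a ⬝ᵥ b ≤ 0 :=
  Finset.sum_nonpos fun i _ => mul_nonpos_of_nonneg_of_nonpos (ha i) (hb i)

/-- A quadratic with zero derivative at `z` exceeds its value there by exactly its second-order
part. Complementarity identifies the Lagrangian with the cost at `z`, and at `z'` the inequality
terms only lower it. Since `z'` need not meet the setpoint, the term in `ν` survives; the quadratic
excess is kept for uniqueness. -/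
theorem IsKKT.le_regCost (hd : d.Assumptions) {x : Fin n → ℝ} {ysp : Fin p → ℝ}
    {z : MPCDecision d.N n m} {lz : Fin d.N → Fin d.rZ → ℝ} {lo : Fin d.rO → ℝ} {ν : Fin p → ℝ}
    (h : d.IsKKT x ysp z lz lo ν) {z' : MPCDecision d.N n m} (hz' : d.TrackFeasible x z') :
    d.regCost x z + d.regCost 0 (z' - z) ≤ d.regCost x z' + ν ⬝ᵥ (d.output z' - ysp) := by
  have h1 := hd.lagrangian_add x ysp lz lo ν z (z' - z)
  rw [(hd.stationary_iff x ysp lz lo ν z).1 h.stationary, add_sub_cancel, add_zero] at h1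
  have h2 : d.lagrangian x ysp lz lo ν z = d.regCost x z := by
    have e1 : ∀ j, lz j ⬝ᵥ d.stageResidual x z j = 0 := fun j =>
      Finset.sum_eq_zero fun i _ => h.lz_compl j i
    have e2 : lo ⬝ᵥ d.terminalResidual x z = 0 := Finset.sum_eq_zero fun i _ => h.lo_compl i
    simp [lagrangian, e1, e2, h.feasible.2]
  rw [trackFeasible_iff] at hz'
  have h3 : ∑ j : Fin d.N, lz j ⬝ᵥ d.stageResidual x z' j ≤ 0 :=
    Finset.sum_nonpos fun j _ => dotProduct_nonpos (h.lz_nonneg j) (hz'.1 j)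
  have h4 := dotProduct_nonpos h.lo_nonneg hz'.2
  rw [h2] at h1
  rw [← h1, lagrangian]
  linarith

theorem dotProduct_le_sum_abs_mul_norm {k : ℕ} (ν w : Fin k → ℝ) :
    ν ⬝ᵥ w ≤ (∑ i, |ν i|) * ‖w‖ := by
  rw [dotProduct, Finset.sum_mul]
  refine Finset.sum_le_sum fun i _ => (le_abs_self _).trans ?_
  rw [abs_mul]
  exact mul_le_mul_of_nonneg_left (norm_le_pi_norm w i) (abs_nonneg _)

theorem IsKKT.isMin (hd : d.Assumptions) {x : Fin n → ℝ} {ysp : Fin p → ℝ}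
    {z : MPCDecision d.N n m} {lz : Fin d.N → Fin d.rZ → ℝ} {lo : Fin d.rO → ℝ} {ν : Fin p → ℝ}
    (h : d.IsKKT x ysp z lz lo ν) {z' : MPCDecision d.N n m} (hz' : d.RegFeasible x ysp z') :
    d.regCost x z ≤ d.regCost x z' := by
  have h1 := h.le_regCost hd hz'.1
  rw [hz'.2, sub_self, dotProduct_zero] at h1
  linarith [hd.regCost_nonneg 0 (z' - z)]

/-- Minimizers of the regulation problem satisfy the KKT conditions. -/
theorem Assumptions.exists_isKKT (hd : d.Assumptions) {x : Fin n → ℝ} {ysp : Fin p → ℝ}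
    {z : MPCDecision d.N n m} (hz : d.RegFeasible x ysp z)
    (hmin : ∀ y, d.RegFeasible x ysp y → d.regCost x z ≤ d.regCost x y) :
    ∃ lz lo ν, d.IsKKT x ysp z lz lo ν := by
  let res : (Fin d.N × Fin d.rZ) ⊕ Fin d.rO → ℝ :=
    Sum.elim (fun q => d.stageResidual x z q.1 q.2) (d.terminalResidual x z)
  let a : (Fin d.N × Fin d.rZ) ⊕ Fin d.rO → MPCDecision d.N n m →ₗ[ℝ] ℝ :=
    Sum.elim (fun q => IsLinearMap.mk' (fun δ => d.stageDir δ q.1 q.2)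
        ⟨fun δ δ' => by rw [stageDir_add]; rfl, fun t δ => by rw [stageDir_smul]; rfl⟩)
      (fun i => IsLinearMap.mk' (fun δ => d.terminalDir δ i)
        ⟨fun δ δ' => by rw [terminalDir_add]; rfl, fun t δ => by rw [terminalDir_smul]; rfl⟩)
  let e : Fin p → MPCDecision d.N n m →ₗ[ℝ] ℝ := fun k => IsLinearMap.mk'
    (fun δ => d.output δ k) ⟨fun δ δ' => by rw [output_add]; rfl,
      fun t δ => by rw [output_smul]; rfl⟩
  let c : MPCDecision d.N n m →ₗ[ℝ] ℝ := IsLinearMap.mk' (fun δ => 2 * d.regBilin x z 0 δ)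
    ⟨fun δ δ' => by rw [regBilin_add_right, mul_add],
      fun t δ => by rw [regBilin_smul_right, smul_eq_mul]; ring⟩
  have hfz := (trackFeasible_iff x z).1 hz.1
  have hres : ∀ i, res i ≤ 0 := by
    rintro (⟨j, i⟩ | i)
    · exact hfz.1 j i
    · exact hfz.2 i
  obtain ⟨l, ν, hl, hl0, hst⟩ := farkas {i | res i = 0} a e c (by
    intro δ h1 h2
    -- Along a short step in `δ`, active constraints persist by linearity and inactive ones by
    -- continuity; thus no constraint qualification is required.
    have hev : ∀ᶠ t : ℝ in 𝓝[>] 0, ∀ i, res i + t * a i δ ≤ 0 := by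
      rw [Filter.eventually_all]
      intro i
      by_cases hi : res i = 0
      · filter_upwards [self_mem_nhdsWithin] with t ht
        rw [hi, zero_add]
        exact mul_nonpos_of_nonneg_of_nonpos (le_of_lt ht) (h1 i hi)
      · have hlt : res i < 0 := lt_of_le_of_ne (hres i) hi
        have hc : Filter.Tendsto (fun t : ℝ => res i + t * a i δ) (𝓝[>] 0) (𝓝 (res i)) := by
          have : Continuous fun t : ℝ => res i + t * a i δ := by fun_prop
          simpa using (this.tendsto 0).mono_left nhdsWithin_le_nhds
        exact (hc.eventually (gt_mem_nhds hlt)).mono fun t ht => le_of_lt ht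
    have hge : ∀ᶠ t : ℝ in 𝓝[>] 0, 0 ≤ c δ + t * d.regCost 0 δ := by
      filter_upwards [hev, self_mem_nhdsWithin] with t ht ht0
      have hfeas : d.RegFeasible x ysp (z + t • δ) := by
        refine ⟨(trackFeasible_iff _ _).2 ⟨fun j i => ?_, fun i => ?_⟩, ?_⟩
        · rw [stageResidual_add, stageDir_smul]
          exact ht (.inl (j, i))
        · rw [terminalResidual_add, terminalDir_smul]
          exact ht (.inr i)
        · rw [output_add, output_smul, hz.2, show d.output δ = 0 from funext h2, smul_zero,
            add_zero]
      have h3 := hmin _ hfeas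
      rw [hd.regCost_line] at h3
      have h5 : 0 ≤ t * (2 * d.regBilin x z 0 δ + t * d.regCost 0 δ) := by nlinarith
      exact nonneg_of_mul_nonneg_right h5 ht0
    have hc : Filter.Tendsto (fun t : ℝ => c δ + t * d.regCost 0 δ) (𝓝[>] 0) (𝓝 (c δ)) := by
      have : Continuous fun t : ℝ => c δ + t * d.regCost 0 δ := by fun_prop
      simpa using (this.tendsto 0).mono_left nhdsWithin_le_nhds
    exact ge_of_tendsto hc hge)
  refine ⟨fun j i => l (.inl (j, i)), fun i => l (.inr i), ν, hz, fun j i => hl _, fun i => hl _,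
    fun j i => ?_, fun i => ?_, (hd.stationary_iff _ _ _ _ _ _).2 fun δ => ?_⟩
  · by_cases h : d.stageResidual x z j i = 0
    · rw [h, mul_zero]
    · rw [hl0 (.inl (j, i)) h, zero_mul]
  · by_cases h : d.terminalResidual x z i = 0
    · rw [h, mul_zero]
    · rw [hl0 (.inr i) h, zero_mul]
  · have := hst δ
    rw [Fintype.sum_sum_type, Fintype.sum_prod_type] at this
    rw [← this, lagDir, add_assoc (2 * _)]
    rfl

end MPCData

namespace MPCData

variable {n m p : ℕ} {d : MPCData n m p}

/-! ### Decisions given by input sequences -/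

/-- The decision made of the first inputs of a sequence and of the target `(xa, ua)`. -/
def seqDecision (d : MPCData n m p) (u : ℕ → Fin m → ℝ) (xa : Fin n → ℝ) (ua : Fin m → ℝ) :
    MPCDecision d.N n m := (fun j => u j, xa, ua)

theorem pred_seqDecision (x : Fin n → ℝ) (u : ℕ → Fin m → ℝ) (xa : Fin n → ℝ) (ua : Fin m → ℝ)
    {j : ℕ} (hj : j ≤ d.N) : d.pred x (d.seqDecision u xa ua).1 j = d.traj x u j := by
  induction j with
  | zero => rfl
  | succ j ih =>
    rw [pred, traj, ih (by omega), dif_pos (by omega)]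
    rfl

theorem regCost_seqDecision (x : Fin n → ℝ) (u : ℕ → Fin m → ℝ) (xa : Fin n → ℝ)
    (ua : Fin m → ℝ) : d.regCost x (d.seqDecision u xa ua)
      = ∑ j ∈ Finset.range d.N, d.stage xa ua (d.traj x u j) (u j)
        + quadForm d.P (d.traj x u d.N - xa) := by
  rw [regCost, pred_seqDecision _ _ _ _ le_rfl, Finset.sum_range]
  congr 1
  refine Finset.sum_congr rfl fun j _ => ?_
  rw [pred_seqDecision _ _ _ _ j.2.le]
  rfl

theorem trackFeasible_seqDecision (x : Fin n → ℝ) (u : ℕ → Fin m → ℝ) (xa : Fin n → ℝ)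
    (ua : Fin m → ℝ) : d.TrackFeasible x (d.seqDecision u xa ua) ↔
      (∀ j < d.N, (d.traj x u j, u j) ∈ d.Z) ∧ (d.traj x u d.N, xa, ua) ∈ d.Omega := by
  rw [TrackFeasible, pred_seqDecision _ _ _ _ le_rfl]
  refine and_congr ⟨fun h j hj => ?_, fun h j => ?_⟩ Iff.rfl
  · have := h ⟨j, hj⟩
    rwa [pred_seqDecision _ _ _ _ hj.le] at this
  · rw [pred_seqDecision _ _ _ _ j.2.le]
    exact h j j.2

/-- The input at time `N` lies outside the decision and is free; the shift takes the LQR input at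
the predicted terminal state. -/
theorem exists_seqDecision (z : MPCDecision d.N n m) (v : Fin m → ℝ) :
    ∃ u : ℕ → Fin m → ℝ, u d.N = v ∧ d.seqDecision u z.2.1 z.2.2 = z := by
  refine ⟨fun j => if hj : j < d.N then z.1 ⟨j, hj⟩ else v, by simp, ?_⟩
  refine Prod.ext (funext fun j => ?_) rfl
  simp [seqDecision]

/-! ### The terminal law -/

/-- The unconstrained LQR law for the target `(xa, ua)`. -/
def lqrLaw (d : MPCData n m p) (xa : Fin n → ℝ) (ua : Fin m → ℝ) (x : Fin n → ℝ) :
    Fin m → ℝ := d.K *ᵥ (x - xa) + ua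

theorem Assumptions.closedLoop_lqrLaw_mem (hd : d.Assumptions) {x xa : Fin n → ℝ}
    {ua : Fin m → ℝ} (h : (x, xa, ua) ∈ d.Omega) (k : ℕ) :
    (d.closedLoop (d.lqrLaw xa ua) x k, xa, ua) ∈ d.Omega := by
  induction k with
  | zero => exact h
  | succ k ih => exact hd.omega_inv _ _ _ ih

theorem Assumptions.sum_stage_lqrLaw (hd : d.Assumptions) {xa : Fin n → ℝ}
    {ua : Fin m → ℝ} (heq : xa = d.A *ᵥ xa + d.B *ᵥ ua) (x : Fin n → ℝ) (k : ℕ) :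
    ∑ j ∈ Finset.range k, d.stage xa ua (d.closedLoop (d.lqrLaw xa ua) x j)
      (d.lqrLaw xa ua (d.closedLoop (d.lqrLaw xa ua) x j))
      + quadForm d.P (d.closedLoop (d.lqrLaw xa ua) x k - xa) = quadForm d.P (x - xa) := by
  induction k with
  | zero => simp [closedLoop]
  | succ k ih =>
    rw [Finset.sum_range_succ, add_assoc, closedLoop, hd.stage_add_terminal heq, ← lqrLaw, sub_self,
      quadForm_zero, add_zero, ih]

theorem Assumptions.exists_lqr_decision (hd : d.Assumptions) {x xa : Fin n → ℝ}
    {ua : Fin m → ℝ} (h : (x, xa, ua) ∈ d.Omega) :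
    ∃ z : MPCDecision d.N n m, d.TrackFeasible x z ∧ z.2.1 = xa ∧ z.2.2 = ua ∧
      d.regCost x z = quadForm d.P (x - xa) := by
  refine ⟨d.seqDecision (fun k => d.lqrLaw xa ua (d.closedLoop (d.lqrLaw xa ua) x k)) xa ua,
    ?_, rfl, rfl, ?_⟩
  · rw [trackFeasible_seqDecision]
    simp only [closedLoop_eq_traj]
    exact ⟨fun j _ => hd.omega_adm _ _ _ (hd.closedLoop_lqrLaw_mem h j),
      hd.closedLoop_lqrLaw_mem h _⟩
  · rw [regCost_seqDecision]
    simp only [closedLoop_eq_traj]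
    exact hd.sum_stage_lqrLaw (hd.omega_eq _ _ _ h).1 x d.N

/-- The shifted decision is feasible at the successor state, and its cost is smaller by exactly
the first stage cost. -/
theorem Assumptions.exists_shift (hd : d.Assumptions) {x : Fin n → ℝ} {z : MPCDecision d.N n m}
    (hz : d.TrackFeasible x z) : ∃ z' : MPCDecision d.N n m,
      d.TrackFeasible (d.A *ᵥ x + d.B *ᵥ d.firstInput z) z' ∧ z'.2 = z.2 ∧
      d.regCost (d.A *ᵥ x + d.B *ᵥ d.firstInput z) z'
        + d.stage z.2.1 z.2.2 x (d.firstInput z) = d.regCost x z := by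
  obtain ⟨u, hu, hz'⟩ := exists_seqDecision z (d.lqrLaw z.2.1 z.2.2 (d.pred x z.1 d.N))
  have hu0 : d.firstInput z = u 0 := by rw [← hz']; rfl
  have hNp : d.pred x z.1 d.N = d.traj x u d.N := by
    conv_lhs => rw [← hz']
    exact pred_seqDecision _ _ _ _ le_rfl
  rw [hNp] at hu
  have hc := regCost_seqDecision (d := d) x u z.2.1 z.2.2
  have hf := (trackFeasible_seqDecision (d := d) x u z.2.1 z.2.2).1 (hz'.symm ▸ hz)
  rw [hz'] at hc
  refine ⟨d.seqDecision (fun j => u (j + 1)) z.2.1 z.2.2, ?_, rfl, ?_⟩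
  · rw [trackFeasible_seqDecision, hu0]
    simp only [← traj_succ']
    refine ⟨fun j hj => ?_, ?_⟩
    · rcases Nat.lt_or_ge (j + 1) d.N with h | h
      · exact hf.1 _ h
      · have : j + 1 = d.N := by omega
        rw [this, hu]
        exact hd.omega_adm _ _ _ hf.2
    · rw [traj, hu]
      exact hd.omega_inv _ _ _ hf.2
  · rw [regCost_seqDecision, hu0, hc]
    simp only [← traj_succ']
    -- The sum over times `0` to `N` is split off at its first and at its last term. The last stage
    -- cost plus the new terminal cost is the old terminal cost, as the appended input is the LQR
    -- one.
    have h1 := Finset.sum_range_succ' (fun j => d.stage z.2.1 z.2.2 (d.traj x u j) (u j)) d.N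
    have h2 := hd.stage_add_terminal (hd.equilibrium hz) (d.traj x u d.N) (u d.N)
    rw [Finset.sum_range_succ] at h1
    have h3 : u d.N - (d.K *ᵥ (d.traj x u d.N - z.2.1) + z.2.2) = 0 := by
      rw [hu, lqrLaw, sub_self]
    rw [h3, quadForm_zero, add_zero] at h2
    have h4 : d.traj x u 0 = x := rfl
    simp only [h4] at h1
    rw [traj]
    linarith

/-! ### Infinite-horizon costs -/

theorem costToGo_eq (xsp : Fin n → ℝ) (usp : Fin m → ℝ) (κ : (Fin n → ℝ) → Fin m → ℝ)
    (x : Fin n → ℝ) : d.costToGo xsp usp κ x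
      = ∑' k, ENNReal.ofReal (d.stage xsp usp (d.closedLoop κ x k) (κ (d.closedLoop κ x k))) :=
  rfl

theorem costToGo_succ (xsp : Fin n → ℝ) (usp : Fin m → ℝ) (κ : (Fin n → ℝ) → Fin m → ℝ)
    (x : Fin n → ℝ) : d.costToGo xsp usp κ x = ENNReal.ofReal (d.stage xsp usp x (κ x))
      + d.costToGo xsp usp κ (d.A *ᵥ x + d.B *ᵥ κ x) := by
  rw [costToGo_eq, tsum_eq_zero_add' ENNReal.summable, costToGo_eq]
  simp only [closedLoop_succ']
  rfl

theorem Assumptions.costToGo_add (hd : d.Assumptions) (xsp : Fin n → ℝ) (usp : Fin m → ℝ)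
    (κ : (Fin n → ℝ) → Fin m → ℝ) (x : Fin n → ℝ) (k : ℕ) :
    d.costToGo xsp usp κ x = ENNReal.ofReal (∑ j ∈ Finset.range k,
        d.stage xsp usp (d.closedLoop κ x j) (κ (d.closedLoop κ x j)))
      + d.costToGo xsp usp κ (d.closedLoop κ x k) := by
  induction k with
  | zero => simp [closedLoop]
  | succ k ih =>
    rw [ih, costToGo_succ, Finset.sum_range_succ, ENNReal.ofReal_add
      (Finset.sum_nonneg fun _ _ => hd.stage_nonneg _ _ _ _) (hd.stage_nonneg _ _ _ _), add_assoc,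
      closedLoop]

theorem Assumptions.costToGo_le (hd : d.Assumptions) {xsp : Fin n → ℝ} {usp : Fin m → ℝ}
    {κ : (Fin n → ℝ) → Fin m → ℝ} {x : Fin n → ℝ} {c : ℝ}
    (h : ∀ k, ∑ j ∈ Finset.range k, d.stage xsp usp (d.closedLoop κ x j)
      (κ (d.closedLoop κ x j)) ≤ c) : d.costToGo xsp usp κ x ≤ ENNReal.ofReal c := by
  rw [costToGo_eq]
  refine ENNReal.tsum_le_of_sum_range_le fun k => ?_
  rw [← ENNReal.ofReal_sum_of_nonneg fun _ _ => hd.stage_nonneg _ _ _ _]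
  exact ENNReal.ofReal_le_ofReal (h k)

theorem Assumptions.costToGo_lqrLaw_le (hd : d.Assumptions) {xa : Fin n → ℝ}
    {ua : Fin m → ℝ} (heq : xa = d.A *ᵥ xa + d.B *ᵥ ua) (x : Fin n → ℝ) :
    d.costToGo xa ua (d.lqrLaw xa ua) x ≤ ENNReal.ofReal (quadForm d.P (x - xa)) := by
  refine hd.costToGo_le fun k => ?_
  have := hd.sum_stage_lqrLaw heq x k
  linarith [quadForm_nonneg hd.P_posDef.posSemidef
    (d.closedLoop (d.lqrLaw xa ua) x k - xa)]

theorem Assumptions.stage_tendsto (hd : d.Assumptions) {xa xb : ℕ → Fin n → ℝ}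
    {ua ub : ℕ → Fin m → ℝ}
    (h : Filter.Tendsto (fun k => d.stage (xa k) (ua k) (xb k) (ub k)) Filter.atTop (𝓝 0)) :
    Filter.Tendsto (fun k => d.Q *ᵥ (xb k - xa k)) Filter.atTop (𝓝 0) ∧
      Filter.Tendsto (fun k => ub k - ua k) Filter.atTop (𝓝 0) := by
  have hQ0 : ∀ (M : Fin n → ℝ), 0 ≤ quadForm d.Q M := quadForm_nonneg hd.Q_posSemidef
  have hR0 : ∀ (M : Fin m → ℝ), 0 ≤ quadForm d.R M := quadForm_nonneg hd.R_posDef.posSemidef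
  constructor
  · exact tendsto_mulVec_of_quadForm hd.Q_posSemidef
      (squeeze_zero (fun k => hQ0 _) (fun k => le_add_of_nonneg_right (hR0 _)) h)
  · exact tendsto_of_quadForm_posDef hd.R_posDef
      (squeeze_zero (fun k => hR0 _) (fun k => le_add_of_nonneg_left (hQ0 _)) h)

/-- Closed-loop trajectories of finite cost converge to the equilibrium. -/
theorem Assumptions.tendsto_of_costToGo (hd : d.Assumptions) {xsp : Fin n → ℝ} {usp : Fin m → ℝ}
    (heq : xsp = d.A *ᵥ xsp + d.B *ᵥ usp) {κ : (Fin n → ℝ) → Fin m → ℝ} {x : Fin n → ℝ}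
    (h : d.costToGo xsp usp κ x < ⊤) :
    Filter.Tendsto (d.closedLoop κ x) Filter.atTop (𝓝 xsp) := by
  have h0 : Filter.Tendsto (fun k => d.stage xsp usp (d.closedLoop κ x k)
      (κ (d.closedLoop κ x k))) Filter.atTop (𝓝 0) := by
    have := ENNReal.tendsto_atTop_zero_of_tsum_ne_top h.ne
    have h2 := (ENNReal.tendsto_toReal ENNReal.zero_ne_top).comp this
    refine h2.congr fun k => ENNReal.toReal_ofReal ?_
    exact hd.stage_nonneg xsp usp _ _
  obtain ⟨h1, h2⟩ := hd.stage_tendsto (xa := fun _ => xsp) (ua := fun _ => usp) h0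
  have := hd.tendsto_zero (L := Filter.atTop) (e := fun j k => d.closedLoop κ x (k + j) - xsp)
    (fun j => h1.comp (Filter.tendsto_add_atTop_nat j)) (fun j => by
      refine ((tendsto_mulVec_zero d.B h2).comp (Filter.tendsto_add_atTop_nat j)).congr fun k => ?_
      simp only [Function.comp_apply, mulVec_sub]
      rw [show d.closedLoop κ x (k + (j + 1)) = d.A *ᵥ d.closedLoop κ x (k + j)
        + d.B *ᵥ κ (d.closedLoop κ x (k + j)) from rfl,
        show d.A *ᵥ xsp = xsp - d.B *ᵥ usp from eq_sub_of_add_eq heq.symm]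
      abel)
  simpa using this.add_const xsp

/-- The unconstrained LQR cost is a lower bound of the infinite-horizon cost. -/
theorem Assumptions.quadForm_le_costToGo (hd : d.Assumptions) {xsp : Fin n → ℝ} {usp : Fin m → ℝ}
    (heq : xsp = d.A *ᵥ xsp + d.B *ᵥ usp) (κ : (Fin n → ℝ) → Fin m → ℝ) (x : Fin n → ℝ) :
    ENNReal.ofReal (quadForm d.P (x - xsp)) ≤ d.costToGo xsp usp κ x := by
  rcases eq_top_or_lt_top (d.costToGo xsp usp κ x) with h | h
  · rw [h]; exact le_top
  have hP0 : ∀ (M : Fin n → ℝ), 0 ≤ quadForm d.P M := quadForm_nonneg hd.P_posDef.posSemidef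
  have hsum : ∀ k, quadForm d.P (x - xsp) ≤ ∑ j ∈ Finset.range k,
      d.stage xsp usp (d.closedLoop κ x j) (κ (d.closedLoop κ x j))
        + quadForm d.P (d.closedLoop κ x k - xsp) := by
    intro k
    induction k with
    | zero => simp [closedLoop]
    | succ k ih =>
      have h1 := hd.stage_add_terminal heq (d.closedLoop κ x k) (κ (d.closedLoop κ x k))
      have h2 := quadForm_nonneg hd.gainHessian_posDef.posSemidef (κ (d.closedLoop κ x k)
        - (d.K *ᵥ (d.closedLoop κ x k - xsp) + usp))
      rw [Finset.sum_range_succ, closedLoop]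
      linarith
  -- A finite cost forces convergence to the equilibrium, so the terminal term left over by
  -- telescoping disappears in the limit.
  have hlim : Filter.Tendsto (fun k => d.costToGo xsp usp κ x
      + ENNReal.ofReal (quadForm d.P (d.closedLoop κ x k - xsp))) Filter.atTop
      (𝓝 (d.costToGo xsp usp κ x + 0)) := by
    refine tendsto_const_nhds.add ?_
    have h1 : Filter.Tendsto (fun k => d.closedLoop κ x k - xsp) Filter.atTop (𝓝 0) := by
      simpa using (hd.tendsto_of_costToGo heq h).sub_const xsp
    have h2 := ((continuous_quadForm d.P).tendsto 0).comp h1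
    simpa using ENNReal.tendsto_ofReal h2
  rw [add_zero] at hlim
  refine ge_of_tendsto' hlim fun k => ?_
  have hs := hd.costToGo_add xsp usp κ x k
  calc ENNReal.ofReal (quadForm d.P (x - xsp))
      ≤ ENNReal.ofReal (∑ j ∈ Finset.range k, d.stage xsp usp (d.closedLoop κ x j)
        (κ (d.closedLoop κ x j)) + quadForm d.P (d.closedLoop κ x k - xsp)) :=
        ENNReal.ofReal_le_ofReal (hsum k)
    _ = ENNReal.ofReal (∑ j ∈ Finset.range k, d.stage xsp usp (d.closedLoop κ x j)
        (κ (d.closedLoop κ x j))) + ENNReal.ofReal (quadForm d.P (d.closedLoop κ x k - xsp)) :=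
        ENNReal.ofReal_add (Finset.sum_nonneg fun _ _ => hd.stage_nonneg _ _ _ _) (hP0 _)
    _ ≤ _ := by
        gcongr
        rw [hs]
        exact le_self_add

/-- Equality in the LQR lower bound forces the LQR input. -/
theorem Assumptions.eq_lqrLaw_of_costToGo_le (hd : d.Assumptions) {xsp : Fin n → ℝ}
    {usp : Fin m → ℝ} (heq : xsp = d.A *ᵥ xsp + d.B *ᵥ usp) {κ : (Fin n → ℝ) → Fin m → ℝ}
    {x : Fin n → ℝ} (h : d.costToGo xsp usp κ x ≤ ENNReal.ofReal (quadForm d.P (x - xsp))) :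
    κ x = d.lqrLaw xsp usp x := by
  have hP0 : ∀ (M : Fin n → ℝ), 0 ≤ quadForm d.P M := quadForm_nonneg hd.P_posDef.posSemidef
  have h1 := hd.stage_add_terminal heq x (κ x)
  have h2 := quadForm_nonneg hd.gainHessian_posDef.posSemidef (κ x - (d.K *ᵥ (x - xsp) + usp))
  -- Bounding only the tail after one step by the LQR cost leaves no room for the excess term of the
  -- first input.
  have h3 : ENNReal.ofReal (d.stage xsp usp x (κ x)
      + quadForm d.P (d.A *ᵥ x + d.B *ᵥ κ x - xsp)) ≤ ENNReal.ofReal (quadForm d.P (x - xsp)) := by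
    rw [ENNReal.ofReal_add (hd.stage_nonneg _ _ _ _) (hP0 _)]
    refine le_trans ?_ h
    rw [costToGo_succ]
    gcongr
    exact hd.quadForm_le_costToGo heq κ _
  rw [ENNReal.ofReal_le_ofReal_iff (hP0 _)] at h3
  have h4 := eq_zero_of_quadForm_posDef hd.gainHessian_posDef (le_antisymm (by linarith) h2)
  exact sub_eq_zero.1 h4

/-! ### The regulation law -/

/-- The shifted minimizer keeps its artificial equilibrium, so it still meets the setpoint.
Comparison with an arbitrary feasible `z`, rather than the minimizer, lets the estimate be iterated.
-/
theorem Assumptions.regLaw_step (hd : d.Assumptions) {ysp : Fin p → ℝ} {xsp : Fin n → ℝ}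
    {usp : Fin m → ℝ} (hsp : d.IsSetpoint ysp xsp usp) {κr : (Fin n → ℝ) → Fin m → ℝ}
    (hr : d.IsRegLaw ysp κr) {x : Fin n → ℝ} {z : MPCDecision d.N n m}
    (hz : d.RegFeasible x ysp z) : (x, κr x) ∈ d.Z ∧ ∃ z' : MPCDecision d.N n m,
      d.RegFeasible (d.A *ᵥ x + d.B *ᵥ κr x) ysp z' ∧
      d.regCost (d.A *ᵥ x + d.B *ᵥ κr x) z' + d.stage xsp usp x (κr x) ≤ d.regCost x z := by
  obtain ⟨y, hy, hmin, hκ⟩ := hr x ⟨z, hz⟩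
  obtain ⟨z', hz', h2, hc⟩ := hd.exists_shift hy.1
  obtain ⟨e1, e2⟩ := hd.eq_of_regFeasible hsp hy
  rw [← hκ] at hz' hc
  rw [e1, e2] at hc
  refine ⟨?_, z', ⟨hz', ?_⟩, hc.trans_le (hmin z hz)⟩
  · rw [hκ]
    exact hy.1.1 ⟨0, d.N_pos⟩
  · rw [← hy.2, output, h2]
    rfl

theorem Assumptions.regLaw_iterate (hd : d.Assumptions) {ysp : Fin p → ℝ} {xsp : Fin n → ℝ}
    {usp : Fin m → ℝ} (hsp : d.IsSetpoint ysp xsp usp) {κr : (Fin n → ℝ) → Fin m → ℝ}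
    (hr : d.IsRegLaw ysp κr) {x : Fin n → ℝ} {z : MPCDecision d.N n m}
    (hz : d.RegFeasible x ysp z) (k : ℕ) : ∃ z' : MPCDecision d.N n m,
      d.RegFeasible (d.closedLoop κr x k) ysp z' ∧
      d.regCost (d.closedLoop κr x k) z' + ∑ j ∈ Finset.range k,
        d.stage xsp usp (d.closedLoop κr x j) (κr (d.closedLoop κr x j)) ≤ d.regCost x z := by
  induction k with
  | zero => exact ⟨z, hz, by simp [closedLoop]⟩
  | succ k ih =>
    obtain ⟨z', hz', hc⟩ := ih
    obtain ⟨-, y, hy, hcy⟩ := hd.regLaw_step hsp hr hz'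
    refine ⟨y, hy, ?_⟩
    rw [Finset.sum_range_succ, closedLoop]
    linarith

theorem Assumptions.regLaw_admissible (hd : d.Assumptions) {ysp : Fin p → ℝ} {xsp : Fin n → ℝ}
    {usp : Fin m → ℝ} (hsp : d.IsSetpoint ysp xsp usp) {κr : (Fin n → ℝ) → Fin m → ℝ}
    (hr : d.IsRegLaw ysp κr) {x : Fin n → ℝ} (hx : x ∈ d.regRegion ysp) :
    d.AdmissibleFrom κr x := by
  intro k
  obtain ⟨z, hz⟩ := hx
  obtain ⟨z', hz', -⟩ := hd.regLaw_iterate hsp hr hz k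
  exact (hd.regLaw_step hsp hr hz').1

theorem Assumptions.regLaw_costToGo_le (hd : d.Assumptions) {ysp : Fin p → ℝ} {xsp : Fin n → ℝ}
    {usp : Fin m → ℝ} (hsp : d.IsSetpoint ysp xsp usp) {κr : (Fin n → ℝ) → Fin m → ℝ}
    (hr : d.IsRegLaw ysp κr) {x : Fin n → ℝ} {z : MPCDecision d.N n m}
    (hz : d.RegFeasible x ysp z) : d.costToGo xsp usp κr x ≤ ENNReal.ofReal (d.regCost x z) := by
  refine hd.costToGo_le fun k => ?_
  obtain ⟨z', hz', hc⟩ := hd.regLaw_iterate hsp hr hz k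
  linarith [hd.regCost_nonneg (d.closedLoop κr x k) z']

/-! ### Existence of minimizers of the regulation problem -/

theorem continuous_pred (j : ℕ) :
    Continuous (fun q : (Fin n → ℝ) × MPCDecision d.N n m => d.pred q.1 q.2.1 j) := by
  induction j with
  | zero => exact continuous_fst
  | succ j ih =>
    simp only [pred]
    refine (continuous_const.matrix_mulVec ih).add (continuous_const.matrix_mulVec ?_)
    split_ifs <;> fun_prop

theorem continuous_regCost :
    Continuous (fun q : (Fin n → ℝ) × MPCDecision d.N n m => d.regCost q.1 q.2) := by
  have h := fun j => continuous_pred (d := d) j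
  have hQ := fun M : Matrix (Fin n) (Fin n) ℝ => continuous_quadForm M
  have hR := fun M : Matrix (Fin m) (Fin m) ℝ => continuous_quadForm M
  unfold regCost
  fun_prop

theorem isClosed_regFeasible (x : Fin n → ℝ) (ysp : Fin p → ℝ) :
    IsClosed {z | d.RegFeasible x ysp z} := by
  have h : ∀ j, Continuous (fun z : MPCDecision d.N n m => d.pred x z.1 j) := fun j =>
    (continuous_pred (d := d) j).comp (continuous_const.prodMk continuous_id)
  simp only [RegFeasible, trackFeasible_iff, Set.ofPred_and, Set.ofPred_forall]
  refine ((isClosed_iInter fun j => isClosed_le ?_ continuous_const).inter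
    (isClosed_le ?_ continuous_const)).inter (isClosed_eq ?_ continuous_const)
  · unfold stageResidual
    fun_prop
  · unfold terminalResidual
    fun_prop
  · unfold output
    fun_prop

/-- The artificial equilibrium is fixed by the setpoint and the inputs lie in the compact projection
of `𝒵`, so the feasible decisions form a compact set. -/
theorem Assumptions.exists_regLaw (hd : d.Assumptions) {ysp : Fin p → ℝ} {xsp : Fin n → ℝ}
    {usp : Fin m → ℝ} (hsp : d.IsSetpoint ysp xsp usp) : ∃ κr, d.IsRegLaw ysp κr := by
  have key : ∀ x : Fin n → ℝ, ∃ v : Fin m → ℝ, x ∈ d.regRegion ysp → ∃ z, d.RegFeasible x ysp z ∧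
      (∀ z', d.RegFeasible x ysp z' → d.regCost x z ≤ d.regCost x z') ∧ v = d.firstInput z := by
    intro x
    by_cases hx : x ∈ d.regRegion ysp
    · have hsub : {z | d.RegFeasible x ysp z} ⊆
          (Set.univ.pi fun _ : Fin d.N => Prod.snd '' d.Z) ×ˢ ({xsp} ×ˢ {usp}) := by
        intro z hz
        obtain ⟨e1, e2⟩ := hd.eq_of_regFeasible hsp hz
        exact ⟨fun j _ => ⟨_, hz.1.1 j, rfl⟩, e1, e2⟩
      have hcomp : IsCompact {z | d.RegFeasible x ysp z} :=
        ((isCompact_univ_pi fun _ => hd.proj_compact).prod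
          (isCompact_singleton.prod isCompact_singleton)).of_isClosed_subset
          (isClosed_regFeasible x ysp) hsub
      obtain ⟨z, hz, hmin⟩ := hcomp.exists_isMinOn hx
        ((continuous_regCost (d := d)).comp
          (continuous_const.prodMk continuous_id : Continuous fun z => (x, z))).continuousOn
      exact ⟨d.firstInput z, fun _ => ⟨z, hz, fun z' hz' => hmin hz', rfl⟩⟩
    · exact ⟨0, fun h => absurd h hx⟩
  choose κ hκ using key
  exact ⟨κ, fun x hx => hκ x hx⟩

end MPCData

namespace MPCData

variable {n m p : ℕ} {d : MPCData n m p} {ysp : Fin p → ℝ} {xsp : Fin n → ℝ} {usp : Fin m → ℝ}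
  {κr κinf κN : (Fin n → ℝ) → Fin m → ℝ} {VO : (Fin p → ℝ) → (Fin p → ℝ) → ℝ} {γ : ℝ}

/-! ### The optimal law and the regulation problem -/

theorem Assumptions.mem_optDomain (hd : d.Assumptions) (hsp : d.IsSetpoint ysp xsp usp)
    {x : Fin n → ℝ} (hx : x ∈ d.regRegion ysp) : x ∈ d.optDomain xsp usp := by
  obtain ⟨κr, hr⟩ := hd.exists_regLaw hsp
  refine ⟨κr, hd.regLaw_admissible hsp hr hx, ?_⟩
  obtain ⟨z, hz⟩ := hx
  exact (hd.regLaw_costToGo_le hsp hr hz).trans_lt ENNReal.ofReal_lt_top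

/-- The optimal law is compared only with state feedbacks, and the inputs of `z` continued by the
LQR need not come from one. The regulation law is a feedback whose cost is no larger than that of
`z`. -/
theorem Assumptions.optLaw_costToGo_le (hd : d.Assumptions) (hsp : d.IsSetpoint ysp xsp usp)
    (hinf : d.IsOptimalLaw xsp usp κinf) {x : Fin n → ℝ} {z : MPCDecision d.N n m}
    (hz : d.RegFeasible x ysp z) : d.costToGo xsp usp κinf x ≤ ENNReal.ofReal (d.regCost x z) := by
  obtain ⟨κr, hr⟩ := hd.exists_regLaw hsp
  exact ((hinf x (hd.mem_optDomain hsp ⟨z, hz⟩)).2 κr (hd.regLaw_admissible hsp hr ⟨z, hz⟩)).trans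
    (hd.regLaw_costToGo_le hsp hr hz)

theorem IsOptimalLaw.mem_succ (hinf : d.IsOptimalLaw xsp usp κinf) {x : Fin n → ℝ}
    (hx : x ∈ d.optDomain xsp usp) : d.A *ᵥ x + d.B *ᵥ κinf x ∈ d.optDomain xsp usp := by
  obtain ⟨κ, hκ, hc⟩ := id hx
  obtain ⟨h1, h2⟩ := hinf x hx
  refine ⟨κinf, fun k => ?_, ?_⟩
  · rw [closedLoop_succ']
    exact h1 _
  · refine lt_of_le_of_lt ?_ ((h2 κ hκ).trans_lt hc)
    rw [costToGo_succ xsp usp κinf x]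
    exact le_add_self

/-- The decision made of the inputs of the optimal law. -/
def lawDecision (d : MPCData n m p) (xsp : Fin n → ℝ) (usp : Fin m → ℝ)
    (κ : (Fin n → ℝ) → Fin m → ℝ) (x : Fin n → ℝ) : MPCDecision d.N n m :=
  d.seqDecision (fun k => κ (d.closedLoop κ x k)) xsp usp

theorem pred_lawDecision (κ : (Fin n → ℝ) → Fin m → ℝ) (x : Fin n → ℝ) {j : ℕ} (hj : j ≤ d.N) :
    d.pred x (d.lawDecision xsp usp κ x).1 j = d.closedLoop κ x j := by
  rw [lawDecision, pred_seqDecision _ _ _ _ hj, closedLoop_eq_traj]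

theorem IsOptimalLaw.regFeasible (hsp : d.IsSetpoint ysp xsp usp)
    (hinf : d.IsOptimalLaw xsp usp κinf) {x : Fin n → ℝ} (hx : x ∈ d.Upsilon xsp usp κinf) :
    d.RegFeasible x ysp (d.lawDecision xsp usp κinf x) := by
  refine ⟨(trackFeasible_seqDecision _ _ _ _).2 ?_, hsp.2.symm⟩
  simp only [closedLoop_eq_traj]
  exact ⟨fun j _ => (hinf x hx.1).1 j, hx.2⟩

/-- The truncated cost of `κ_∞` is at most its full cost, by the LQR lower bound on the tail, and
the full cost is at most that of any feasible `y`. Taking its own truncation for `y` gives equality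
in the LQR bound at time `N`, which identifies the input there. -/
theorem Assumptions.lawDecision_optimal (hd : d.Assumptions) (hsp : d.IsSetpoint ysp xsp usp)
    (hinf : d.IsOptimalLaw xsp usp κinf) {x : Fin n → ℝ} (hx : x ∈ d.Upsilon xsp usp κinf) :
    (∀ y, d.RegFeasible x ysp y → d.regCost x (d.lawDecision xsp usp κinf x) ≤ d.regCost x y) ∧
      κinf (d.closedLoop κinf x d.N) = d.lqrLaw xsp usp (d.closedLoop κinf x d.N) := by
  have hP0 := quadForm_nonneg hd.P_posDef.posSemidef (d.closedLoop κinf x d.N - xsp)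
  have hS0 : 0 ≤ ∑ j ∈ Finset.range d.N,
      d.stage xsp usp (d.closedLoop κinf x j) (κinf (d.closedLoop κinf x j)) :=
    Finset.sum_nonneg fun _ _ => hd.stage_nonneg _ _ _ _
  have hcost := hd.costToGo_add xsp usp κinf x d.N
  have hlow := hd.quadForm_le_costToGo hsp.1.1 κinf (d.closedLoop κinf x d.N)
  have hreg : d.regCost x (d.lawDecision xsp usp κinf x) = ∑ j ∈ Finset.range d.N,
      d.stage xsp usp (d.closedLoop κinf x j) (κinf (d.closedLoop κinf x j))
        + quadForm d.P (d.closedLoop κinf x d.N - xsp) := by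
    rw [lawDecision, regCost_seqDecision]
    simp only [closedLoop_eq_traj]
  have hle := fun y (hy : d.RegFeasible x ysp y) => hd.optLaw_costToGo_le hsp hinf hy
  rw [hcost] at hle
  constructor
  · intro y hy
    rw [← ENNReal.ofReal_le_ofReal_iff (hd.regCost_nonneg x y), hreg, ENNReal.ofReal_add hS0 hP0]
    exact le_trans (by gcongr) (hle y hy)
  · refine hd.eq_lqrLaw_of_costToGo_le hsp.1.1 ?_
    have h1 := hle _ (hinf.regFeasible hsp hx)
    rwa [hreg, ENNReal.ofReal_add hS0 hP0, ENNReal.add_le_add_iff_left ENNReal.ofReal_ne_top] at h1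

/-- At time `N` the optimal law acts as the LQR, under which the terminal set is invariant. -/
theorem Assumptions.upsilon_succ (hd : d.Assumptions) (hsp : d.IsSetpoint ysp xsp usp)
    (hinf : d.IsOptimalLaw xsp usp κinf) {x : Fin n → ℝ} (hx : x ∈ d.Upsilon xsp usp κinf) :
    d.A *ᵥ x + d.B *ᵥ κinf x ∈ d.Upsilon xsp usp κinf := by
  refine ⟨hinf.mem_succ hx.1, ?_⟩
  rw [closedLoop_succ', closedLoop, (hd.lawDecision_optimal hsp hinf hx).2]
  exact hd.omega_inv _ _ _ hx.2

theorem Assumptions.upsilon_iterate (hd : d.Assumptions) (hsp : d.IsSetpoint ysp xsp usp)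
    (hinf : d.IsOptimalLaw xsp usp κinf) {x : Fin n → ℝ} (hx : x ∈ d.Upsilon xsp usp κinf)
    (k : ℕ) : d.closedLoop κinf x k ∈ d.Upsilon xsp usp κinf := by
  induction k with
  | zero => exact hx
  | succ k ih => exact hd.upsilon_succ hsp hinf ih

/-! ### Exactness of the offset cost -/

theorem Gam_mono {γ γ' : ℝ} (h : γ ≤ γ') : d.Gam γ ⊆ d.Gam γ' :=
  fun _ ⟨ν, h1, h2⟩ => ⟨ν, h1, h2.trans h⟩

theorem IsOffsetCost.nonneg (hVO : d.IsOffsetCost VO ysp γ) (y : Fin p → ℝ) : 0 ≤ VO y ysp := by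
  by_cases h : y = ysp
  · rw [h, hVO.zero]
  · exact (hVO.pos y h).le

/-- If the multipliers are bounded by (numbers arbitrarily close to) `γ`, the minimizers of the
tracking problem and of the regulation problem coincide. -/
theorem Assumptions.track_eq_reg (hd : d.Assumptions) (hVO : d.IsOffsetCost VO ysp γ)
    {x : Fin n → ℝ} (hx : ∀ ε > 0, (x, ysp) ∈ d.Gam (γ + ε)) {z z' : MPCDecision d.N n m}
    (hz : d.RegFeasible x ysp z) (hmin : ∀ y, d.RegFeasible x ysp y → d.regCost x z ≤ d.regCost x y)
    (hz' : d.TrackFeasible x z')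
    (hmin' : ∀ y, d.TrackFeasible x y → d.trackCost VO ysp x z' ≤ d.trackCost VO ysp x y) :
    z' = z := by
  have h1 : d.regCost x z + d.regCost 0 (z' - z) ≤
      d.regCost x z' + γ * ‖d.output z' - ysp‖ := by
    -- The KKT point attached to each `ε` is the regulation minimizer `z`, by uniqueness; only its
    -- multiplier depends on `ε`, and the bound passes to the limit.
    have h2 : ∀ ε > 0, d.regCost x z + d.regCost 0 (z' - z) - d.regCost x z'
        ≤ (γ + ε) * ‖d.output z' - ysp‖ := by
      intro ε hε
      obtain ⟨ν, ⟨y, lz, lo, hk⟩, hν⟩ := hx ε hε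
      have hyz : z = y := hd.reg_unique hk.feasible hz (fun w hw => hk.isMin hd hw)
        (hmin y hk.feasible)
      subst hyz
      have h3 := hk.le_regCost hd hz'
      have h4 := dotProduct_le_sum_abs_mul_norm ν (d.output z' - ysp)
      have h5 := mul_le_mul_of_nonneg_right hν (norm_nonneg (d.output z' - ysp))
      simp only at h3 h4 h5
      linarith
    have hc : Filter.Tendsto (fun ε : ℝ => (γ + ε) * ‖d.output z' - ysp‖) (𝓝[>] 0)
        (𝓝 (γ * ‖d.output z' - ysp‖)) := by
      have : Continuous fun ε : ℝ => (γ + ε) * ‖d.output z' - ysp‖ := by fun_prop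
      simpa using (this.tendsto 0).mono_left nhdsWithin_le_nhds
    have := ge_of_tendsto hc (by filter_upwards [self_mem_nhdsWithin] with ε hε using h2 ε hε)
    linarith
  have h2 := hVO.lower _ (hd.output_mem hz')
  have h3 := hmin' z hz.1
  simp only [trackCost, hz.2, hVO.zero, add_zero] at h3
  have h4 := hd.regCost_nonneg 0 (z' - z)
  -- The exactness estimate, the growth of the offset cost and minimality of `z'` form a closed
  -- chain of inequalities, so the quadratic excess vanishes.
  have h5 : d.regCost 0 (z' - z) = 0 := by linarith
  have heq := hd.equilibrium_sub hz' hz.1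
  obtain ⟨h6, h7⟩ := hd.regCost_zero_eq_zero heq h5
  -- The excess does not yet exclude a change of `u_a` in the kernel of `B`, made equally in all
  -- inputs. Such a change leaves the cost alone, so it would have to be paid for by the offset
  -- cost, which is positive away from `ysp`. This covers equality of `γ` and the multiplier norm.
  have hcost : d.regCost x z' = d.regCost x z := by
    have hpred : ∀ j ≤ d.N, d.pred 0 (z' - z).1 j = 0 := by
      intro j
      induction j with
      | zero => exact fun _ => rfl
      | succ j ih =>
        intro hj
        rw [pred, ih (by omega), dif_pos (by omega), h7]
        rw [h6] at heq
        simpa using heq.symm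
    have h8 : d.regBilin x z 0 (z' - z) = 0 := by
      rw [regBilin, hpred d.N le_rfl, h6]
      simp only [sub_zero, mulVec_zero, dotProduct_zero, add_zero]
      refine Finset.sum_eq_zero fun j _ => ?_
      rw [hpred j j.2.le, h7]
      simp
    have h9 := hd.regCost_add x z (z' - z)
    rw [add_sub_cancel, h8, h5] at h9
    linarith
  have hout : d.output z' = ysp := by
    by_contra hne
    have := hVO.pos _ hne
    linarith
  refine sub_eq_zero.1 (hd.eq_zero_of_regCost heq h5 ?_)
  rw [output_sub, hout, hz.2, sub_self]

theorem Assumptions.trackLaw_eq_regLaw (hd : d.Assumptions) (hVO : d.IsOffsetCost VO ysp γ)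
    (hN : d.IsTrackLaw VO ysp κN) (hr : d.IsRegLaw ysp κr) {x : Fin n → ℝ}
    (hx : ∀ ε > 0, (x, ysp) ∈ d.Gam (γ + ε)) : κN x = κr x := by
  obtain ⟨ν, ⟨y, lz, lo, hk⟩, hν⟩ := hx 1 one_pos
  obtain ⟨z, hz, hmin, h1⟩ := hr x ⟨y, hk.feasible⟩
  obtain ⟨z', hz', hmin', h2⟩ := hN x ⟨y, hk.feasible.1⟩
  rw [h1, h2, hd.track_eq_reg hVO hx hz hmin hz' hmin']

theorem Assumptions.trackLaw_eq_optLaw (hd : d.Assumptions) (hsp : d.IsSetpoint ysp xsp usp)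
    (hinf : d.IsOptimalLaw xsp usp κinf) (hVO : d.IsOffsetCost VO ysp γ)
    (hN : d.IsTrackLaw VO ysp κN) {x : Fin n → ℝ} (hx : x ∈ d.Upsilon xsp usp κinf)
    (hxγ : (x, ysp) ∈ d.Gam γ) : κN x = κinf x := by
  have hz := hinf.regFeasible hsp hx
  obtain ⟨z', hz', hmin', h2⟩ := hN x ⟨_, hz.1⟩
  rw [h2, hd.track_eq_reg hVO (fun ε hε => Gam_mono (by linarith) hxγ) hz
    (hd.lawDecision_optimal hsp hinf hx).1 hz' hmin']
  rfl

/-- On `𝒲` the tracking MPC follows the optimal law, so that `𝒲` does not depend on the offset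
cost. -/
theorem Assumptions.mem_W_iff (hd : d.Assumptions) (hsp : d.IsSetpoint ysp xsp usp)
    (hinf : d.IsOptimalLaw xsp usp κinf) (hVO : d.IsOffsetCost VO ysp γ)
    (hN : d.IsTrackLaw VO ysp κN) {x : Fin n → ℝ} : x ∈ d.W γ ysp xsp usp κinf κN ↔
      x ∈ d.Upsilon xsp usp κinf ∧ ∀ i, (d.closedLoop κinf x i, ysp) ∈ d.Gam γ := by
  -- The disjunction serves both directions: while the two trajectories agree, either alternative is
  -- the same condition.
  have key : x ∈ d.Upsilon xsp usp κinf → (∀ i, (d.closedLoop κN x i, ysp) ∈ d.Gam γ ∨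
      (d.closedLoop κinf x i, ysp) ∈ d.Gam γ) → ∀ i, d.closedLoop κN x i = d.closedLoop κinf x i := by
    intro hx h i
    induction i with
    | zero => rfl
    | succ i ih =>
      have h1 : (d.closedLoop κinf x i, ysp) ∈ d.Gam γ := by
        have := h i
        rwa [ih, or_self] at this
      rw [closedLoop, ih, hd.trackLaw_eq_optLaw hsp hinf hVO hN
        (hd.upsilon_iterate hsp hinf hx i) h1, closedLoop]
  constructor
  · rintro ⟨h1, h2⟩
    exact ⟨h1, fun i => key h1 (fun i => .inl (h2 i)) i ▸ h2 i⟩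
  · rintro ⟨h1, h2⟩
    exact ⟨h1, fun i => (key h1 (fun i => .inr (h2 i)) i).symm ▸ h2 i⟩

theorem Assumptions.W_succ (hd : d.Assumptions) (hsp : d.IsSetpoint ysp xsp usp)
    (hinf : d.IsOptimalLaw xsp usp κinf) (hVO : d.IsOffsetCost VO ysp γ)
    (hN : d.IsTrackLaw VO ysp κN) {x : Fin n → ℝ} (hx : x ∈ d.W γ ysp xsp usp κinf κN) :
    κN x = κinf x ∧ d.A *ᵥ x + d.B *ᵥ κN x ∈ d.W γ ysp xsp usp κinf κN := by
  have h1 := hd.trackLaw_eq_optLaw hsp hinf hVO hN hx.1 (hx.2 0)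
  refine ⟨h1, ?_, fun i => ?_⟩
  · rw [h1]
    exact hd.upsilon_succ hsp hinf hx.1
  · rw [closedLoop_succ']
    exact hx.2 _

/-- Turns `γ > γ_min` into `γ > 0`, the form in which it is applied. -/
theorem gamMin_nonneg : 0 ≤ d.gamMin :=
  le_iInf₂ fun _ _ => le_iInf₂ fun _ _ => EReal.coe_nonneg.2
    (Finset.sum_nonneg fun _ _ => abs_nonneg _)

/-- `multNorm` is an infimum whose attainment is not established; hence the slack `ε`, removed later
by a limit. -/
theorem mem_Gam_of_gamMax (h : d.gamMax ≤ (γ : EReal)) {x : Fin n → ℝ}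
    (hx : x ∈ d.regRegion ysp) {ε : ℝ} (hε : 0 < ε) : (x, ysp) ∈ d.Gam (γ + ε) := by
  have h1 : d.multNorm (x, ysp) < ((γ + ε : ℝ) : EReal) :=
    ((le_iSup₂ (f := fun q (_ : q ∈ d.GamAll) => d.multNorm q) (x, ysp) hx).trans h).trans_lt
      (EReal.coe_lt_coe_iff.2 (by linarith))
  simp only [multNorm, iInf_lt_iff] at h1
  obtain ⟨ν, hν, h2⟩ := h1
  exact ⟨ν, hν, (EReal.coe_lt_coe_iff.1 h2).le⟩

/-! ### Neighbourhoods of the equilibrium -/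

/-- Along the filter pulled back from `𝓝 0` by the quadratic form, the form tends to zero, so `x`
tends to `xsp`; thus the sublevel sets refine all neighbourhoods. -/
theorem Assumptions.exists_sublevel (hd : d.Assumptions) {U : Set (Fin n → ℝ)} (hU : U ∈ 𝓝 xsp) :
    ∃ ε > 0, ∀ x, quadForm d.P (x - xsp) ≤ ε → x ∈ U := by
  have h1 : Filter.Tendsto (fun x : Fin n → ℝ => x - xsp)
      (Filter.comap (fun x => quadForm d.P (x - xsp)) (𝓝 0)) (𝓝 0) :=
    tendsto_of_quadForm_posDef hd.P_posDef Filter.tendsto_comap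
  have h2 : Filter.Tendsto (fun x : Fin n → ℝ => x)
      (Filter.comap (fun x => quadForm d.P (x - xsp)) (𝓝 0)) (𝓝 xsp) := by
    simpa using h1.add_const xsp
  obtain ⟨t, ht, hsub⟩ := Filter.mem_comap.1 (h2 hU)
  obtain ⟨ε, hε, hb⟩ := Metric.mem_nhds_iff.1 ht
  refine ⟨ε / 2, half_pos hε, fun x hx => hsub (hb ?_)⟩
  have h3 := quadForm_nonneg hd.P_posDef.posSemidef (x - xsp)
  rw [Metric.mem_ball, Real.dist_eq, sub_zero, abs_of_nonneg h3]
  linarith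

theorem sublevel_mem_nhds {ε : ℝ} (hε : 0 < ε) :
    {x | quadForm d.P (x - xsp) ≤ ε} ∈ 𝓝 xsp := by
  have h1 : Continuous fun x => quadForm d.P (x - xsp) :=
    (continuous_quadForm d.P).comp (continuous_id.sub continuous_const)
  have h2 := h1.tendsto xsp
  rw [sub_self, quadForm_zero] at h2
  exact (h2.eventually (gt_mem_nhds hε)).mono fun x hx => le_of_lt hx

theorem Assumptions.optLaw_costToGo_le_quadForm (hd : d.Assumptions)
    (hsp : d.IsSetpoint ysp xsp usp) (hinf : d.IsOptimalLaw xsp usp κinf) {x : Fin n → ℝ}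
    (hx : (x, xsp, usp) ∈ d.Omega) : x ∈ d.optDomain xsp usp ∧
      d.costToGo xsp usp κinf x ≤ ENNReal.ofReal (quadForm d.P (x - xsp)) := by
  have h1 := hd.costToGo_lqrLaw_le hsp.1.1 x
  have h2 : d.AdmissibleFrom (d.lqrLaw xsp usp) x := fun k =>
    hd.omega_adm _ _ _ (hd.closedLoop_lqrLaw_mem hx k)
  have h3 : x ∈ d.optDomain xsp usp := ⟨_, h2, h1.trans_lt ENNReal.ofReal_lt_top⟩
  exact ⟨h3, ((hinf x h3).2 _ h2).trans h1⟩

/-- In the terminal region the optimal law does not increase the LQR cost. -/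
theorem Assumptions.quadForm_closedLoop_le (hd : d.Assumptions)
    (hsp : d.IsSetpoint ysp xsp usp) (hinf : d.IsOptimalLaw xsp usp κinf) {x : Fin n → ℝ}
    (hx : (x, xsp, usp) ∈ d.Omega) (k : ℕ) :
    quadForm d.P (d.closedLoop κinf x k - xsp) ≤ quadForm d.P (x - xsp) := by
  rw [← ENNReal.ofReal_le_ofReal_iff (quadForm_nonneg hd.P_posDef.posSemidef _)]
  refine (hd.quadForm_le_costToGo hsp.1.1 κinf _).trans
    (le_trans ?_ (hd.optLaw_costToGo_le_quadForm hsp hinf hx).2)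
  rw [hd.costToGo_add xsp usp κinf x k]
  exact le_add_self

/-- A small sublevel set of the `P`-form lies in the terminal region, and `κ_∞` started there is
still in the sublevel set at time `N`. -/
theorem Assumptions.upsilon_mem_nhds (hd : d.Assumptions)
    (hsp : d.IsSetpoint ysp xsp usp) (hinf : d.IsOptimalLaw xsp usp κinf) :
    d.Upsilon xsp usp κinf ∈ 𝓝 xsp := by
  obtain ⟨ε, hε, h⟩ := hd.exists_sublevel (hd.omega_nhds _ _ hsp.1)
  refine Filter.mem_of_superset (sublevel_mem_nhds (d := d) hε) fun x hx => ?_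
  exact ⟨(hd.optLaw_costToGo_le_quadForm hsp hinf (h x hx)).1,
    h _ ((hd.quadForm_closedLoop_le hsp hinf (h x hx) _).trans hx)⟩

end MPCData

/-! ### Small multipliers near the equilibrium -/

/-- A conic relation between vectors that relates every `v` to some `ν` does so with `ν` bounded
linearly in `v`. -/
theorem exists_bounded_selection {n p : ℕ} {r : (Fin n → ℝ) → (Fin p → ℝ) → Prop}
    (hex : ∀ v, ∃ ν, r v ν) (hadd : ∀ v w ν μ, r v ν → r w μ → r (v + w) (ν + μ))
    (hsmul : ∀ (t : ℝ) v ν, 0 ≤ t → r v ν → r (t • v) (t • ν)) :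
    ∃ c, 0 ≤ c ∧ ∀ v, ∃ ν, r v ν ∧ ∑ i, |ν i| ≤ c * ‖v‖ := by
  choose f hf using hex
  -- The signed unit vectors generate all `v` with the nonnegative coefficients `|v j|`, so finitely
  -- many choices of `ν` determine the constant.
  let s : (Fin n → ℝ) → Fin n → (Fin n → ℝ) := fun v j =>
    if 0 ≤ v j then Pi.single j 1 else -Pi.single j 1
  let b : Fin n → ℝ := fun j => (∑ i, |f (Pi.single j 1) i|) + ∑ i, |f (-Pi.single j 1) i|
  have hr0 : r 0 0 := by simpa using hsmul 0 0 _ le_rfl (hf 0)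
  refine ⟨∑ j, b j, Finset.sum_nonneg fun j _ => add_nonneg (Finset.sum_nonneg fun _ _ =>
    abs_nonneg _) (Finset.sum_nonneg fun _ _ => abs_nonneg _), fun v => ?_⟩
  refine ⟨∑ j, |v j| • f (s v j), ?_, ?_⟩
  · have h1 : ∀ S : Finset (Fin n), r (∑ j ∈ S, |v j| • s v j) (∑ j ∈ S, |v j| • f (s v j)) := by
      intro S
      induction S using Finset.induction_on with
      | empty => simpa using hr0
      | insert a S ha ih =>
        rw [Finset.sum_insert ha, Finset.sum_insert ha]
        exact hadd _ _ _ _ (hsmul _ _ _ (abs_nonneg _) (hf _)) ih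
    have h2 : ∑ j, |v j| • s v j = v := by
      conv_rhs => rw [← Finset.univ_sum_single v]
      refine Finset.sum_congr rfl fun j _ => ?_
      by_cases h : 0 ≤ v j
      · simp [s, h, abs_of_nonneg h, ← Pi.single_smul]
      · simp [s, h, abs_of_neg (not_le.1 h), ← Pi.single_smul]
    simpa only [h2] using h1 Finset.univ
  · have hsb : ∀ j, ∑ i, |f (s v j) i| ≤ b j := by
      intro j
      by_cases h : 0 ≤ v j
      · simp only [s, h, if_true, b]
        exact le_add_of_nonneg_right (Finset.sum_nonneg fun _ _ => abs_nonneg _)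
      · simp only [s, h, if_false, b]
        exact le_add_of_nonneg_left (Finset.sum_nonneg fun _ _ => abs_nonneg _)
    calc ∑ i, |(∑ j, |v j| • f (s v j)) i|
        ≤ ∑ i, ∑ j, |v j| * |f (s v j) i| := by
          refine Finset.sum_le_sum fun i _ => ?_
          rw [Finset.sum_apply]
          refine (Finset.abs_sum_le_sum_abs _ _).trans (le_of_eq ?_)
          refine Finset.sum_congr rfl fun j _ => ?_
          rw [Pi.smul_apply, smul_eq_mul, abs_mul, abs_abs]
      _ = ∑ j, |v j| * ∑ i, |f (s v j) i| := by
          rw [Finset.sum_comm]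
          simp only [Finset.mul_sum]
      _ ≤ ∑ j, ‖v‖ * b j := by
          refine Finset.sum_le_sum fun j _ => ?_
          exact mul_le_mul (norm_le_pi_norm v j) (hsb j)
            (Finset.sum_nonneg fun _ _ => abs_nonneg _) (norm_nonneg _)
      _ = (∑ j, b j) * ‖v‖ := by rw [← Finset.mul_sum, mul_comm]

namespace MPCData

variable {n m p : ℕ} {d : MPCData n m p} {ysp : Fin p → ℝ} {xsp : Fin n → ℝ} {usp : Fin m → ℝ}
  {γ : ℝ}

/-- Deviation from the target after `j` steps of the LQR law, starting from the deviation `v`. -/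
def lqrErr (d : MPCData n m p) (v : Fin n → ℝ) (j : ℕ) : Fin n → ℝ :=
  ((d.A + d.B * d.K) ^ j) *ᵥ v

theorem lqrErr_succ (v : Fin n → ℝ) (j : ℕ) :
    d.lqrErr v (j + 1) = d.A *ᵥ d.lqrErr v j + d.B *ᵥ (d.K *ᵥ d.lqrErr v j) := by
  rw [lqrErr, pow_succ', ← mulVec_mulVec, add_mulVec, ← mulVec_mulVec, lqrErr]

theorem closedLoop_lqrLaw (heq : xsp = d.A *ᵥ xsp + d.B *ᵥ usp) (x : Fin n → ℝ) (j : ℕ) :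
    d.closedLoop (d.lqrLaw xsp usp) x j - xsp = d.lqrErr (x - xsp) j := by
  induction j with
  | zero => simp [lqrErr, closedLoop]
  | succ j ih =>
    rw [lqrErr_succ, ← ih, closedLoop, lqrLaw, mulVec_add, mulVec_sub d.A]
    rw [show d.A *ᵥ xsp = xsp - d.B *ᵥ usp from eq_sub_of_add_eq heq.symm]
    abel

/-- Half the derivative of the regulation cost at the LQR point of the state `xsp + v`, as a
functional of the artificial variables. -/
def lqrGrad (d : MPCData n m p) (v : Fin n → ℝ) (δ : (Fin n → ℝ) × (Fin m → ℝ)) : ℝ :=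
  -(v ⬝ᵥ (d.P *ᵥ δ.1)) - ∑ j ∈ Finset.range d.N,
    d.lqrErr v (j + 1) ⬝ᵥ (d.P *ᵥ (δ.1 - d.A *ᵥ δ.1 - d.B *ᵥ δ.2))

/-- At LQR inputs the square term of the polarized Riccati identity vanishes, so the sum telescopes
and the input directions drop out. The vector `r` measures the failure of `δ` to be an equilibrium
direction; stationarity must be tested on such directions too. -/
theorem Assumptions.regBilin_lqr (hd : d.Assumptions)
    (heq : xsp = d.A *ᵥ xsp + d.B *ᵥ usp) (x : Fin n → ℝ) (δ : MPCDecision d.N n m) :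
    d.regBilin x (d.lawDecision xsp usp (d.lqrLaw xsp usp) x) 0 δ = d.lqrGrad (x - xsp) δ.2 := by
  set r := δ.2.1 - d.A *ᵥ δ.2.1 - d.B *ᵥ δ.2.2 with hr
  have hterm : ∀ j (hj : j < d.N), d.lqrErr (x - xsp) j ⬝ᵥ (d.Q *ᵥ (d.pred 0 δ.1 j - δ.2.1))
      + (d.K *ᵥ d.lqrErr (x - xsp) j) ⬝ᵥ (d.R *ᵥ (δ.1 ⟨j, hj⟩ - δ.2.2))
      + d.lqrErr (x - xsp) (j + 1) ⬝ᵥ (d.P *ᵥ (d.pred 0 δ.1 (j + 1) - δ.2.1))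
      + d.lqrErr (x - xsp) (j + 1) ⬝ᵥ (d.P *ᵥ r)
      = d.lqrErr (x - xsp) j ⬝ᵥ (d.P *ᵥ (d.pred 0 δ.1 j - δ.2.1)) := by
    intro j hj
    have h1 := hd.riccati_bilin (d.lqrErr (x - xsp) j) (d.pred 0 δ.1 j - δ.2.1)
      (d.K *ᵥ d.lqrErr (x - xsp) j) (δ.1 ⟨j, hj⟩ - δ.2.2)
    rw [sub_self, zero_dotProduct, add_zero, ← lqrErr_succ] at h1
    rw [← h1, add_assoc _ _ (_ ⬝ᵥ (d.P *ᵥ r)), ← dotProduct_add, ← mulVec_add]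
    congr 3
    rw [pred, dif_pos hj, hr, mulVec_sub, mulVec_sub]
    abel
  have hsum : ∀ k (hk : k ≤ d.N), (∑ j : Fin k, (d.lqrErr (x - xsp) j
        ⬝ᵥ (d.Q *ᵥ (d.pred 0 δ.1 j - δ.2.1)) + (d.K *ᵥ d.lqrErr (x - xsp) j)
        ⬝ᵥ (d.R *ᵥ (δ.1 ⟨j, j.2.trans_le hk⟩ - δ.2.2))))
      + d.lqrErr (x - xsp) k ⬝ᵥ (d.P *ᵥ (d.pred 0 δ.1 k - δ.2.1))
      + ∑ j ∈ Finset.range k, d.lqrErr (x - xsp) (j + 1) ⬝ᵥ (d.P *ᵥ r)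
      = -((x - xsp) ⬝ᵥ (d.P *ᵥ δ.2.1)) := by
    intro k
    induction k with
    | zero => intro _; simp [pred, lqrErr, mulVec_neg]
    | succ k ih =>
      intro hk
      have h1 := hterm k (by omega)
      have h2 := ih (by omega)
      rw [Fin.sum_univ_castSucc, Finset.sum_range_succ]
      simp only [Fin.val_castSucc, Fin.val_last]
      linarith
  have h1 := hsum d.N le_rfl
  have hK : ∀ j, d.lqrLaw xsp usp (d.closedLoop (d.lqrLaw xsp usp) x j) - usp
      = d.K *ᵥ d.lqrErr (x - xsp) j := by
    intro j
    rw [lqrLaw, closedLoop_lqrLaw heq, add_sub_cancel_right]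
  have h2 : d.regBilin x (d.lawDecision xsp usp (d.lqrLaw xsp usp) x) 0 δ =
      (∑ j : Fin d.N, (d.lqrErr (x - xsp) j
        ⬝ᵥ (d.Q *ᵥ (d.pred 0 δ.1 j - δ.2.1)) + (d.K *ᵥ d.lqrErr (x - xsp) j)
        ⬝ᵥ (d.R *ᵥ (δ.1 j - δ.2.2))))
      + d.lqrErr (x - xsp) d.N ⬝ᵥ (d.P *ᵥ (d.pred 0 δ.1 d.N - δ.2.1)) := by
    rw [regBilin, pred_lawDecision _ _ le_rfl]
    congr 1
    · refine Finset.sum_congr rfl fun j _ => ?_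
      rw [pred_lawDecision _ _ j.2.le, ← hK j, ← closedLoop_lqrLaw heq]
      rfl
    · rw [← closedLoop_lqrLaw heq]
      rfl
  rw [h2, lqrGrad]
  linarith

/-- Terminal residual of the equilibrium. -/
def eqResidual (d : MPCData n m p) (xsp : Fin n → ℝ) (usp : Fin m → ℝ) : Fin d.rO → ℝ :=
  d.Hx *ᵥ xsp + d.Ha *ᵥ xsp + d.Hu *ᵥ usp - d.h

theorem Assumptions.eqResidual_nonpos (hd : d.Assumptions) (hsp : (xsp, usp) ∈ d.Zsp)
    (i : Fin d.rO) : d.eqResidual xsp usp i ≤ 0 := by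
  have h1 : xsp ∈ {x | (x, xsp, usp) ∈ d.Omega} := mem_of_mem_nhds (hd.omega_nhds _ _ hsp)
  have h2 := h1 i
  simp only [eqResidual, Pi.sub_apply]
  linarith

/-- Terminal constraints that involve the state are inactive at the equilibria. -/
theorem Assumptions.eqResidual_neg (hd : d.Assumptions) (hsp : (xsp, usp) ∈ d.Zsp)
    {i : Fin d.rO} (hi : d.Hx i ≠ 0) : d.eqResidual xsp usp i < 0 := by
  have hc : Continuous fun s : ℝ => xsp + s • d.Hx i := by fun_prop
  have h1 : ∀ᶠ s : ℝ in 𝓝[>] 0, (xsp + s • d.Hx i, xsp, usp) ∈ d.Omega := by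
    have h2 := hc.tendsto 0
    rw [zero_smul, add_zero] at h2
    exact (h2.mono_left nhdsWithin_le_nhds) (hd.omega_nhds _ _ hsp)
  obtain ⟨s, hs, hs0⟩ := (h1.and self_mem_nhdsWithin).exists
  have h2 := hs i
  have h3 : 0 < d.Hx i ⬝ᵥ d.Hx i := by
    refine lt_of_le_of_ne (Finset.sum_nonneg fun j _ => mul_self_nonneg _) fun h => hi ?_
    exact dotProduct_self_eq_zero.1 h.symm
  have h4 : 0 < s * (d.Hx i ⬝ᵥ d.Hx i) := mul_pos hs0 h3
  simp only [mulVec_add, mulVec_smul, Pi.add_apply, Pi.smul_apply, smul_eq_mul] at h2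
  have h5 : (d.Hx *ᵥ d.Hx i) i = d.Hx i ⬝ᵥ d.Hx i := rfl
  rw [h5] at h2
  simp only [eqResidual, Pi.sub_apply, Pi.add_apply]
  linarith

/-- `ν`, with suitable multipliers of the terminal constraints, balances the gradient at the LQR
point of the state `xsp + v`. -/
def IsLqrMultiplier (d : MPCData n m p) (xsp : Fin n → ℝ) (usp : Fin m → ℝ) (v : Fin n → ℝ)
    (ν : Fin p → ℝ) : Prop :=
  ∃ lo : Fin d.rO → ℝ, (∀ i, 0 ≤ lo i) ∧
    (∀ i, ¬(d.Hx i = 0 ∧ d.eqResidual xsp usp i = 0) → lo i = 0) ∧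
    ∀ δ : (Fin n → ℝ) × (Fin m → ℝ), 2 * d.lqrGrad v δ + lo ⬝ᵥ (d.Ha *ᵥ δ.1 + d.Hu *ᵥ δ.2)
      + ν ⬝ᵥ (d.C *ᵥ δ.1 + d.D *ᵥ δ.2) = 0

theorem lqrErr_add (v w : Fin n → ℝ) (j : ℕ) :
    d.lqrErr (v + w) j = d.lqrErr v j + d.lqrErr w j := mulVec_add _ _ _

theorem lqrErr_smul (t : ℝ) (v : Fin n → ℝ) (j : ℕ) :
    d.lqrErr (t • v) j = t • d.lqrErr v j := mulVec_smul _ _ _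

theorem lqrGrad_add_left (v w : Fin n → ℝ) (δ : (Fin n → ℝ) × (Fin m → ℝ)) :
    d.lqrGrad (v + w) δ = d.lqrGrad v δ + d.lqrGrad w δ := by
  simp only [lqrGrad, lqrErr_add, add_dotProduct, Finset.sum_add_distrib]
  ring

theorem lqrGrad_smul_left (t : ℝ) (v : Fin n → ℝ) (δ : (Fin n → ℝ) × (Fin m → ℝ)) :
    d.lqrGrad (t • v) δ = t * d.lqrGrad v δ := by
  simp only [lqrGrad, lqrErr_smul, smul_dotProduct, smul_eq_mul, ← Finset.mul_sum]
  ring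

theorem lqrGrad_add_right (v : Fin n → ℝ) (δ δ' : (Fin n → ℝ) × (Fin m → ℝ)) :
    d.lqrGrad v (δ + δ') = d.lqrGrad v δ + d.lqrGrad v δ' := by
  simp only [lqrGrad, Prod.fst_add, Prod.snd_add, mulVec_add, mulVec_sub, dotProduct_add,
    dotProduct_sub, Finset.sum_add_distrib, Finset.sum_sub_distrib]
  ring

theorem lqrGrad_smul_right (t : ℝ) (v : Fin n → ℝ) (δ : (Fin n → ℝ) × (Fin m → ℝ)) :
    d.lqrGrad v (t • δ) = t * d.lqrGrad v δ := by
  simp only [lqrGrad, Prod.smul_fst, Prod.smul_snd, mulVec_smul, mulVec_sub, dotProduct_smul,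
    dotProduct_sub, Finset.sum_sub_distrib, smul_eq_mul, ← Finset.mul_sum]
  ring

/-- Farkas applies to every gradient because its cone of directions is trivial. A direction allowed
by the active state-free rows keeps the terminal constraint after a small step with the state at
`xsp`, so it is an equilibrium direction; with zero output it must vanish. -/
theorem Assumptions.exists_isLqrMultiplier (hd : d.Assumptions) (hsp : (xsp, usp) ∈ d.Zsp)
    (v : Fin n → ℝ) : ∃ ν, d.IsLqrMultiplier xsp usp v ν := by
  let a : Fin d.rO → ((Fin n → ℝ) × (Fin m → ℝ)) →ₗ[ℝ] ℝ := fun i => IsLinearMap.mk'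
    (fun δ => (d.Ha *ᵥ δ.1 + d.Hu *ᵥ δ.2) i)
    ⟨fun δ δ' => by simp [mulVec_add]; ring, fun t δ => by simp [mulVec_smul]; ring⟩
  let e : Fin p → ((Fin n → ℝ) × (Fin m → ℝ)) →ₗ[ℝ] ℝ := fun i => IsLinearMap.mk'
    (fun δ => (d.C *ᵥ δ.1 + d.D *ᵥ δ.2) i)
    ⟨fun δ δ' => by simp [mulVec_add]; ring, fun t δ => by simp [mulVec_smul]; ring⟩
  let c : ((Fin n → ℝ) × (Fin m → ℝ)) →ₗ[ℝ] ℝ := IsLinearMap.mk'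
    (fun δ => 2 * d.lqrGrad v δ) ⟨fun δ δ' => by rw [lqrGrad_add_right, mul_add],
      fun t δ => by rw [lqrGrad_smul_right, smul_eq_mul]; ring⟩
  obtain ⟨l, ν, hl, hl0, hst⟩ := farkas {i | d.Hx i = 0 ∧ d.eqResidual xsp usp i = 0} a e c (by
    intro δ h1 h2
    have hev : ∀ᶠ t : ℝ in 𝓝[>] 0, ∀ i, d.eqResidual xsp usp i + t * a i δ ≤ 0 := by
      rw [Filter.eventually_all]
      intro i
      rcases (hd.eqResidual_nonpos hsp i).eq_or_lt with hi | hlt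
      · have hHx : d.Hx i = 0 := by
          by_contra hne
          exact (hd.eqResidual_neg hsp hne).ne hi
        filter_upwards [self_mem_nhdsWithin] with t ht
        rw [hi, zero_add]
        exact mul_nonpos_of_nonneg_of_nonpos (le_of_lt ht) (h1 i ⟨hHx, hi⟩)
      · have hc : Filter.Tendsto (fun t : ℝ => d.eqResidual xsp usp i + t * a i δ) (𝓝[>] 0)
            (𝓝 (d.eqResidual xsp usp i)) := by
          have : Continuous fun t : ℝ => d.eqResidual xsp usp i + t * a i δ := by fun_prop
          simpa using (this.tendsto 0).mono_left nhdsWithin_le_nhds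
        exact (hc.eventually (gt_mem_nhds hlt)).mono fun t ht => le_of_lt ht
    obtain ⟨t, ht, ht0⟩ := (hev.and self_mem_nhdsWithin).exists
    have hmem : (xsp, xsp + t • δ.1, usp + t • δ.2) ∈ d.Omega := by
      intro i
      have h3 := ht i
      have h4 : a i δ = (d.Ha *ᵥ δ.1) i + (d.Hu *ᵥ δ.2) i := rfl
      simp only [eqResidual, Pi.sub_apply, Pi.add_apply, h4, mulVec_add, mulVec_smul,
        Pi.smul_apply, smul_eq_mul] at h3 ⊢
      linarith
    have heq : xsp + t • δ.1 = d.A *ᵥ (xsp + t • δ.1) + d.B *ᵥ (usp + t • δ.2) :=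
      (hd.omega_eq _ _ _ hmem).1
    have heq0 : xsp = d.A *ᵥ xsp + d.B *ᵥ usp := hsp.1
    have h5 : t • δ.1 = d.A *ᵥ (t • δ.1) + d.B *ᵥ (t • δ.2) := by
      rw [mulVec_add, mulVec_add] at heq
      rw [show d.A *ᵥ xsp = xsp - d.B *ᵥ usp from eq_sub_of_add_eq heq0.symm] at heq
      calc t • δ.1 = xsp + t • δ.1 - xsp := by abel
        _ = _ := by rw [heq]; abel
    have h6 := hd.equilibrium_unique _ _ h5 (by
      rw [mulVec_smul, mulVec_smul, ← smul_add, show d.C *ᵥ δ.1 + d.D *ᵥ δ.2 = 0 from funext h2,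
        smul_zero])
    have ht0' : t ≠ 0 := ne_of_gt ht0
    have h7 : δ = 0 := Prod.ext ((smul_eq_zero.1 h6.1).resolve_left ht0')
      ((smul_eq_zero.1 h6.2).resolve_left ht0')
    rw [h7, map_zero])
  exact ⟨ν, l, hl, hl0, hst⟩

/-- The active rows refer to the equilibrium and not to the state, so sums and nonnegative multiples
of multipliers belong to those of `v`. -/
theorem Assumptions.exists_bounded_lqrMultiplier (hd : d.Assumptions) (hsp : (xsp, usp) ∈ d.Zsp) :
    ∃ c, 0 ≤ c ∧ ∀ v, ∃ ν, d.IsLqrMultiplier xsp usp v ν ∧ ∑ i, |ν i| ≤ c * ‖v‖ := by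
  refine exists_bounded_selection (hd.exists_isLqrMultiplier hsp) ?_ ?_
  · rintro v w ν μ ⟨l, h1, h2, h3⟩ ⟨k, g1, g2, g3⟩
    refine ⟨l + k, fun i => add_nonneg (h1 i) (g1 i), fun i hi => ?_, fun δ => ?_⟩
    · rw [Pi.add_apply, h2 i hi, g2 i hi, add_zero]
    · have := h3 δ
      have := g3 δ
      rw [lqrGrad_add_left, add_dotProduct, add_dotProduct]
      linarith
  · rintro t v ν ht ⟨l, h1, h2, h3⟩
    refine ⟨t • l, fun i => mul_nonneg ht (h1 i), fun i hi => ?_, fun δ => ?_⟩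
    · rw [Pi.smul_apply, h2 i hi, smul_zero]
    · have h4 := congrArg (fun s => t * s) (h3 δ)
      simp only [mul_zero] at h4
      rw [lqrGrad_smul_left, smul_dotProduct, smul_dotProduct, smul_eq_mul, smul_eq_mul]
      linarith

/-- In the terminal region, the LQR point satisfies the KKT conditions. -/
theorem Assumptions.isKKT_lqr (hd : d.Assumptions) (hsp : d.IsSetpoint ysp xsp usp)
    {x : Fin n → ℝ} (hx : (x, xsp, usp) ∈ d.Omega) {ν : Fin p → ℝ}
    (hν : d.IsLqrMultiplier xsp usp (x - xsp) ν) : ν ∈ d.multipliers x ysp := by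
  obtain ⟨lo, h1, h2, h3⟩ := hν
  set z := d.lawDecision xsp usp (d.lqrLaw xsp usp) x with hz
  -- Rows with a nonzero multiplier do not involve the state, so complementarity at the equilibrium
  -- carries over to every predicted terminal state.
  have hHx : ∀ (i) (y : Fin n → ℝ), lo i * (d.Hx *ᵥ y) i = 0 := by
    intro i y
    by_cases h : d.Hx i = 0
    · rw [mulVec, h, zero_dotProduct, mul_zero]
    · rw [h2 i fun h' => h h'.1, zero_mul]
  refine ⟨z, 0, lo, ⟨(trackFeasible_seqDecision _ _ _ _).2 ?_, hsp.2.symm⟩, fun _ _ => le_rfl, h1,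
    fun _ _ => by simp, fun i => ?_, (hd.stationary_iff _ _ _ _ _ _).2 fun δ => ?_⟩
  · simp only [closedLoop_eq_traj]
    exact ⟨fun j _ => hd.omega_adm _ _ _ (hd.closedLoop_lqrLaw_mem hx j),
      hd.closedLoop_lqrLaw_mem hx _⟩
  · by_cases h : d.Hx i = 0 ∧ d.eqResidual xsp usp i = 0
    · have h4 := h.2
      have h5 := hHx i xsp
      have h6 := hHx i (d.pred x z.1 d.N)
      have h7 : z.2 = (xsp, usp) := rfl
      simp only [eqResidual, Pi.sub_apply, Pi.add_apply, terminalResidual, h7] at h4 ⊢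
      have h8 := congrArg (fun s => lo i * s) h4
      simp only [mul_zero] at h8
      linarith
    · rw [h2 i h, zero_mul]
  · have h4 : lo ⬝ᵥ (d.Hx *ᵥ d.pred 0 δ.1 d.N) = 0 := Finset.sum_eq_zero fun i _ => hHx i _
    have h5 := h3 δ.2
    rw [dotProduct_add] at h5
    rw [lagDir, hz, hd.regBilin_lqr hsp.1.1, terminalDir, dotProduct_add, dotProduct_add, h4,
      output]
    simp only [Pi.zero_apply, zero_dotProduct, Finset.sum_const_zero]
    linarith

theorem Assumptions.gam_mem_nhds (hd : d.Assumptions) (hsp : d.IsSetpoint ysp xsp usp)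
    (hγ : 0 < γ) : {x | (x, ysp) ∈ d.Gam γ} ∈ 𝓝 xsp := by
  obtain ⟨c, hc, h⟩ := hd.exists_bounded_lqrMultiplier hsp.1
  have h1 : ∀ᶠ x in 𝓝 xsp, c * ‖x - xsp‖ < γ := by
    have : Continuous fun x : Fin n → ℝ => c * ‖x - xsp‖ := by fun_prop
    have h2 := this.tendsto xsp
    rw [sub_self, norm_zero, mul_zero] at h2
    exact h2.eventually (gt_mem_nhds hγ)
  filter_upwards [h1, hd.omega_nhds _ _ hsp.1] with x hx hΩ
  obtain ⟨ν, hν, hb⟩ := h (x - xsp)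
  exact ⟨ν, hd.isKKT_lqr hsp hΩ hν, hb.trans hx.le⟩

end MPCData

namespace MPCData

variable {n m p : ℕ} {d : MPCData n m p} {ysp : Fin p → ℝ} {xsp : Fin n → ℝ} {usp : Fin m → ℝ}
  {κN : (Fin n → ℝ) → Fin m → ℝ} {VO : (Fin p → ℝ) → (Fin p → ℝ) → ℝ} {γ : ℝ}

/-! ### Admissible equilibria -/

theorem isClosed_Z (d : MPCData n m p) : IsClosed d.Z :=
  isClosed_le (by fun_prop) continuous_const

theorem convex_Z (d : MPCData n m p) : Convex ℝ d.Z := by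
  intro q hq r hr a b ha hb hab i
  have h1 := mul_le_mul_of_nonneg_left (hq i) ha
  have h2 := mul_le_mul_of_nonneg_left (hr i) hb
  have h3 : a * d.w i + b * d.w i = d.w i := by rw [← add_mul, hab, one_mul]
  simp only [Pi.add_apply, Prod.fst_add, Prod.snd_add, Prod.smul_fst, Prod.smul_snd, mulVec_add,
    mulVec_smul, Pi.smul_apply, smul_eq_mul] at h1 h2 ⊢
  linarith

theorem isClosed_Zsp (d : MPCData n m p) : IsClosed d.Zsp :=
  (isClosed_eq continuous_fst (by fun_prop)).inter (d.isClosed_Z.smul₀ d.lam)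

theorem convex_Zsp (d : MPCData n m p) : Convex ℝ d.Zsp := by
  intro q hq r hr a b ha hb hab
  refine ⟨?_, d.convex_Z.smul d.lam hq.2 hr.2 ha hb hab⟩
  simp only [Prod.fst_add, Prod.snd_add, Prod.smul_fst, Prod.smul_snd, mulVec_add, mulVec_smul]
  conv_lhs => rw [hq.1, hr.1]
  simp only [smul_add]
  abel

/-- Quantitative form of `equilibrium_unique`: an injective linear map in finite dimension is
bounded below. -/
theorem Assumptions.exists_equilibrium_bound (hd : d.Assumptions) :
    ∃ c, 0 ≤ c ∧ ∀ (x : Fin n → ℝ) (u : Fin m → ℝ), x = d.A *ᵥ x + d.B *ᵥ u →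
      ‖(x, u)‖ ≤ c * ‖d.C *ᵥ x + d.D *ᵥ u‖ := by
  let T : ((Fin n → ℝ) × (Fin m → ℝ)) →ₗ[ℝ] (Fin n → ℝ) × (Fin p → ℝ) := IsLinearMap.mk'
    (fun q => (q.1 - d.A *ᵥ q.1 - d.B *ᵥ q.2, d.C *ᵥ q.1 + d.D *ᵥ q.2))
    ⟨fun q r => by
      ext1
      · simp only [Prod.fst_add, Prod.snd_add, mulVec_add]; abel
      · simp only [Prod.fst_add, Prod.snd_add, mulVec_add]; abel,
    fun t q => by simp [mulVec_smul, smul_sub, smul_add]⟩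
  have hT : LinearMap.ker T = ⊥ := by
    rw [LinearMap.ker_eq_bot']
    intro q hq
    have h1 : q.1 - d.A *ᵥ q.1 - d.B *ᵥ q.2 = 0 := congrArg Prod.fst hq
    have h2 : d.C *ᵥ q.1 + d.D *ᵥ q.2 = 0 := congrArg Prod.snd hq
    rw [sub_sub, sub_eq_zero] at h1
    have h3 := hd.equilibrium_unique _ _ h1 h2
    exact Prod.ext h3.1 h3.2
  obtain ⟨c, -, hc⟩ := T.exists_antilipschitzWith hT
  refine ⟨c, c.2, fun x u h => ?_⟩
  have h1 := hc.le_mul_dist (x, u) 0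
  have h2 : T (x, u) = (0, d.C *ᵥ x + d.D *ᵥ u) := by
    refine Prod.ext ?_ rfl
    change x - d.A *ᵥ x - d.B *ᵥ u = 0
    rw [sub_sub, sub_eq_zero]
    exact h
  rw [map_zero, dist_zero_right, dist_zero_right, h2,
    show ‖((0 : Fin n → ℝ), d.C *ᵥ x + d.D *ᵥ u)‖ = ‖d.C *ᵥ x + d.D *ᵥ u‖ by
      simp [Prod.norm_mk]] at h1
  exact h1

/-- On bounded sets of admissible equilibria the terminal regions contain balls of a common
radius. -/
theorem Assumptions.exists_uniform_radius (hd : d.Assumptions) (hsp : (xsp, usp) ∈ d.Zsp)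
    {r : ℝ} (hr : 0 ≤ r) :
    ∃ ρ > 0, ∀ xa ua, (xa, ua) ∈ d.Zsp → ‖(xa, ua) - (xsp, usp)‖ ≤ r →
      ∀ x : Fin n → ℝ, ‖x - xa‖ ≤ ρ → (x, xa, ua) ∈ d.Omega := by
  set S : Set ((Fin n → ℝ) × (Fin m → ℝ)) := d.Zsp ∩ Metric.closedBall (xsp, usp) r with hS
  have hcomp : IsCompact S := (isCompact_closedBall _ _).inter_left d.isClosed_Zsp
  have hne : S.Nonempty := ⟨_, hsp, Metric.mem_closedBall_self hr⟩
  have hev : ∀ᶠ ρ : ℝ in 𝓝[>] 0, ∀ i, ∀ q ∈ S, ∀ x : Fin n → ℝ, ‖x - q.1‖ ≤ ρ →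
      (d.Hx *ᵥ x + d.Ha *ᵥ q.1 + d.Hu *ᵥ q.2) i ≤ d.h i := by
    rw [Filter.eventually_all]
    intro i
    have hrow : ∀ (q : (Fin n → ℝ) × (Fin m → ℝ)) (x : Fin n → ℝ),
        (d.Hx *ᵥ x + d.Ha *ᵥ q.1 + d.Hu *ᵥ q.2) i
          = d.h i + d.eqResidual q.1 q.2 i + d.Hx i ⬝ᵥ (x - q.1) := by
      intro q x
      have h1 : ∀ y, (d.Hx *ᵥ y) i = d.Hx i ⬝ᵥ y := fun y => rfl
      simp only [eqResidual, Pi.add_apply, Pi.sub_apply, h1, dotProduct_sub]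
      ring
    -- Rows without the state hold at every admissible equilibrium. The others are strictly
    -- inactive, hence inactive with a uniform margin on the compact set.
    by_cases hi : d.Hx i = 0
    · refine Filter.Eventually.of_forall fun ρ q hq x _ => ?_
      rw [hrow, hi, zero_dotProduct]
      linarith [hd.eqResidual_nonpos hq.1 i]
    · have hc : Continuous fun q : (Fin n → ℝ) × (Fin m → ℝ) => d.eqResidual q.1 q.2 i := by
        unfold eqResidual
        fun_prop
      obtain ⟨q₀, hq₀, hmax⟩ := hcomp.exists_isMaxOn hne hc.continuousOn
      have hneg := hd.eqResidual_neg (i := i) hq₀.1 hi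
      have hlim : Filter.Tendsto (fun ρ : ℝ => (∑ j, |d.Hx i j|) * ρ) (𝓝[>] 0) (𝓝 0) := by
        have : Continuous fun ρ : ℝ => (∑ j, |d.Hx i j|) * ρ := by fun_prop
        simpa using (this.tendsto 0).mono_left nhdsWithin_le_nhds
      filter_upwards [hlim.eventually (gt_mem_nhds (neg_pos.2 hneg))] with ρ hρ q hq x hx
      have h1 := hmax hq
      have h2 := dotProduct_le_sum_abs_mul_norm (d.Hx i) (x - q.1)
      have h3 := mul_le_mul_of_nonneg_left hx (Finset.sum_nonneg fun j (_ : j ∈ Finset.univ) =>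
        abs_nonneg (d.Hx i j))
      rw [hrow]
      simp only [Set.mem_ofPred_eq] at h1
      linarith
  obtain ⟨ρ, hρ, hρ0⟩ := (hev.and self_mem_nhdsWithin).exists
  refine ⟨ρ, hρ0, fun xa ua h1 h2 x hx i => hρ i (xa, ua) ⟨h1, ?_⟩ x hx⟩
  rwa [Metric.mem_closedBall, dist_eq_norm]

/-! ### Convergence of the tracking MPC -/

theorem IsOffsetCost.line (hVO : d.IsOffsetCost VO ysp γ) (y y' : Fin p → ℝ) {t : ℝ} (h0 : 0 ≤ t)
    (h1 : t ≤ 1) : VO (y + t • (y' - y)) ysp ≤ (1 - t) * VO y ysp + t * VO y' ysp := by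
  have h := hVO.convex.2 (Set.mem_univ y) (Set.mem_univ y') (sub_nonneg.2 h1) h0 (by ring)
  rw [show y + t • (y' - y) = (1 - t) • y + t • y' by rw [smul_sub, sub_smul, one_smul]; abel]
  simpa only [smul_eq_mul] using h

theorem Assumptions.trackCost_growth (hd : d.Assumptions) (hVO : d.IsOffsetCost VO ysp γ)
    {x : Fin n → ℝ} {z z' : MPCDecision d.N n m} (hz : d.TrackFeasible x z)
    (hmin : ∀ y, d.TrackFeasible x y → d.trackCost VO ysp x z ≤ d.trackCost VO ysp x y)
    (hz' : d.TrackFeasible x z') :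
    d.trackCost VO ysp x z + d.regCost 0 (z' - z) ≤ d.trackCost VO ysp x z' :=
  hd.growth (F := d.TrackFeasible x) (g := fun z => VO (d.output z) ysp)
    (fun _ h0 h1 => hz.line hz' h0 h1) (fun t h0 h1 => by
      rw [output_add, output_smul, output_sub]
      exact hVO.line _ _ h0 h1) hmin

/-- An upper bound of the offset cost at a minimizer, obtained by moving the artificial
equilibrium towards the setpoint. -/
theorem Assumptions.offset_le (hd : d.Assumptions) (hsp : d.IsSetpoint ysp xsp usp)
    (hVO : d.IsOffsetCost VO ysp γ) {r ρ : ℝ}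
    (hρ : ∀ xa ua, (xa, ua) ∈ d.Zsp → ‖(xa, ua) - (xsp, usp)‖ ≤ r →
      ∀ x : Fin n → ℝ, ‖x - xa‖ ≤ ρ → (x, xa, ua) ∈ d.Omega)
    {x : Fin n → ℝ} {z : MPCDecision d.N n m} (hz : d.TrackFeasible x z)
    (hmin : ∀ y, d.TrackFeasible x y → d.trackCost VO ysp x z ≤ d.trackCost VO ysp x y)
    (hzr : ‖z.2 - (xsp, usp)‖ ≤ r) {s : ℝ} (hs0 : 0 ≤ s) (hs1 : s ≤ 1)
    (hs : ‖x - z.2.1‖ + s * r ≤ ρ) {c : ℝ} (hc0 : 0 ≤ c)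
    (hc : ∀ v, quadForm d.P v ≤ c * ‖v‖ ^ 2) :
    s * VO (d.output z) ysp ≤ c * (‖x - z.2.1‖ + s * r) ^ 2 := by
  set q := z.2 + s • ((xsp, usp) - z.2) with hq
  have hmem : q ∈ d.Zsp :=
    d.convex_Zsp.add_smul_sub_mem (hd.omega_eq _ _ _ hz.2) hsp.1 ⟨hs0, hs1⟩
  have hqr : ‖q - (xsp, usp)‖ ≤ r := by
    have : q - (xsp, usp) = (1 - s) • (z.2 - (xsp, usp)) := by
      rw [hq, smul_sub, sub_smul, one_smul, smul_sub]
      abel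
    rw [this, norm_smul, Real.norm_of_nonneg (by linarith)]
    nlinarith [norm_nonneg (z.2 - (xsp, usp))]
  have hxq : ‖x - q.1‖ ≤ ‖x - z.2.1‖ + s * r := by
    have h1 : x - q.1 = (x - z.2.1) + s • (z.2.1 - xsp) := by
      rw [hq]
      simp only [Prod.fst_add, Prod.smul_fst, Prod.fst_sub, smul_sub]
      abel
    have h2 : ‖z.2.1 - xsp‖ ≤ r := (norm_fst_le (z.2 - (xsp, usp))).trans hzr
    rw [h1]
    refine (norm_add_le _ _).trans ?_
    rw [norm_smul, Real.norm_of_nonneg hs0]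
    gcongr
  -- The competitor moves the artificial equilibrium by the fraction `s` and applies the LQR from
  -- `x`. It gains `s` times the offset cost and pays at most the quadratic terminal cost, of second
  -- order in `s` once `x` is close to `x_a`.
  obtain ⟨y, hy, e1, e2, hcost⟩ := hd.exists_lqr_decision (hρ q.1 q.2 hmem hqr x (hxq.trans hs))
  have hout : d.output y = d.output z + s • (ysp - d.output z) := by
    rw [output, e1, e2, hq, output, hsp.2]
    simp only [Prod.fst_add, Prod.smul_fst, Prod.fst_sub, Prod.snd_add, Prod.smul_snd,
      Prod.snd_sub, smul_sub, smul_add, mulVec_add, mulVec_sub, mulVec_smul]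
    abel
  have h1 := hmin y hy
  have h2 := hVO.line (d.output z) ysp hs0 hs1
  rw [hVO.zero] at h2
  simp only [trackCost, hcost, hout] at h1
  have h3 := hd.regCost_nonneg x z
  have h4 : quadForm d.P (x - q.1) ≤ c * (‖x - z.2.1‖ + s * r) ^ 2 :=
    (hc _).trans (by gcongr)
  linarith

/-- The optimal cost decreases by the stage cost plus the quadratic distance from the shifted to the
new minimizer, so both tend to zero. The artificial state then varies ever more slowly, and
observability drives the state to it. An artificial equilibrium that stayed away from the setpoint
would contradict `offset_le`. -/
theorem Assumptions.trackLaw_tendsto (hd : d.Assumptions) (hsp : d.IsSetpoint ysp xsp usp)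
    (hγ : 0 < γ) (hVO : d.IsOffsetCost VO ysp γ) (hN : d.IsTrackLaw VO ysp κN) {x₀ : Fin n → ℝ}
    (hx₀ : x₀ ∈ d.trackRegion) : Filter.Tendsto (d.closedLoop κN x₀) Filter.atTop (𝓝 xsp) := by
  set x := d.closedLoop κN x₀ with hx
  have hmem : ∀ k, x k ∈ d.trackRegion := by
    intro k
    induction k with
    | zero => exact hx₀
    | succ k ih =>
      obtain ⟨z, hz, -, h2⟩ := hN _ ih
      obtain ⟨z', hz', -⟩ := hd.exists_shift hz
      rw [← h2] at hz'
      exact ⟨z', hz'⟩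
  choose z hz hmin hκ using fun k => hN _ (hmem k)
  choose y hy hy2 hyc using fun k => hd.exists_shift (hz k)
  have hsucc : ∀ k, d.A *ᵥ x k + d.B *ᵥ d.firstInput (z k) = x (k + 1) := fun k => by
    rw [← hκ k]; rfl
  simp only [hsucc] at hy hyc
  set J := fun k => d.trackCost VO ysp (x k) (z k) with hJ
  have hJ0 : ∀ k, VO (d.output (z k)) ysp ≤ J k := fun k =>
    le_add_of_nonneg_left (hd.regCost_nonneg _ _)
  have hstep : ∀ k, d.stage (z k).2.1 (z k).2.2 (x k) (d.firstInput (z k))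
      + d.regCost 0 (y k - z (k + 1)) ≤ J k - J (k + 1) := by
    intro k
    have h1 := hd.trackCost_growth hVO (hz (k + 1)) (hmin (k + 1)) (hy k)
    have h2 : d.output (y k) = d.output (z k) := by rw [output, hy2, output]
    have h3 := hyc k
    simp only [hJ, trackCost, h2] at h1 ⊢
    linarith
  have hst0 : ∀ k, 0 ≤ d.stage (z k).2.1 (z k).2.2 (x k) (d.firstInput (z k)) := fun k =>
    hd.stage_nonneg _ _ _ _
  have hq0 : ∀ k, 0 ≤ d.regCost 0 (y k - z (k + 1)) := fun k => hd.regCost_nonneg _ _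
  have hanti : Antitone J := antitone_nat_of_succ_le fun k => by
    linarith [hstep k, hst0 k, hq0 k]
  have hdiff : Filter.Tendsto (fun k => J k - J (k + 1)) Filter.atTop (𝓝 0) := by
    have h1 := tendsto_atTop_ciInf hanti ⟨0, by
      rintro _ ⟨k, rfl⟩
      exact (hVO.nonneg _).trans (hJ0 k)⟩
    simpa using h1.sub (h1.comp (Filter.tendsto_add_atTop_nat 1))
  have hst := squeeze_zero hst0 (fun k => by linarith [hstep k, hq0 k]) hdiff
  have hq := squeeze_zero hq0 (fun k => by linarith [hstep k, hst0 k]) hdiff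
  have hxa : Filter.Tendsto (fun k => (z k).2.1 - (z (k + 1)).2.1) Filter.atTop (𝓝 0) := by
    have := hd.tendsto_dir (fun k => hd.equilibrium_sub (hy k) (hz (k + 1))) hq
    simpa only [Prod.snd_sub, Prod.fst_sub, hy2] using this
  obtain ⟨hQ, hR⟩ := hd.stage_tendsto hst
  have he : Filter.Tendsto (fun k => x k - (z k).2.1) Filter.atTop (𝓝 0) := by
    refine hd.tendsto_zero (L := Filter.atTop) (e := fun j k => x (k + j) - (z (k + j)).2.1)
      (fun j => hQ.comp (Filter.tendsto_add_atTop_nat j)) (fun j => ?_)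
    have h1 := ((tendsto_mulVec_zero d.B hR).add hxa).comp (Filter.tendsto_add_atTop_nat j)
    rw [add_zero] at h1
    refine h1.congr fun k => ?_
    simp only [Function.comp_apply, ← add_assoc]
    rw [← hsucc (k + j), mulVec_sub, mulVec_sub,
      show d.A *ᵥ (z (k + j)).2.1 = (z (k + j)).2.1 - d.B *ᵥ (z (k + j)).2.2 from
        eq_sub_of_add_eq (hd.equilibrium (hz (k + j))).symm]
    abel
  obtain ⟨c₁, hc₁, hbd⟩ := hd.exists_equilibrium_bound
  have hza : ∀ k, ‖(z k).2 - (xsp, usp)‖ ≤ c₁ * ‖d.output (z k) - ysp‖ := by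
    intro k
    have h0 : xsp = d.A *ᵥ xsp + d.B *ᵥ usp := hsp.1.1
    have h1 := hbd ((z k).2.1 - xsp) ((z k).2.2 - usp) (by
      simp only [mulVec_sub]
      conv_lhs => rw [hd.equilibrium (hz k), h0]
      abel)
    have h2 : d.C *ᵥ ((z k).2.1 - xsp) + d.D *ᵥ ((z k).2.2 - usp) = d.output (z k) - ysp := by
      rw [output, hsp.2]
      simp only [mulVec_sub]
      abel
    rw [h2] at h1
    exact h1
  have hyl : ∀ k, ‖d.output (z k) - ysp‖ ≤ VO (d.output (z k)) ysp / γ := fun k => by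
    rw [le_div_iff₀ hγ, mul_comm]
    exact hVO.lower _ (hd.output_mem (hz k))
  -- A common bound for the distance of the artificial equilibria from the target, through the
  -- initial cost; the `1` makes it positive.
  set r := c₁ * (J 0 / γ) + 1 with hr
  have hJ00 : 0 ≤ J 0 := (hVO.nonneg _).trans (hJ0 0)
  have hrpos : 0 < r := by positivity
  have hzr : ∀ k, ‖(z k).2 - (xsp, usp)‖ ≤ r := by
    intro k
    have h1 : ‖d.output (z k) - ysp‖ ≤ J 0 / γ :=
      (hyl k).trans (by gcongr; exact (hJ0 k).trans (hanti (Nat.zero_le k)))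
    exact (hza k).trans (by rw [hr]; linarith [mul_le_mul_of_nonneg_left h1 hc₁])
  obtain ⟨ρ, hρ0, hρ⟩ := hd.exists_uniform_radius hsp.1 hrpos.le
  obtain ⟨c, hc0, hc⟩ := exists_quadForm_le d.P
  have hVOlim : Filter.Tendsto (fun k => VO (d.output (z k)) ysp) Filter.atTop (𝓝 0) := by
    rw [Metric.tendsto_atTop']
    intro η hη
    -- Once `‖x - x_a‖ < s r`, the estimate reads `s V_O ≤ c (2 s r)²`, that is `V_O ≤ 4 c s r²`.
    -- The condition `2 s r < ρ` keeps the competitor feasible.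
    have hev : ∀ᶠ s : ℝ in 𝓝[>] 0, s < 1 ∧ 2 * s * r < ρ ∧ 4 * c * s * r ^ 2 < η := by
      have h1 : Filter.Tendsto (fun s : ℝ => s) (𝓝[>] 0) (𝓝 0) := nhdsWithin_le_nhds
      have h2 : Filter.Tendsto (fun s : ℝ => 2 * s * r) (𝓝[>] 0) (𝓝 0) := by
        simpa using (h1.const_mul 2).mul_const r
      have h3 : Filter.Tendsto (fun s : ℝ => 4 * c * s * r ^ 2) (𝓝[>] 0) (𝓝 0) := by
        simpa using (h1.const_mul (4 * c)).mul_const (r ^ 2)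
      exact (h1.eventually (gt_mem_nhds one_pos)).and
        ((h2.eventually (gt_mem_nhds hρ0)).and (h3.eventually (gt_mem_nhds hη)))
    obtain ⟨s, ⟨hs1, hs2, hs3⟩, hs0⟩ := (hev.and self_mem_nhdsWithin).exists
    have hs0' : 0 < s := hs0
    have hsr : 0 < s * r := by positivity
    have hek : ∀ᶠ k in Filter.atTop, ‖x k - (z k).2.1‖ < s * r := by
      have := he.norm
      rw [norm_zero] at this
      exact this.eventually (gt_mem_nhds hsr)
    obtain ⟨k₀, hk₀⟩ := Filter.eventually_atTop.1 hek
    refine ⟨k₀, fun k hk => ?_⟩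
    have h1 := hk₀ k hk.le
    have h2 := hd.offset_le hsp hVO hρ (hz k) (hmin k) (hzr k) hs0'.le hs1.le (by linarith) hc0.le hc
    have h3 : c * (‖x k - (z k).2.1‖ + s * r) ^ 2 ≤ c * (2 * (s * r)) ^ 2 := by
      gcongr
      linarith
    rw [Real.dist_eq, sub_zero, abs_of_nonneg (hVO.nonneg _)]
    refine lt_of_mul_lt_mul_left ?_ hs0'.le
    nlinarith
  have hylim : Filter.Tendsto (fun k => ‖d.output (z k) - ysp‖) Filter.atTop (𝓝 0) :=
    squeeze_zero (fun k => norm_nonneg _) hyl (by simpa using hVOlim.div_const γ)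
  have hzlim : Filter.Tendsto (fun k => (z k).2.1 - xsp) Filter.atTop (𝓝 0) := by
    refine squeeze_zero_norm (fun k => (norm_fst_le ((z k).2 - (xsp, usp))).trans (hza k)) ?_
    simpa using hylim.const_mul c₁
  have := (he.add hzlim).add_const xsp
  simpa using this

end MPCData

namespace MPCData

variable {n m p : ℕ} {d : MPCData n m p} {ysp : Fin p → ℝ} {xsp : Fin n → ℝ} {usp : Fin m → ℝ}
  {κinf κN : (Fin n → ℝ) → Fin m → ℝ} {VO : (Fin p → ℝ) → (Fin p → ℝ) → ℝ} {γ : ℝ}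

/-! ### Polyhedral descriptions -/

section Affine

variable {E : Type*} [AddCommGroup E] [Module ℝ E]

@[fun_prop]
theorem isAffineFun_pred (d : MPCData n m p) {f : E → Fin n → ℝ} {g : E → Fin d.N → Fin m → ℝ}
    (hf : IsAffineFun f) (hg : IsAffineFun g) (j : ℕ) :
    IsAffineFun (fun q => d.pred (f q) (g q) j) := by
  induction j with
  | zero => exact hf
  | succ j ih =>
    simp only [pred]
    refine (ih.mulVec d.A).add (IsAffineFun.mulVec d.B ?_)
    split_ifs <;> fun_prop

@[fun_prop]
theorem isAffineFun_stageResidual (d : MPCData n m p) {f : E → Fin n → ℝ}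
    {g : E → MPCDecision d.N n m} (hf : IsAffineFun f) (hg : IsAffineFun g) (j : Fin d.N) :
    IsAffineFun (fun q => d.stageResidual (f q) (g q) j) := by
  unfold stageResidual
  fun_prop

@[fun_prop]
theorem isAffineFun_terminalResidual (d : MPCData n m p) {f : E → Fin n → ℝ}
    {g : E → MPCDecision d.N n m} (hf : IsAffineFun f) (hg : IsAffineFun g) :
    IsAffineFun (fun q => d.terminalResidual (f q) (g q)) := by
  unfold terminalResidual
  fun_prop

@[fun_prop]
theorem isAffineFun_output (d : MPCData n m p) {g : E → MPCDecision d.N n m}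
    (hg : IsAffineFun g) : IsAffineFun (fun q => d.output (g q)) := by
  unfold output
  fun_prop

/-- For a fixed direction, the derivative of the quadratic Lagrangian is jointly affine in state,
decision and multipliers. -/
theorem isAffineFun_lagDir (d : MPCData n m p) {f : E → Fin n → ℝ}
    {g : E → MPCDecision d.N n m} {lz : E → Fin d.N → Fin d.rZ → ℝ} {lo : E → Fin d.rO → ℝ}
    {ν : E → Fin p → ℝ} (hf : IsAffineFun f) (hg : IsAffineFun g) (hlz : IsAffineFun lz)
    (hlo : IsAffineFun lo) (hν : IsAffineFun ν) (δ : MPCDecision d.N n m) :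
    IsAffineFun (fun q => d.lagDir (f q) (lz q) (lo q) (ν q) (g q) δ) := by
  unfold lagDir regBilin
  fun_prop

end Affine

theorem lagDir_add (x : Fin n → ℝ) (lz : Fin d.N → Fin d.rZ → ℝ) (lo : Fin d.rO → ℝ)
    (ν : Fin p → ℝ) (z δ δ' : MPCDecision d.N n m) : d.lagDir x lz lo ν z (δ + δ')
      = d.lagDir x lz lo ν z δ + d.lagDir x lz lo ν z δ' := by
  simp only [lagDir, regBilin_add_right, stageDir_add, terminalDir_add, output_add, dotProduct_add,
    Finset.sum_add_distrib]
  ring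

theorem lagDir_smul (x : Fin n → ℝ) (lz : Fin d.N → Fin d.rZ → ℝ) (lo : Fin d.rO → ℝ)
    (ν : Fin p → ℝ) (z : MPCDecision d.N n m) (t : ℝ) (δ : MPCDecision d.N n m) :
    d.lagDir x lz lo ν z (t • δ) = t * d.lagDir x lz lo ν z δ := by
  simp only [lagDir, regBilin_smul_right, stageDir_smul, terminalDir_smul, output_smul,
    dotProduct_smul, smul_eq_mul, ← Finset.mul_sum]
  ring

theorem forall_lagDir_iff (x : Fin n → ℝ) (lz : Fin d.N → Fin d.rZ → ℝ) (lo : Fin d.rO → ℝ)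
    (ν : Fin p → ℝ) (z : MPCDecision d.N n m) : (∀ δ, d.lagDir x lz lo ν z δ = 0) ↔
      ∀ i, d.lagDir x lz lo ν z (Module.finBasis ℝ (MPCDecision d.N n m) i) = 0 := by
  refine ⟨fun h i => h _, fun h δ => ?_⟩
  let φ : MPCDecision d.N n m →ₗ[ℝ] ℝ := IsLinearMap.mk' (d.lagDir x lz lo ν z)
    ⟨lagDir_add x lz lo ν z, lagDir_smul x lz lo ν z⟩
  have : φ = 0 := (Module.finBasis ℝ (MPCDecision d.N n m)).ext fun i => h i
  exact LinearMap.congr_fun this δ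

/-- Complementarity written as a disjunction, and stationarity tested on a basis, turn the KKT
system into finitely many affine alternatives. -/
theorem Assumptions.isKKT_iff (hd : d.Assumptions) (x : Fin n → ℝ) (z : MPCDecision d.N n m)
    (lz : Fin d.N → Fin d.rZ → ℝ) (lo : Fin d.rO → ℝ) (ν : Fin p → ℝ) :
    d.IsKKT x ysp z lz lo ν ↔ (∀ j, d.stageResidual x z j ≤ 0) ∧ d.terminalResidual x z ≤ 0 ∧
      d.output z = ysp ∧ (∀ j i, 0 ≤ lz j i) ∧ (∀ i, 0 ≤ lo i) ∧
      (∀ j i, lz j i = 0 ∨ d.stageResidual x z j i = 0) ∧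
      (∀ i, lo i = 0 ∨ d.terminalResidual x z i = 0) ∧
      ∀ i, d.lagDir x lz lo ν z (Module.finBasis ℝ (MPCDecision d.N n m) i) = 0 := by
  rw [← forall_lagDir_iff, ← hd.stationary_iff x ysp]
  simp only [← mul_eq_zero]
  constructor
  · intro h
    have h1 := (trackFeasible_iff _ _).1 h.feasible.1
    exact ⟨h1.1, h1.2, h.feasible.2, h.lz_nonneg, h.lo_nonneg, h.lz_compl, h.lo_compl,
      h.stationary⟩
  · rintro ⟨h1, h2, h3, h4, h5, h6, h7, h8⟩
    exact ⟨⟨(trackFeasible_iff _ _).2 ⟨h1, h2⟩, h3⟩, h4, h5, h6, h7, h8⟩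

theorem Assumptions.isPolyUnion_isKKT (hd : d.Assumptions) {E : Type*} [AddCommGroup E]
    [Module ℝ E] {f : E → Fin n → ℝ} {g : E → MPCDecision d.N n m}
    {lz : E → Fin d.N → Fin d.rZ → ℝ} {lo : E → Fin d.rO → ℝ} {ν : E → Fin p → ℝ}
    (hf : IsAffineFun f) (hg : IsAffineFun g) (hlz : IsAffineFun lz)
    (hlo : IsAffineFun lo) (hν : IsAffineFun ν) :
    IsPolyUnion {q | d.IsKKT (f q) ysp (g q) (lz q) (lo q) (ν q)} := by
  simp only [hd.isKKT_iff]
  refine .and (.forall_fintype fun j => .le_pi (by fun_prop) (by fun_prop)) (.and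
    (.le_pi (by fun_prop) (by fun_prop)) (.and (.eq_pi (by fun_prop) (by fun_prop)) (.and
    (.forall_fintype fun j => .forall_fintype fun i => .le (by fun_prop) (by fun_prop)) (.and
    (.forall_fintype fun i => .le (by fun_prop) (by fun_prop)) (.and
    (.forall_fintype fun j => .forall_fintype fun i => .or (.eq (by fun_prop) (by fun_prop))
      (.eq (by fun_prop) (by fun_prop))) (.and
    (.forall_fintype fun i => .or (.eq (by fun_prop) (by fun_prop))
      (.eq (by fun_prop) (by fun_prop)))
    (.forall_fintype fun i => .eq (isAffineFun_lagDir d hf hg hlz hlo hν _) (by fun_prop))))))))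

theorem Assumptions.isPolyUnion_Gam (hd : d.Assumptions) (ysp : Fin p → ℝ) (γ : ℝ) :
    IsPolyUnion {x | (x, ysp) ∈ d.Gam γ} := by
  -- The last component is a majorant of `|ν|`, which makes the bound on the 1-norm linear.
  have : {x | (x, ysp) ∈ d.Gam γ} = {x | ∃ r : MPCDecision d.N n m × (Fin d.N → Fin d.rZ → ℝ) ×
      (Fin d.rO → ℝ) × (Fin p → ℝ) × (Fin p → ℝ),
      d.IsKKT x ysp r.1 r.2.1 r.2.2.1 r.2.2.2.1 ∧ (∀ i, r.2.2.2.1 i ≤ r.2.2.2.2 i) ∧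
      (∀ i, -r.2.2.2.1 i ≤ r.2.2.2.2 i) ∧ ∑ i, r.2.2.2.2 i ≤ γ} := by
    ext x
    constructor
    · rintro ⟨ν, ⟨z, lz, lo, h⟩, hν⟩
      exact ⟨(z, lz, lo, ν, fun i => |ν i|), h, fun i => le_abs_self _, fun i => neg_le_abs _, hν⟩
    · rintro ⟨⟨z, lz, lo, ν, t⟩, h, h1, h2, h3⟩
      exact ⟨ν, ⟨z, lz, lo, h⟩, (Finset.sum_le_sum fun i _ => abs_le'.2 ⟨h1 i, h2 i⟩).trans h3⟩
  rw [this]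
  refine IsPolyUnion.exists_prop (.and (hd.isPolyUnion_isKKT (by fun_prop) (by fun_prop)
    (by fun_prop) (by fun_prop) (by fun_prop)) (.and
    (.forall_fintype fun i => .le (by fun_prop) (by fun_prop)) (.and
    (.forall_fintype fun i => .le (by fun_prop) (by fun_prop)) (.le (by fun_prop) (by fun_prop)))))

/-! ### Changing the horizon -/

/-- The same data with another prediction horizon. -/
def withHorizon (d : MPCData n m p) (M : ℕ) (hM : 0 < M) : MPCData n m p :=
  { d with N := M, N_pos := hM }

theorem Assumptions.withHorizon (hd : d.Assumptions) {M : ℕ} (hM : 0 < M) :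
    (d.withHorizon M hM).Assumptions where
  zero_mem := hd.zero_mem
  proj_compact := hd.proj_compact
  lam_nonneg := hd.lam_nonneg
  lam_lt_one := hd.lam_lt_one
  equilibrium_unique := hd.equilibrium_unique
  R_posDef := hd.R_posDef
  Q_posSemidef := hd.Q_posSemidef
  observable := hd.observable
  schur := hd.schur
  P_posDef := hd.P_posDef
  lqr_gain := hd.lqr_gain
  lqr_cost := hd.lqr_cost
  omega_adm := hd.omega_adm
  omega_eq := hd.omega_eq
  omega_inv := hd.omega_inv
  omega_nhds := hd.omega_nhds

theorem closedLoop_withHorizon {M : ℕ} (hM : 0 < M) :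
    (d.withHorizon M hM).closedLoop = d.closedLoop := by
  funext κ x k
  induction k with
  | zero => rfl
  | succ k ih =>
    rw [closedLoop, closedLoop, ih]
    rfl

theorem costToGo_withHorizon {M : ℕ} (hM : 0 < M) :
    (d.withHorizon M hM).costToGo = d.costToGo := by
  funext xsp usp κ x
  rw [costToGo, costToGo, closedLoop_withHorizon]
  rfl

theorem admissibleFrom_withHorizon {M : ℕ} (hM : 0 < M) :
    (d.withHorizon M hM).AdmissibleFrom = d.AdmissibleFrom := by
  funext κ x
  rw [AdmissibleFrom, AdmissibleFrom, closedLoop_withHorizon]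
  rfl

theorem optDomain_withHorizon {M : ℕ} (hM : 0 < M) :
    (d.withHorizon M hM).optDomain = d.optDomain := by
  funext xsp usp
  rw [optDomain, optDomain, costToGo_withHorizon, admissibleFrom_withHorizon]

/-- The infinite-horizon problem does not see `N`, so one optimal law serves all prediction
horizons. -/
theorem IsOptimalLaw.withHorizon (hinf : d.IsOptimalLaw xsp usp κinf) {M : ℕ} (hM : 0 < M) :
    (d.withHorizon M hM).IsOptimalLaw xsp usp κinf := by
  rw [IsOptimalLaw, optDomain_withHorizon, costToGo_withHorizon, admissibleFrom_withHorizon]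
  exact hinf

theorem mem_upsilon_withHorizon {M : ℕ} (hM : 0 < M) {x : Fin n → ℝ} :
    x ∈ (d.withHorizon M hM).Upsilon xsp usp κinf ↔
      x ∈ d.optDomain xsp usp ∧ (d.closedLoop κinf x M, xsp, usp) ∈ d.Omega := by
  rw [← optDomain_withHorizon hM, ← closedLoop_withHorizon hM]
  rfl

theorem pred_withHorizon {M : ℕ} (hM : 0 < M) (hNM : d.N ≤ M) (x : Fin n → ℝ)
    (u : Fin (d.withHorizon M hM).N → Fin m → ℝ) {j : ℕ} (hj : j ≤ d.N) :
    (d.withHorizon M hM).pred x u j = d.pred x (fun i => u (Fin.castLE hNM i)) j := by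
  induction j with
  | zero => rfl
  | succ j ih =>
    have h1 : j < d.N := by omega
    have h2 : j < (d.withHorizon M hM).N := h1.trans_le hNM
    rw [pred, pred, ih (by omega), dif_pos h1, dif_pos h2]
    rfl

/-! ### Uniform convergence of the optimal law -/

/-- By contradiction: trajectories of bounded cost that are outside `U` at arbitrarily late times
must stay away from `xsp` until then. They contain long stretches of small stage cost, along which
observability brings them to `xsp` after all. -/
theorem Assumptions.exists_uniform_time (hd : d.Assumptions) (hsp : d.IsSetpoint ysp xsp usp)
    (hinf : d.IsOptimalLaw xsp usp κinf) (c : ℝ) {U : Set (Fin n → ℝ)} (hU : U ∈ 𝓝 xsp) :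
    ∃ T : ℕ, ∀ x, d.costToGo xsp usp κinf x ≤ ENNReal.ofReal c → ∀ t, T ≤ t →
      d.closedLoop κinf x t ∈ U := by
  obtain ⟨ε, hε, hsub⟩ := hd.exists_sublevel (Filter.inter_mem hU (hd.omega_nhds _ _ hsp.1))
  by_contra! hcon
  -- Time `(k + 1)²` leaves room for `k + 1` blocks of length `k + 1`: one of them has cost at most
  -- a `1 / (k + 1)` share, while the block lengths tend to infinity.
  choose x hx t ht hxt using fun k : ℕ => hcon ((k + 1) * (k + 1))
  -- Once in the sublevel set, which lies in the terminal region, the trajectory never leaves it,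
  -- and it is contained in `U`.
  have hfar : ∀ k, ∀ s ≤ (k + 1) * (k + 1),
      ε < quadForm d.P (d.closedLoop κinf (x k) s - xsp) := by
    intro k s hs
    by_contra! hle
    obtain ⟨i, hi⟩ := Nat.exists_eq_add_of_le (hs.trans (ht k))
    have h1 := hd.quadForm_closedLoop_le hsp hinf (hsub _ hle).2 i
    rw [closedLoop_add, ← hi] at h1
    exact hxt k (hsub _ (h1.trans hle)).1
  set ℓ : ℕ → ℕ → ℝ := fun k s => d.stage xsp usp (d.closedLoop κinf (x k) s)
    (κinf (d.closedLoop κinf (x k) s)) with hℓ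
  have hℓ0 : ∀ k s, 0 ≤ ℓ k s := fun k s => hd.stage_nonneg _ _ _ _
  have hsum : ∀ k N, ∑ s ∈ Finset.range N, ℓ k s ≤ max c 0 := by
    intro k N
    rw [← ENNReal.ofReal_le_ofReal_iff (le_max_right _ _)]
    refine le_trans ?_ ((hx k).trans (ENNReal.ofReal_le_ofReal (le_max_left _ _)))
    rw [hd.costToGo_add xsp usp κinf (x k) N]
    exact le_self_add
  have hblock : ∀ k : ℕ, ∃ i < k + 1, ∀ j < k + 1,
      ℓ k (i * (k + 1) + j) ≤ max c 0 / ((k : ℝ) + 1) := by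
    intro k
    have h1 := Finset.sum_range_sub (fun i => ∑ s ∈ Finset.range (i * (k + 1)), ℓ k s) (k + 1)
    have h2 : ∑ i ∈ Finset.range (k + 1), (∑ s ∈ Finset.range ((i + 1) * (k + 1)), ℓ k s
        - ∑ s ∈ Finset.range (i * (k + 1)), ℓ k s)
        ≤ ∑ i ∈ Finset.range (k + 1), max c 0 / ((k : ℝ) + 1) := by
      rw [h1, Finset.sum_const, Finset.card_range, nsmul_eq_mul, Nat.cast_add, Nat.cast_one,
        mul_div_cancel₀ _ (by positivity : (k : ℝ) + 1 ≠ 0)]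
      simpa using hsum k _
    obtain ⟨i, hi, h3⟩ := Finset.exists_le_of_sum_le ⟨0, by simp⟩ h2
    refine ⟨i, Finset.mem_range.1 hi, fun j hj => le_trans ?_ h3⟩
    rw [add_mul, one_mul, Finset.sum_range_add, add_sub_cancel_left]
    exact Finset.single_le_sum (f := fun j => ℓ k (i * (k + 1) + j)) (fun _ _ => hℓ0 _ _)
      (Finset.mem_range.2 hj)
  choose i hi hiℓ using hblock
  have hlim : ∀ j, Filter.Tendsto (fun k => ℓ k (i k * (k + 1) + j)) Filter.atTop (𝓝 0) := by
    intro j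
    have h1 : Filter.Tendsto (fun k : ℕ => max c 0 / ((k : ℝ) + 1)) Filter.atTop (𝓝 0) := by
      simpa [div_eq_mul_inv] using (tendsto_one_div_add_atTop_nhds_zero_nat (𝕜 := ℝ)).const_mul
        (max c 0)
    refine squeeze_zero' (Filter.Eventually.of_forall fun k => hℓ0 _ _) ?_ h1
    filter_upwards [Filter.eventually_ge_atTop j] with k hk
    exact hiℓ k j (by omega)
  have h0 : Filter.Tendsto (fun k => d.closedLoop κinf (x k) (i k * (k + 1) + 0) - xsp)
      Filter.atTop (𝓝 0) := by
    have h1 := fun j => hd.stage_tendsto (xa := fun _ => xsp) (ua := fun _ => usp) (hlim j)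
    refine hd.tendsto_zero (L := Filter.atTop)
      (e := fun j k => d.closedLoop κinf (x k) (i k * (k + 1) + j) - xsp)
      (fun j => (h1 j).1) fun j => (tendsto_mulVec_zero d.B (h1 j).2).congr fun k => ?_
    rw [← add_assoc, closedLoop, mulVec_sub, mulVec_sub,
      show d.A *ᵥ xsp = xsp - d.B *ᵥ usp from eq_sub_of_add_eq hsp.1.1.symm]
    abel
  have h1 := ((continuous_quadForm d.P).tendsto 0).comp h0
  rw [quadForm_zero] at h1
  obtain ⟨k, hk⟩ := (h1.eventually (gt_mem_nhds hε)).exists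
  refine lt_irrefl ε ((hfar k _ ?_).trans hk)
  rw [add_zero]
  exact Nat.mul_le_mul_right _ (hi k).le

/-- State and inputs range over bounded sets and the artificial equilibrium is fixed, so the
continuous cost is bounded on a compact set. -/
theorem Assumptions.exists_regCost_le (hd : d.Assumptions) (hsp : d.IsSetpoint ysp xsp usp)
    (hZ : Bornology.IsBounded d.Z) :
    ∃ c, ∀ x z, d.RegFeasible x ysp z → d.regCost x z ≤ c := by
  have hK : IsCompact (closure d.Z) := hZ.isCompact_closure
  have hK' : IsCompact ((Prod.fst '' closure d.Z) ×ˢ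
      ((Set.univ.pi fun _ : Fin d.N => Prod.snd '' closure d.Z) ×ˢ
        (({xsp} : Set (Fin n → ℝ)) ×ˢ ({usp} : Set (Fin m → ℝ))))) :=
    (hK.image continuous_fst).prod ((isCompact_univ_pi fun _ => hK.image continuous_snd).prod
      (isCompact_singleton.prod isCompact_singleton))
  obtain ⟨c, hc⟩ := hK'.exists_bound_of_continuousOn (continuous_regCost (d := d)).continuousOn
  refine ⟨c, fun x z hz => (le_abs_self _).trans (hc (x, z) ⟨?_, ?_, ?_⟩)⟩
  · exact ⟨_, subset_closure (hz.1.1 ⟨0, d.N_pos⟩), rfl⟩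
  · exact fun j _ => ⟨_, subset_closure (hz.1.1 j), rfl⟩
  · exact hd.eq_of_regFeasible hsp hz

/-- For bounded constraint sets, `𝒲` is described by the optimality conditions of a regulation
problem with a long horizon and by finitely many of the conditions on the multipliers. -/
theorem Assumptions.exists_horizon (hd : d.Assumptions) (hsp : d.IsSetpoint ysp xsp usp)
    (hinf : d.IsOptimalLaw xsp usp κinf) (hγ : 0 < γ) (hVO : d.IsOffsetCost VO ysp γ)
    (hN : d.IsTrackLaw VO ysp κN) (hZ : Bornology.IsBounded d.Z) :
    ∃ (M : ℕ) (hM : 0 < M), ∀ x, x ∈ d.W γ ysp xsp usp κinf κN ↔ ∃ z lz lo ν,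
      (d.withHorizon M hM).IsKKT x ysp z lz lo ν ∧
      ((d.withHorizon M hM).pred x z.1 d.N, xsp, usp) ∈ d.Omega ∧
      ∀ i : Fin (M + 1), ((d.withHorizon M hM).pred x z.1 i, ysp) ∈ d.Gam γ := by
  obtain ⟨c, hc⟩ := hd.exists_regCost_le hsp hZ
  obtain ⟨T, hT⟩ := hd.exists_uniform_time hsp hinf c
    (Filter.inter_mem (hd.omega_nhds _ _ hsp.1) (hd.gam_mem_nhds hsp hγ))
  have hNM : d.N ≤ max d.N T := le_max_left _ _
  have hM : 0 < max d.N T := d.N_pos.trans_le hNM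
  have hTM : T ≤ max d.N T := le_max_right _ _
  generalize max d.N T = M at hNM hM hTM
  have hdM := hd.withHorizon hM
  have hspM : (d.withHorizon M hM).IsSetpoint ysp xsp usp := hsp
  have hinfM := hinf.withHorizon hM
  have hpred : ∀ x, ∀ i ≤ M, (d.withHorizon M hM).pred x
      ((d.withHorizon M hM).lawDecision xsp usp κinf x).1 i = d.closedLoop κinf x i := by
    intro x i hi
    rw [← closedLoop_withHorizon hM]
    exact pred_lawDecision (d := d.withHorizon M hM) κinf x hi
  refine ⟨M, hM, fun x => ?_⟩
  rw [hd.mem_W_iff hsp hinf hVO hN]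
  constructor
  · rintro ⟨hx, hG⟩
    have hxM : x ∈ (d.withHorizon M hM).Upsilon xsp usp κinf := by
      rw [mem_upsilon_withHorizon]
      refine ⟨hx.1, ?_⟩
      have := (hd.upsilon_iterate hsp hinf hx (M - d.N)).2
      rwa [closedLoop_add, Nat.sub_add_cancel hNM] at this
    obtain ⟨lz, lo, ν, hk⟩ := hdM.exists_isKKT (hinfM.regFeasible hspM hxM)
      (hdM.lawDecision_optimal hspM hinfM hxM).1
    refine ⟨_, lz, lo, ν, hk, ?_, fun i => ?_⟩
    · rw [hpred x _ hNM]
      exact hx.2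
    · rw [hpred x i (Nat.lt_succ_iff.1 i.2)]
      exact hG i
  · rintro ⟨z, lz, lo, ν, hk, hΩ, hG⟩
    obtain ⟨e1, e2⟩ := hdM.eq_of_regFeasible hspM hk.feasible
    -- The first `N` inputs of the long solution are feasible for the original problem. The
    -- resulting uniform cost bound puts `κ_∞` in the terminal region at time `M`, and uniqueness
    -- then identifies the long solution with the trajectory of `κ_∞`.
    have hzN : d.RegFeasible x ysp (fun i => z.1 (Fin.castLE hNM i), xsp, usp) := by
      refine ⟨⟨fun j => ?_, ?_⟩, hsp.2.symm⟩
      · have := hk.feasible.1.1 (Fin.castLE hNM j)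
        change ((d.withHorizon M hM).pred x z.1 (j : ℕ), _) ∈ _ at this
        rw [pred_withHorizon hM hNM x z.1 j.2.le] at this
        exact this
      · rw [pred_withHorizon hM hNM x z.1 le_rfl] at hΩ
        exact hΩ
    have hcost := (hd.optLaw_costToGo_le hsp hinf hzN).trans
      (ENNReal.ofReal_le_ofReal (hc _ _ hzN))
    have hxM : x ∈ (d.withHorizon M hM).Upsilon xsp usp κinf := by
      rw [mem_upsilon_withHorizon]
      exact ⟨hd.mem_optDomain hsp ⟨_, hzN⟩, (hT x hcost M hTM).1⟩
    have hz : z = (d.withHorizon M hM).lawDecision xsp usp κinf x :=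
      hdM.reg_unique (hinfM.regFeasible hspM hxM) hk.feasible
        (hdM.lawDecision_optimal hspM hinfM hxM).1
        (hk.isMin hdM (hinfM.regFeasible hspM hxM))
    subst hz
    refine ⟨⟨hd.mem_optDomain hsp ⟨_, hzN⟩, ?_⟩, fun i => ?_⟩
    · rwa [hpred x _ hNM] at hΩ
    · rcases Nat.lt_or_ge i (M + 1) with hi | hi
      · have := hG ⟨i, hi⟩
        rwa [hpred x _ (Nat.lt_succ_iff.1 hi)] at this
      -- Beyond `M` the conditions on `Γ(γ)` hold automatically, by the choice of `T`.
      · exact (hT x hcost i (by omega)).2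

theorem Assumptions.isPolygon_W (hd : d.Assumptions) (hsp : d.IsSetpoint ysp xsp usp)
    (hinf : d.IsOptimalLaw xsp usp κinf) (hγ : 0 < γ) (hVO : d.IsOffsetCost VO ysp γ)
    (hN : d.IsTrackLaw VO ysp κN) (hZ : Bornology.IsBounded d.Z) :
    IsPolygon (d.W γ ysp xsp usp κinf κN) := by
  obtain ⟨M, hM, h⟩ := hd.exists_horizon hsp hinf hγ hVO hN hZ
  have hW : d.W γ ysp xsp usp κinf κN = {x | ∃ r : MPCDecision M n m × (Fin M → Fin d.rZ → ℝ) ×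
      (Fin d.rO → ℝ) × (Fin p → ℝ),
      (d.withHorizon M hM).IsKKT x ysp r.1 r.2.1 r.2.2.1 r.2.2.2 ∧
      ((d.withHorizon M hM).pred x r.1.1 d.N, xsp, usp) ∈ d.Omega ∧
      ∀ i : Fin (M + 1), ((d.withHorizon M hM).pred x r.1.1 i, ysp) ∈ d.Gam γ} := by
    ext x
    rw [h x]
    exact ⟨fun ⟨z, lz, lo, ν, h⟩ => ⟨(z, lz, lo, ν), h⟩,
      fun ⟨r, h⟩ => ⟨r.1, r.2.1, r.2.2.1, r.2.2.2, h⟩⟩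
  rw [hW]
  have hpred : ∀ i : ℕ, IsAffineFun (fun q : (Fin n → ℝ) × MPCDecision M n m ×
      (Fin M → Fin d.rZ → ℝ) × (Fin d.rO → ℝ) × (Fin p → ℝ) =>
      (d.withHorizon M hM).pred q.1 q.2.1.1 i) := fun i =>
    isAffineFun_pred (d.withHorizon M hM) (E := (Fin n → ℝ) × MPCDecision M n m ×
      (Fin M → Fin d.rZ → ℝ) × (Fin d.rO → ℝ) × (Fin p → ℝ)) (f := fun q => q.1)
      (g := fun q => q.2.1.1) (by fun_prop) (by fun_prop) i
  refine (IsPolyUnion.exists_prop ?_).isPolygon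
  refine .and ?_ (.and ?_ ?_)
  · exact (hd.withHorizon hM).isPolyUnion_isKKT (E := (Fin n → ℝ) × MPCDecision M n m ×
      (Fin M → Fin d.rZ → ℝ) × (Fin d.rO → ℝ) × (Fin p → ℝ)) (f := fun q => q.1)
      (g := fun q => q.2.1) (lz := fun q => q.2.2.1) (lo := fun q => q.2.2.2.1)
      (ν := fun q => q.2.2.2.2) (by fun_prop) (by fun_prop) (by fun_prop) (by fun_prop)
      (by fun_prop)
  · exact IsPolyUnion.le_pi ((((hpred d.N).mulVec d.Hx).add (.const (d.Ha *ᵥ xsp))).add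
      (.const (d.Hu *ᵥ usp)))
      (.const _)
  · exact .forall_fintype fun i => (hd.isPolyUnion_Gam ysp γ).preimage (hpred i)

end MPCData

/-! ### Entry into `𝒲` and the main theorem -/

namespace MPCData

variable {n m p : ℕ} {d : MPCData n m p} {ysp : Fin p → ℝ} {xsp : Fin n → ℝ} {usp : Fin m → ℝ}
  {κr κinf κN : (Fin n → ℝ) → Fin m → ℝ} {VO : (Fin p → ℝ) → (Fin p → ℝ) → ℝ} {γ : ℝ}

theorem regRegion_subset_trackRegion (d : MPCData n m p) (ysp : Fin p → ℝ) :
    d.regRegion ysp ⊆ d.trackRegion := fun _ ⟨z, hz⟩ => ⟨z, hz.1⟩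

theorem Assumptions.self_mem_regRegion (hd : d.Assumptions) (hsp : d.IsSetpoint ysp xsp usp) :
    xsp ∈ d.regRegion ysp := by
  have h : xsp ∈ {x | (x, xsp, usp) ∈ d.Omega} := mem_of_mem_nhds (hd.omega_nhds _ _ hsp.1)
  obtain ⟨z, hz, e1, e2, -⟩ := hd.exists_lqr_decision h
  exact ⟨z, hz, by rw [output, e1, e2, ← hsp.2]⟩

/-- Trajectories of the tracking MPC enter `𝒲`, after which the law is the optimal one. -/
theorem Assumptions.exists_mem_W (hd : d.Assumptions) (hsp : d.IsSetpoint ysp xsp usp)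
    (hinf : d.IsOptimalLaw xsp usp κinf) (hγ : 0 < γ) (hVO : d.IsOffsetCost VO ysp γ)
    (hN : d.IsTrackLaw VO ysp κN) {x : Fin n → ℝ} (hx : x ∈ d.regRegion ysp) :
    ∃ k₀ : ℕ, d.closedLoop κN x k₀ ∈ d.W γ ysp xsp usp κinf κN ∧
      ∀ k, k₀ ≤ k → κN (d.closedLoop κN x k) = κinf (d.closedLoop κN x k) := by
  have h1 := (hd.trackLaw_tendsto hsp hγ hVO hN (d.regRegion_subset_trackRegion ysp hx)).eventually
    (Filter.inter_mem (hd.upsilon_mem_nhds hsp hinf) (hd.gam_mem_nhds hsp hγ))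
  obtain ⟨k₀, hk₀⟩ := Filter.eventually_atTop.1 h1
  refine ⟨k₀, ⟨(hk₀ k₀ le_rfl).1, fun i => ?_⟩, fun k hk => ?_⟩
  · rw [closedLoop_add]
    exact (hk₀ _ (Nat.le_add_right _ _)).2
  · exact hd.trackLaw_eq_optLaw hsp hinf hVO hN (hk₀ k hk).1 (hk₀ k hk).2

theorem Assumptions.W_nonempty (hd : d.Assumptions) (hsp : d.IsSetpoint ysp xsp usp)
    (hinf : d.IsOptimalLaw xsp usp κinf) (hγ : 0 < γ) (hVO : d.IsOffsetCost VO ysp γ)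
    (hN : d.IsTrackLaw VO ysp κN) : (d.W γ ysp xsp usp κinf κN).Nonempty := by
  obtain ⟨k, hk, -⟩ := hd.exists_mem_W hsp hinf hγ hVO hN (hd.self_mem_regRegion hsp)
  exact ⟨_, hk⟩

theorem Assumptions.trackLaw_eq_regLaw_of_gamMax (hd : d.Assumptions)
    (hsp : d.IsSetpoint ysp xsp usp) (hr : d.IsRegLaw ysp κr) (hVO : d.IsOffsetCost VO ysp γ)
    (hN : d.IsTrackLaw VO ysp κN) (hmax : d.gamMax ≤ (γ : EReal)) {x : Fin n → ℝ}
    (hx : x ∈ d.regRegion ysp) (k : ℕ) :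
    κN (d.closedLoop κN x k) = κr (d.closedLoop κN x k) := by
  have heq : ∀ x ∈ d.regRegion ysp, κN x = κr x := fun x hx =>
    hd.trackLaw_eq_regLaw hVO hN hr fun ε hε => mem_Gam_of_gamMax hmax hx hε
  -- As the two laws agree on the feasible region of the regulation problem, recursive feasibility
  -- passes from `κr` to `κN`.
  have hmem : d.closedLoop κN x k ∈ d.regRegion ysp := by
    induction k with
    | zero => exact hx
    | succ k ih =>
      obtain ⟨z, hz⟩ := id ih
      obtain ⟨-, z', hz', -⟩ := hd.regLaw_step hsp hr hz
      rw [closedLoop, heq _ ih]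
      exact ⟨z', hz'⟩
  exact heq _ hmem

end MPCData

theorem mainTheorem4 {n m p : ℕ} (d : MPCData n m p) (hd : d.Assumptions)
    (ysp : Fin p → ℝ) (xsp : Fin n → ℝ) (usp : Fin m → ℝ) (hsp : d.IsSetpoint ysp xsp usp)
    (κr κinf : (Fin n → ℝ) → (Fin m → ℝ))
    (hr : d.IsRegLaw ysp κr) (hinf : d.IsOptimalLaw xsp usp κinf) :
    (∀ (γ : ℝ) (VO : (Fin p → ℝ) → (Fin p → ℝ) → ℝ) (κN : (Fin n → ℝ) → (Fin m → ℝ)),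
      d.IsOffsetCost VO ysp γ → d.IsTrackLaw VO ysp κN → d.gamMin < (γ : EReal) →
        (d.W γ ysp xsp usp κinf κN).Nonempty ∧
        (Bornology.IsBounded d.Z → IsPolygon (d.W γ ysp xsp usp κinf κN)) ∧
        (∀ x ∈ d.W γ ysp xsp usp κinf κN,
          d.A *ᵥ x + d.B *ᵥ κN x ∈ d.W γ ysp xsp usp κinf κN)) ∧
    (∀ (γa γb : ℝ) (VOa VOb : (Fin p → ℝ) → (Fin p → ℝ) → ℝ)
        (κNa κNb : (Fin n → ℝ) → (Fin m → ℝ)),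
      d.IsOffsetCost VOa ysp γa → d.IsTrackLaw VOa ysp κNa →
      d.IsOffsetCost VOb ysp γb → d.IsTrackLaw VOb ysp κNb →
      d.gamMin < (γa : EReal) → γa ≤ γb →
        d.W γa ysp xsp usp κinf κNa ⊆ d.W γb ysp xsp usp κinf κNb) ∧
    (∀ (γ : ℝ) (VO : (Fin p → ℝ) → (Fin p → ℝ) → ℝ) (κN : (Fin n → ℝ) → (Fin m → ℝ))
        (x0 : Fin n → ℝ),
      d.IsOffsetCost VO ysp γ → d.IsTrackLaw VO ysp κN → d.gamMin < (γ : EReal) →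
      x0 ∈ d.regRegion ysp →
        (∃ k₀ : ℕ, d.closedLoop κN x0 k₀ ∈ d.W γ ysp xsp usp κinf κN ∧
          ∀ k, k₀ ≤ k → κN (d.closedLoop κN x0 k) = κinf (d.closedLoop κN x0 k)) ∧
        (d.gamMax ≤ (γ : EReal) →
          (∀ k, κN (d.closedLoop κN x0 k) = κr (d.closedLoop κN x0 k)) ∧
          ∃ k₀ : ℕ, d.closedLoop κN x0 k₀ ∈ d.Upsilon xsp usp κinf ∧
            ∀ k, k₀ ≤ k → κN (d.closedLoop κN x0 k) = κinf (d.closedLoop κN x0 k))) := by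
  have hpos : ∀ {γ : ℝ}, d.gamMin < (γ : EReal) → 0 < γ := fun h =>
    EReal.coe_pos.1 (MPCData.gamMin_nonneg.trans_lt h)
  refine ⟨fun γ VO κN hVO hN hγ => ⟨hd.W_nonempty hsp hinf (hpos hγ) hVO hN,
    hd.isPolygon_W hsp hinf (hpos hγ) hVO hN, fun x hx => (hd.W_succ hsp hinf hVO hN hx).2⟩,
    fun γa γb VOa VOb κNa κNb hVOa hNa hVOb hNb _ hab x hx => ?_,
    fun γ VO κN x₀ hVO hN hγ hx₀ => ?_⟩
  · rw [hd.mem_W_iff hsp hinf hVOa hNa] at hx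
    rw [hd.mem_W_iff hsp hinf hVOb hNb]
    exact ⟨hx.1, fun i => MPCData.Gam_mono hab (hx.2 i)⟩
  · have h := hd.exists_mem_W hsp hinf (hpos hγ) hVO hN hx₀
    refine ⟨h, fun hmax => ⟨hd.trackLaw_eq_regLaw_of_gamMax hsp hr hVO hN hmax hx₀, ?_⟩⟩
    obtain ⟨k₀, h1, h2⟩ := h
    exact ⟨k₀, h1.1, h2⟩
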